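/- Let $M$ be a smooth manifold of dimension $n$ (Hausdorff, second countable, without boundary) and let $L\subset TM\oplus T^*M$ be a Dirac structure on $M$, i.e. a smooth maximal isotropic subbundle whose sections are closed under the Courant bracket. For a Poisson manifold $(P,\Pi)$ write $\sharp\colon T^*P\to TP$ for the contraction with $\Pi$ and $L_P=\{(\sharp\xi,\xi)\}$. Say that $(M,L)$ \emph{embeds coisotropically} in $(P,\Pi)$ if there is a smooth embedding $i\colon M\to P$ such that $\sharp N^*i(M)\subset T\,i(M)$, where $N^*i(M)$ is the conormal bundle, and $i^*L_P=L$, where $(i^*L_P)_x=\{(v,\xi\circ d_xi) : (d_xi(v),\xi)\in (L_P)_{i(x)}\}$. (1) If $M$ is connected, then $(M,L)$ embeds coisotropically in some Poisson manifold if and only if $L\cap TM$ has constant rank. (2) For arbitrary $M$, if $(M,L)$ embeds coisotropically in some Poisson manifold, then the rank of $L\cap TM$ is locally constant. (3) For arbitrary $M$, suppose that $E:=L\cap TM$ has constant rank $k$. Then $(M,L)$ embeds coisotropically in some Poisson manifold. More precisely, $E$ has a smooth complement in $TM$, the family of dual spaces $E^*$ is a smooth vector bundle $\pi\colon E^*\to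 M$ of rank $k$ for which the restriction map $T^*M\to E^*$ is smooth, and the following holds for every smooth distribution $V$ with $TM=E\oplus V$. Let $i_V\colon E^*\to T^*M$ be the map that extends a linear form on $E_x$ by zero on $V_x$, let $\omega_{T^*M}$ be the canonical symplectic form of $T^*M$, and for a $2$-form $B$ let $\tau_B(L')=\{(X,\xi+i_XB):(X,\xi)\in L'\}$. Then there is an open neighbourhood $U$ of the zero section of $E^*$ on which $\tau_{i_V^*\omega_{T^*M}}(\pi^*L)$ is the graph $\{(\sharp\xi,\xi)\}$ of a Poisson structure, and the zero section $M\to U$ embeds $(M,L)$ coisotropically in this Poisson manifold. -/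

import Mathlib

open scoped Manifold ContDiff Bundle Topology
open Bundle Set TopologicalSpace

noncomputable section

namespace DiracGeom

universe u v w

/-! ### Dirac linear algebra -/

section Linear

variable {T T' : Type*} [TopologicalSpace T] [AddCommGroup T] [Module ℝ T]
  [TopologicalSpace T'] [AddCommGroup T'] [Module ℝ T']

/-- The pullback `A^*b` of a bilinear form `b` by a linear map `A`. A bilinear form is written as
the map `v ↦ i_v b = b (v, ·)`. -/
def pullbackTensor (A : T →L[ℝ] T') (b : T' →ₗ[ℝ] (T' →L[ℝ] ℝ)) : T →ₗ[ℝ] (T →L[ℝ] ℝ) where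
  toFun v := (b (A v)).comp A
  map_add' v w := by ext; simp
  map_smul' c v := by ext; simp

/-- The pullback of a subspace `L ⊆ T' ⊕ T'^*` (a Dirac structure on `T'`) by a linear map
`A : T → T'`, namely `{(v, A^* ξ) | (A v, ξ) ∈ L}`. -/
def pullbackDirac (A : T →L[ℝ] T') (L : Submodule ℝ (T' × (T' →L[ℝ] ℝ))) :
    Submodule ℝ (T × (T →L[ℝ] ℝ)) where
  carrier := {p | ∃ ξ : T' →L[ℝ] ℝ, (A p.1, ξ) ∈ L ∧ p.2 = ξ.comp A}
  zero_mem' := ⟨0, by rw [Prod.fst_zero, map_zero]; exact L.zero_mem, by simp⟩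
  add_mem' := by
    rintro p q ⟨ξ, hξ, hp⟩ ⟨η, hη, hq⟩
    exact ⟨ξ + η, by simpa using L.add_mem hξ hη, by simp [hp, hq]⟩
  smul_mem' := by
    rintro c p ⟨ξ, hξ, hp⟩
    exact ⟨c • ξ, by simpa using L.smul_mem c hξ, by simp [hp]⟩

/-- The gauge transformation `τ_B L = {(X, ξ + i_X B) | (X, ξ) ∈ L}`. -/
def gaugeTransform (B : T →ₗ[ℝ] (T →L[ℝ] ℝ)) (L : Submodule ℝ (T × (T →L[ℝ] ℝ))) :
    Submodule ℝ (T × (T →L[ℝ] ℝ)) :=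
  L.map ((LinearMap.fst ℝ T (T →L[ℝ] ℝ)).prod
    (LinearMap.snd ℝ T (T →L[ℝ] ℝ) + B ∘ₗ LinearMap.fst ℝ T (T →L[ℝ] ℝ)))

end Linear

/-! ### Vector fields, `1`-forms and the Courant bracket -/

section Forms

variable {E : Type u} [NormedAddCommGroup E] [NormedSpace ℝ E]
  {H : Type v} [TopologicalSpace H] (I : ModelWithCorners ℝ E H)
  {M : Type w} [TopologicalSpace M] [ChartedSpace H M]

/-- The cotangent space `T*ₓM`. -/
abbrev Cotangent (x : M) : Type u := TangentSpace I x →L[ℝ] Bundle.Trivial M ℝ x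

variable (M) in
/-- The total space of the cotangent bundle `T*M`, with Mathlib's structure of a manifold on the
bundle of continuous linear maps from `TM` to the trivial line bundle. -/
abbrev CotangentBundle : Type (max u w) :=
  TotalSpace (E →L[ℝ] ℝ) (fun x : M => Cotangent I x)

/-- The vector field `X` is smooth on `U`. -/
def SmoothVectorFieldOn [IsManifold I ∞ M] (X : Π x : M, TangentSpace I x) (U : Set M) : Prop :=
  ContMDiffOn I (I.prod 𝓘(ℝ, E)) ∞ (fun x => (⟨x, X x⟩ : TangentBundle I M)) U

/-- The `1`-form `α` is smooth on `U`. -/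
def SmoothOneFormOn [IsManifold I ∞ M] (α : Π x : M, Cotangent I x) (U : Set M) : Prop :=
  ContMDiffOn I (I.prod 𝓘(ℝ, E →L[ℝ] ℝ)) ∞ (fun x => (⟨x, α x⟩ : CotangentBundle I M)) U

/-- The differential of a function. -/
def d0 (f : M → ℝ) (x : M) : Cotangent I x :=
  (mfderiv I 𝓘(ℝ, ℝ) f x : TangentSpace I x →L[ℝ] ℝ)

/-- A `1`-form read in the preferred chart at `x₀`: its pullback by the inverse of that chart. -/
def oneFormInChart (α : Π x : M, Cotangent I x) (x₀ : M) (y : E) : E →L[ℝ] ℝ :=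
  (α ((extChartAt I x₀).symm y)).comp
    (mfderivWithin 𝓘(ℝ, E) I (extChartAt I x₀).symm (range I) y :
      E →L[ℝ] TangentSpace I ((extChartAt I x₀).symm y))

/-- The exterior derivative of a `1`-form `α` at `x`, as the map `v ↦ i_v dα`. It is computed in
the preferred chart at `x`, by `da (v, w) = D_v (a (w)) - D_w (a (v))` for a `1`-form `a` on a
vector space and constant `v`, `w`, and pulled back to `M`. -/
def d1 (α : Π x : M, Cotangent I x) (x : M) : TangentSpace I x →ₗ[ℝ] Cotangent I x :=
  let D : E →L[ℝ] E →L[ℝ] ℝ :=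
    fderivWithin ℝ (oneFormInChart I α x) (range I) (extChartAt I x x)
  pullbackTensor (mfderiv I 𝓘(ℝ, E) (extChartAt I x) x : TangentSpace I x →L[ℝ] E)
    ((D - D.flip : E →L[ℝ] E →L[ℝ] ℝ) : E →ₗ[ℝ] (E →L[ℝ] ℝ))

/-- The Courant bracket of sections of `TM ⊕ T*M`,
`[(X, α), (Y, β)] = ([X, Y], ℒ_X β - ℒ_Y α + ½ d(α(Y) - β(X)))`,
where Cartan's formula `ℒ_X β = i_X dβ + d(β(X))` has been inserted, so that the second component
reads `i_X dβ - i_Y dα + ½ d(β(X) - α(Y))`. -/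
def courantBracket (X : Π x : M, TangentSpace I x) (α : Π x : M, Cotangent I x)
    (Y : Π x : M, TangentSpace I x) (β : Π x : M, Cotangent I x) (x : M) :
    TangentSpace I x × Cotangent I x :=
  (VectorField.mlieBracket I X Y x,
    d1 I β x (X x) - d1 I α x (Y x)
      + (1 / 2 : ℝ) • d0 I (fun y => (β y (X y) - α y (Y y) : ℝ)) x)

/-- `V` is a smooth distribution (a smooth subbundle of `TM`): near each point it has a frame of
smooth vector fields. -/
def IsSmoothDistribution [IsManifold I ∞ M] (V : Π x : M, Submodule ℝ (TangentSpace I x)) :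
    Prop :=
  ∀ x₀ : M, ∃ U : Set M, IsOpen U ∧ x₀ ∈ U ∧
    ∃ (r : ℕ) (X : Fin r → Π x : M, TangentSpace I x),
      (∀ i, SmoothVectorFieldOn I (X i) U) ∧
      ∀ x ∈ U, LinearIndependent ℝ (fun i => X i x) ∧
        V x = Submodule.span ℝ (range fun i => X i x)

/-- The canonical `1`-form on `T*M`, whose value at the covector `p` is `p ∘ dπ`. -/
def canonicalOneForm [IsManifold I ∞ M] (p : CotangentBundle I M) :
    Cotangent (I.prod 𝓘(ℝ, E →L[ℝ] ℝ)) p :=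
  p.2.comp (mfderiv (I.prod 𝓘(ℝ, E →L[ℝ] ℝ)) I
    (TotalSpace.proj : CotangentBundle I M → M) p)

/-- The canonical symplectic form on `T*M`, the differential of the canonical `1`-form
(in coordinates, `∑ dpᵢ ∧ dqᵢ`). -/
def canonicalSymplecticForm [IsManifold I ∞ M] (p : CotangentBundle I M) :
    TangentSpace (I.prod 𝓘(ℝ, E →L[ℝ] ℝ)) p →ₗ[ℝ] Cotangent (I.prod 𝓘(ℝ, E →L[ℝ] ℝ)) p :=
  d1 (I.prod 𝓘(ℝ, E →L[ℝ] ℝ)) (canonicalOneForm I) p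

end Forms

/-! ### Dirac structures and Poisson structures -/

section Structures

variable {E : Type u} [NormedAddCommGroup E] [NormedSpace ℝ E]
  {H : Type v} [TopologicalSpace H] (I : ModelWithCorners ℝ E H)
  (M : Type w) [TopologicalSpace M] [ChartedSpace H M] [IsManifold I ∞ M]

/-- A Dirac structure on `M`: a smooth subbundle `L` of `TM ⊕ T*M` which is isotropic, of rank
`dim M` (hence maximal isotropic), and whose (local) sections are closed under the Courant
bracket. -/
structure DiracStructure where
  /-- The fibre of `L` at a point. -/
  fiber : Π x : M, Submodule ℝ (TangentSpace I x × Cotangent I x)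
  isotropic : ∀ x, ∀ a ∈ fiber x, ∀ b ∈ fiber x, (a.2 b.1 + b.2 a.1 : ℝ) = 0
  finrank_fiber : ∀ x, Module.finrank ℝ (fiber x) = Module.finrank ℝ E
  smooth : ∀ x₀ : M, ∃ U : Set M, IsOpen U ∧ x₀ ∈ U ∧
    ∃ (X : Fin (Module.finrank ℝ E) → Π x : M, TangentSpace I x)
      (α : Fin (Module.finrank ℝ E) → Π x : M, Cotangent I x),
      (∀ i, SmoothVectorFieldOn I (X i) U ∧ SmoothOneFormOn I (α i) U) ∧
      ∀ x ∈ U, fiber x = Submodule.span ℝ (range fun i => (X i x, α i x))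
  integrable : ∀ (U : Set M), IsOpen U →
    ∀ (X : Π x : M, TangentSpace I x) (α : Π x : M, Cotangent I x)
      (Y : Π x : M, TangentSpace I x) (β : Π x : M, Cotangent I x),
      SmoothVectorFieldOn I X U → SmoothOneFormOn I α U →
      SmoothVectorFieldOn I Y U → SmoothOneFormOn I β U →
      (∀ x ∈ U, (X x, α x) ∈ fiber x) → (∀ x ∈ U, (Y x, β x) ∈ fiber x) →
      ∀ x ∈ U, courantBracket I X α Y β x ∈ fiber x

variable {M} in
/-- The bracket `{f, g} = Π(df, dg) = dg (♯ df)` of functions. -/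
def bracketOf (sharp : Π x : M, Cotangent I x →L[ℝ] TangentSpace I x) (f g : M → ℝ) (x : M) : ℝ :=
  d0 I g x (sharp x (d0 I f x))

/-- A Poisson structure on `M`: a smooth bivector field `Π`, given through its contraction
`♯ : T*M → TM` (so `Π (ξ, η) = η (♯ ξ)`), with `[Π, Π] = 0`. The value of the Schouten bracket
`[Π, Π]` on `(df, dg, dh)` is, up to a nonzero constant, the left hand side of the Jacobi identity
for the bracket of functions. -/
structure PoissonStructure where
  /-- The contraction `♯ : T*M → TM` with the bivector field. -/
  sharp : Π x : M, Cotangent I x →L[ℝ] TangentSpace I x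
  skew : ∀ x (ξ η : Cotangent I x), (η (sharp x ξ) : ℝ) = - ξ (sharp x η)
  smooth : ContMDiff I (I.prod 𝓘(ℝ, (E →L[ℝ] ℝ) →L[ℝ] E)) ∞
    (fun x => (⟨x, sharp x⟩ :
      TotalSpace ((E →L[ℝ] ℝ) →L[ℝ] E) (fun x : M => Cotangent I x →L[ℝ] TangentSpace I x)))
  jacobi : ∀ f g h : M → ℝ, ContMDiff I 𝓘(ℝ, ℝ) ∞ f → ContMDiff I 𝓘(ℝ, ℝ) ∞ g →
    ContMDiff I 𝓘(ℝ, ℝ) ∞ h → ∀ x,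
      bracketOf I sharp f (bracketOf I sharp g h) x
        + bracketOf I sharp g (bracketOf I sharp h f) x
        + bracketOf I sharp h (bracketOf I sharp f g) x = 0

variable {I M}

/-- The Dirac structure `L_P = {(♯ξ, ξ)}` of a Poisson structure, at a point. -/
def PoissonStructure.graph (S : PoissonStructure I M) (x : M) :
    Submodule ℝ (TangentSpace I x × Cotangent I x) :=
  LinearMap.range ((S.sharp x : Cotangent I x →ₗ[ℝ] TangentSpace I x).prod LinearMap.id)

namespace DiracStructure

variable (L : DiracStructure I M)

/-- The characteristic subspace `(L ∩ TM)ₓ = {v | (v, 0) ∈ Lₓ}`. -/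
def char (x : M) : Submodule ℝ (TangentSpace I x) :=
  (L.fiber x).comap (LinearMap.inl ℝ (TangentSpace I x) (Cotangent I x))

/-- The rank of `L ∩ TM` at a point. -/
def charRank (x : M) : ℕ := Module.finrank ℝ (L.char x)

/-- `i : M → P` is a coisotropic embedding of the Dirac manifold `(M, L)` in the Poisson manifold
`P`: a smooth embedding with `♯ N*i(M) ⊆ T i(M)` and `i^* L_P = L`. -/
structure IsCoisotropicEmbedding
    {E' : Type*} [NormedAddCommGroup E'] [NormedSpace ℝ E']
    {H' : Type*} [TopologicalSpace H'] {J : ModelWithCorners ℝ E' H'}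
    {P : Type*} [TopologicalSpace P] [ChartedSpace H' P] [IsManifold J ∞ P]
    (S : PoissonStructure J P) (i : M → P) : Prop where
  isSmoothEmbedding : Manifold.IsSmoothEmbedding I J ∞ i
  coisotropic : ∀ x (ξ : Cotangent J (i x)), ξ.comp (mfderiv I J i x) = 0 →
    ∃ v : TangentSpace I x, mfderiv I J i x v = S.sharp (i x) ξ
  pullback_eq : ∀ x, pullbackDirac (mfderiv I J i x) (S.graph (i x)) = L.fiber x

/-- The Dirac manifold `(M, L)` can be embedded coisotropically in some Poisson manifold `P`
(finite dimensional, Hausdorff, second countable and without boundary). -/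
def EmbedsCoisotropically : Prop :=
  ∃ (E' : Type u) (_ : NormedAddCommGroup E') (_ : NormedSpace ℝ E') (_ : FiniteDimensional ℝ E')
    (H' : Type v) (_ : TopologicalSpace H') (J : ModelWithCorners ℝ E' H') (_ : J.Boundaryless)
    (P : Type (max u w)) (_ : TopologicalSpace P) (_ : T2Space P) (_ : SecondCountableTopology P)
    (_ : ChartedSpace H' P) (_ : IsManifold J ∞ P)
    (S : PoissonStructure J P) (i : M → P), L.IsCoisotropicEmbedding S i

/-! ### The Poisson structure on a neighbourhood of the zero section of `(L ∩ TM)*` -/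

/-- The fibre of `E* = (L ∩ TM)*`. -/
abbrev CharDual (x : M) : Type u := L.char x →L[ℝ] ℝ

/-- The total space of `E* = (L ∩ TM)*`, when `L ∩ TM` has rank `k`. -/
abbrev CharDualTotal (k : ℕ) : Type (max u w) :=
  TotalSpace (EuclideanSpace ℝ (Fin k)) L.CharDual

/-- The structure of a smooth vector bundle of rank `k` on `E* = (L ∩ TM)*`, normalized by the
requirement that the restriction map `T*M → E*` be smooth. The restriction map being fibrewise
linear and onto, there is at most one such smooth structure. -/
class CharDualBundle (k : ℕ) where
  topology : TopologicalSpace (L.CharDualTotal k)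
  fiberBundle : FiberBundle (EuclideanSpace ℝ (Fin k)) L.CharDual
  vectorBundle : VectorBundle ℝ (EuclideanSpace ℝ (Fin k)) L.CharDual
  contMDiffVectorBundle : ContMDiffVectorBundle ∞ (EuclideanSpace ℝ (Fin k)) L.CharDual I
  contMDiff_restrict : ContMDiff (I.prod 𝓘(ℝ, E →L[ℝ] ℝ)) (I.prod 𝓘(ℝ, EuclideanSpace ℝ (Fin k))) ∞
    (fun p : CotangentBundle I M =>
      (⟨p.1, p.2.comp (L.char p.1).subtypeL⟩ : L.CharDualTotal k))

attribute [reducible] CharDualBundle.topology CharDualBundle.fiberBundle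

attribute [instance] CharDualBundle.topology CharDualBundle.fiberBundle
  CharDualBundle.vectorBundle CharDualBundle.contMDiffVectorBundle

/-- `V` is a smooth distribution with `TM = (L ∩ TM) ⊕ V`. -/
structure IsSmoothComplement (V : Π x : M, Submodule ℝ (TangentSpace I x)) : Prop where
  smooth : IsSmoothDistribution I V
  isCompl : ∀ x, IsCompl (L.char x) (V x)

variable {L}

/-- The map `i : E* → T*M` given by a complement `V` of `E = L ∩ TM`: it extends a linear form on
`E` by zero on `V`. -/
def splittingMap [FiniteDimensional ℝ E] (k : ℕ) {V : Π x : M, Submodule ℝ (TangentSpace I x)}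
    (hV : L.IsSmoothComplement V) (p : L.CharDualTotal k) : CotangentBundle I M :=
  haveI : FiniteDimensional ℝ (TangentSpace I p.1) := inferInstanceAs (FiniteDimensional ℝ E)
  haveI : T2Space (TangentSpace I p.1) := inferInstanceAs (T2Space E)
  ⟨p.1, p.2.comp (LinearMap.toContinuousLinearMap
    ((L.char p.1).projectionOnto (V p.1) (hV.isCompl p.1)))⟩

/-- The Dirac structure `τ_B (π^* L)` on `E*`, with `π : E* → M` the projection and
`B = i^* ω_{T*M}` the pullback of the canonical symplectic form by `i : E* → T*M`. -/
def gaugedDirac [FiniteDimensional ℝ E] (k : ℕ) [L.CharDualBundle k]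
    {V : Π x : M, Submodule ℝ (TangentSpace I x)} (hV : L.IsSmoothComplement V)
    (p : L.CharDualTotal k) :
    Submodule ℝ (TangentSpace (I.prod 𝓘(ℝ, EuclideanSpace ℝ (Fin k))) p ×
      Cotangent (I.prod 𝓘(ℝ, EuclideanSpace ℝ (Fin k))) p) :=
  gaugeTransform
    (pullbackTensor
      (mfderiv (I.prod 𝓘(ℝ, EuclideanSpace ℝ (Fin k))) (I.prod 𝓘(ℝ, E →L[ℝ] ℝ))
        (splittingMap k hV) p)
      (canonicalSymplecticForm I (splittingMap k hV p)))
    (pullbackDirac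
      (mfderiv (I.prod 𝓘(ℝ, EuclideanSpace ℝ (Fin k))) I
        (TotalSpace.proj : L.CharDualTotal k → M) p)
      (L.fiber p.1))

/-- On the open neighbourhood `U` of the zero section of `E*`, the Dirac structure `τ_B (π^* L)`
is the graph of a Poisson structure, and the zero section embeds `(M, L)` coisotropically in
that Poisson manifold. -/
def IsPoissonNeighbourhood [FiniteDimensional ℝ E] (k : ℕ) [L.CharDualBundle k]
    {V : Π x : M, Submodule ℝ (TangentSpace I x)} (hV : L.IsSmoothComplement V)
    (U : Opens (L.CharDualTotal k)) : Prop :=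
  ∃ (h0 : ∀ x : M, zeroSection (EuclideanSpace ℝ (Fin k)) L.CharDual x ∈ U)
    (S : PoissonStructure (I.prod 𝓘(ℝ, EuclideanSpace ℝ (Fin k))) U),
    (∀ p : U, S.graph p = pullbackDirac
      (mfderiv (I.prod 𝓘(ℝ, EuclideanSpace ℝ (Fin k))) (I.prod 𝓘(ℝ, EuclideanSpace ℝ (Fin k)))
        (Subtype.val : U → L.CharDualTotal k) p)
      (gaugedDirac k hV p.1)) ∧
    L.IsCoisotropicEmbedding S
      (fun x => (⟨zeroSection (EuclideanSpace ℝ (Fin k)) L.CharDual x, h0 x⟩ : U))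

end DiracStructure

end Structures

end DiracGeom

end

/-!
Work in charts, where a Dirac structure is the range of a smooth frame and integrability is the
vanishing of the Courant tensor of that frame. The Courant tensor survives both the pullback to
`E* = (L ∩ TM)*` and the gauge transformation by a closed form, and a Dirac structure is the graph
of a bivector where the covector components of its frame are invertible. This is an open condition
on `E*`. It holds along the zero section, as there `i_V^* ω` is the pairing of `E` with `E*`, which
is nondegenerate on exactly the directions in which `π^* L` fails to be a graph.

Conversely, the rank of `L ∩ TM` is always upper semicontinuous. For a coisotropic embedding,
`L ∩ TM` is the image of the conormal bundle under `♯`, so its rank is also lower semicontinuous.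
-/

noncomputable section

namespace DiracGeom

/-! ### Smooth families of linear maps -/

section LinearFamilies

variable {R S N T : Type*} [NormedAddCommGroup R] [NormedSpace ℝ R]
  [NormedAddCommGroup S] [NormedSpace ℝ S] [NormedAddCommGroup N] [NormedSpace ℝ N]
  [NormedAddCommGroup T] [NormedSpace ℝ T]
  {E : Type*} [NormedAddCommGroup E] [NormedSpace ℝ E]
  {H : Type*} [TopologicalSpace H] {I : ModelWithCorners ℝ E H}
  {M : Type*} [TopologicalSpace M] [ChartedSpace H M]

theorem isOpen_setOf_isInvertible [CompleteSpace R] :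
    IsOpen {A : R →L[ℝ] S | A.IsInvertible} :=
  ContinuousLinearEquiv.isOpen

theorem contMDiffAt_clm_inverse [CompleteSpace R] {n : WithTop ℕ∞} {A : M → R →L[ℝ] S} {x : M}
    (hA : ContMDiffAt I 𝓘(ℝ, R →L[ℝ] S) n A x) (h : (A x).IsInvertible) :
    ContMDiffAt I 𝓘(ℝ, S →L[ℝ] R) n (fun y => (A y).inverse) x :=
  h.contDiffAt_map_inverse.contMDiffAt.comp x hA

theorem contDiff_bordering (Q : S →L[ℝ] T) (p : R →L[ℝ] N) :
    ContDiff ℝ ∞ (fun B : R →L[ℝ] S => (Q ∘L B).prod p) := by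
  have h : (fun B : R →L[ℝ] S => (Q ∘L B).prod p) =
      fun B => ContinuousLinearMap.inl ℝ T N ∘L Q ∘L B + ContinuousLinearMap.inr ℝ T N ∘L p := by
    ext B v <;> simp
  rw [h]
  fun_prop

theorem range_inverse_bordering [FiniteDimensional ℝ N]
    {A : R →L[ℝ] S} {Q : S →L[ℝ] T} {p : R →L[ℝ] N}
    (h : ((Q ∘L A).prod p).IsInvertible) (hN : Module.finrank ℝ A.ker = Module.finrank ℝ N) :
    Function.Injective (((Q ∘L A).prod p).inverse ∘L ContinuousLinearMap.inr ℝ T N) ∧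
      (((Q ∘L A).prod p).inverse ∘L ContinuousLinearMap.inr ℝ T N).range = A.ker := by
  have h_inj : Function.Injective
      (((Q ∘L A).prod p).inverse ∘L ContinuousLinearMap.inr ℝ T N) :=
    h.inverse.injective.comp (LinearMap.inr_injective (R := ℝ) (M := T) (M₂ := N))
  have h_le : A.ker ≤ (((Q ∘L A).prod p).inverse ∘L ContinuousLinearMap.inr ℝ T N).range := by
    intro v hv
    have hΨv : (0, p v) = ((Q ∘L A).prod p) v := by simp [show A v = 0 from hv]
    exact ⟨p v, (congrArg _ hΨv).trans (h.inverse_apply_self v)⟩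
  refine ⟨h_inj, (Submodule.eq_of_le_of_finrank_eq h_le ?_).symm⟩
  rw [hN, LinearMap.finrank_range_of_inj h_inj]

variable [FiniteDimensional ℝ R]

theorem contDiffAt_clm_apply_iff {D : Type*} [NormedAddCommGroup D] [NormedSpace ℝ D]
    {f : D → R →L[ℝ] S} {z : D} {n : WithTop ℕ∞} :
    ContDiffAt ℝ n f z ↔ ∀ v, ContDiffAt ℝ n (fun y => f y v) z := by
  refine ⟨fun h v => h.clm_apply contDiffAt_const, fun h => ?_⟩
  let e₁ : R ≃L[ℝ] (Fin (Module.finrank ℝ R) → ℝ) :=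
    ContinuousLinearEquiv.ofFinrankEq (Module.finrank_fin_fun ℝ).symm
  let e₂ := (e₁.arrowCongr (1 : S ≃L[ℝ] S)).trans (ContinuousLinearEquiv.piRing (Fin _))
  rw [← Function.id_comp f, ← e₂.symm_comp_self]
  exact e₂.symm.contDiff.contDiffAt.comp z (contDiffAt_pi.mpr fun i => h _)

theorem isInvertible_of_bijective {A : R →L[ℝ] S} (h : Function.Bijective A) :
    A.IsInvertible :=
  ⟨(LinearEquiv.ofBijective (A : R →ₗ[ℝ] S) h).toContinuousLinearEquiv, rfl⟩

theorem eventually_finrank_ker_le {X : Type*} [TopologicalSpace X] {A : X → R →L[ℝ] S} {x₀ : X}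
    (hA : ContinuousAt A x₀) :
    ∀ᶠ x in 𝓝 x₀, Module.finrank ℝ (A x).ker ≤ Module.finrank ℝ (A x₀).ker := by
  have h_rank : ∀ᶠ x in 𝓝 x₀, Module.finrank ℝ (A x₀).range ≤ Module.finrank ℝ (A x).range := by
    filter_upwards [hA.eventually ((isOpen_setOfPred_nat_le_rank
      (Module.finrank ℝ (A x₀).range)).mem_nhds (Module.finrank_eq_rank ℝ _).le)] with x hx
    exact (Nat.cast_le (α := Cardinal)).1 (hx.trans_eq (Module.finrank_eq_rank ℝ _).symm)
  filter_upwards [h_rank] with x hx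
  have h₀ := (A x₀ : R →ₗ[ℝ] S).finrank_range_add_finrank_ker
  have h₁ := (A x : R →ₗ[ℝ] S).finrank_range_add_finrank_ker
  omega

theorem exists_isInvertible_bordering [FiniteDimensional ℝ N] (A : R →L[ℝ] S)
    (hN : Module.finrank ℝ A.ker = Module.finrank ℝ N) :
    ∃ (Q : S →L[ℝ] A.range) (p : R →L[ℝ] N), ((Q ∘L A).prod p).IsInvertible := by
  obtain ⟨C, hC⟩ := Submodule.exists_isCompl A.ker
  obtain ⟨Q, hQ⟩ := Submodule.ClosedComplemented.of_finiteDimensional A.range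
  let e : A.ker ≃ₗ[ℝ] N := LinearEquiv.ofFinrankEq _ _ hN
  let p : R →ₗ[ℝ] N := e.toLinearMap ∘ₗ A.ker.projectionOnto C hC
  refine ⟨Q, LinearMap.toContinuousLinearMap p,
    isInvertible_of_bijective ?_⟩
  have h_inj : Function.Injective
      ((Q ∘L A).prod (LinearMap.toContinuousLinearMap p)) := by
    refine (injective_iff_map_eq_zero _).2 fun v hv => ?_
    have hQv : Q (A v) = 0 := congrArg Prod.fst hv
    have hpv : p v = 0 := congrArg Prod.snd hv
    have hv_ker : A v = 0 :=
      congrArg Subtype.val ((hQ ⟨A v, v, rfl⟩).symm.trans hQv)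
    have hv_compl : A.ker.projectionOnto C hC v = 0 := e.map_eq_zero_iff.1 hpv
    exact congrArg Subtype.val
      ((Submodule.projectionOnto_apply_left hC (⟨v, hv_ker⟩ : A.ker)).symm.trans hv_compl)
  have h_dim : Module.finrank ℝ R = Module.finrank ℝ (A.range × N) := by
    rw [Module.finrank_prod, ← hN, (A : R →ₗ[ℝ] S).finrank_range_add_finrank_ker]
  exact ⟨h_inj, (LinearMap.injective_iff_surjective_of_finrank_eq_finrank h_dim).1 h_inj⟩

theorem exists_smooth_kernel_frame [FiniteDimensional ℝ N] {A : M → R →L[ℝ] S} {U : Set M}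
    {x₀ : M} (hU : IsOpen U) (hx₀ : x₀ ∈ U) (hA : ContMDiffOn I 𝓘(ℝ, R →L[ℝ] S) ∞ A U)
    (hN : ∀ x ∈ U, Module.finrank ℝ (A x).ker = Module.finrank ℝ N) :
    ∃ W ⊆ U, IsOpen W ∧ x₀ ∈ W ∧ ∃ K : M → N →L[ℝ] R,
      ContMDiffOn I 𝓘(ℝ, N →L[ℝ] R) ∞ K W ∧
      ∀ x ∈ W, Function.Injective (K x) ∧ (K x).range = (A x).ker := by
  obtain ⟨Q, p, h₀⟩ := exists_isInvertible_bordering (A x₀) (hN x₀ hx₀)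
  have h_smooth : ContMDiffOn I 𝓘(ℝ, R →L[ℝ] (A x₀).range × N) ∞
      (fun x => (Q ∘L A x).prod p) U :=
    (contDiff_bordering Q p).contMDiff.comp_contMDiffOn hA
  have h_restrict : ContDiff ℝ ∞ (fun B : (A x₀).range × N →L[ℝ] R =>
      B ∘L ContinuousLinearMap.inr ℝ (A x₀).range N) := by fun_prop
  refine ⟨U ∩ (fun x => (Q ∘L A x).prod p) ⁻¹' {B | B.IsInvertible}, inter_subset_left,
    h_smooth.continuousOn.isOpen_inter_preimage hU isOpen_setOf_isInvertible, ⟨hx₀, h₀⟩,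
    fun x => ((Q ∘L A x).prod p).inverse ∘L ContinuousLinearMap.inr ℝ _ _, fun x hx => ?_,
    fun x hx => range_inverse_bordering hx.2 (hN x hx.1)⟩
  exact (h_restrict.contMDiff.contMDiffAt.comp x (contMDiffAt_clm_inverse
    (h_smooth.contMDiffAt (hU.mem_nhds hx.1)) hx.2)).contMDiffWithinAt

theorem exists_smooth_leftInverse [FiniteDimensional ℝ N] {Y : M → N →L[ℝ] R} {U : Set M} {x₀ : M}
    (hU : IsOpen U) (hx₀ : x₀ ∈ U) (hY : ContMDiffOn I 𝓘(ℝ, N →L[ℝ] R) ∞ Y U)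
    (h_inj : Function.Injective (Y x₀)) :
    ∃ W ⊆ U, IsOpen W ∧ x₀ ∈ W ∧ ∃ Φ : M → R →L[ℝ] N,
      ContMDiffOn I 𝓘(ℝ, R →L[ℝ] N) ∞ Φ W ∧ ∀ x ∈ W, ∀ c, Φ x (Y x c) = c := by
  obtain ⟨Φ₀, hΦ₀⟩ := ContinuousLinearMap.HasLeftInverse.of_injective_of_finiteDimensional h_inj
  have h_smooth : ContMDiffOn I 𝓘(ℝ, N →L[ℝ] N) ∞ (fun x => Φ₀ ∘L Y x) U :=
    contMDiffOn_const.clm_comp hY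
  have h₀ : (Φ₀ ∘L Y x₀).IsInvertible := by
    rw [show Φ₀ ∘L Y x₀ = ContinuousLinearMap.id ℝ N from ContinuousLinearMap.ext hΦ₀]
    exact ⟨ContinuousLinearEquiv.refl ℝ N, rfl⟩
  refine ⟨U ∩ (fun x => Φ₀ ∘L Y x) ⁻¹' {B | B.IsInvertible}, inter_subset_left,
    h_smooth.continuousOn.isOpen_inter_preimage hU isOpen_setOf_isInvertible, ⟨hx₀, h₀⟩,
    fun x => (Φ₀ ∘L Y x).inverse ∘L Φ₀, fun x hx => ?_,
    fun x hx c => hx.2.inverse_apply_self c⟩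
  exact ((contMDiffAt_clm_inverse (h_smooth.contMDiffAt (hU.mem_nhds hx.1)) hx.2).clm_comp
    contMDiffAt_const).contMDiffWithinAt

end LinearFamilies

/-! ### The Courant tensor of a frame -/

section CourantTensor

variable {F F' R S : Type*} [NormedAddCommGroup F] [NormedSpace ℝ F]
  [NormedAddCommGroup F'] [NormedSpace ℝ F'] [NormedAddCommGroup R] [NormedSpace ℝ R]
  [NormedAddCommGroup S] [NormedSpace ℝ S]

/-- The symmetric pairing `⟨(X, ξ), (Y, η)⟩ = ξ Y + η X` on `F ⊕ F^*`, without the factor `½`. -/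
def dualPairing (a b : F × (F →L[ℝ] ℝ)) : ℝ := a.2 b.1 + b.2 a.1

/-- The Courant tensor `⟨[a, b], c⟩` of the family of isotropic subspaces `range (G z)` of
`F ⊕ F^*`, whose vanishing is integrability. Here `a`, `b` and `c` stand for the sections
`z ↦ G z a`, `z ↦ G z b` and `z ↦ G z c`, and isotropy has been used to write the tensor as a
cyclic sum of first derivatives. -/
def courantTensor (G : F → R →L[ℝ] F × (F →L[ℝ] ℝ)) (z : F) (a b c : R) : ℝ :=
  dualPairing (fderiv ℝ G z (G z a).1 b) (G z c) + dualPairing (fderiv ℝ G z (G z b).1 c) (G z a) +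
    dualPairing (fderiv ℝ G z (G z c).1 a) (G z b)

theorem hasFDerivAt_clm_apply_const {G : F → R →L[ℝ] S} {z : F} (hG : DifferentiableAt ℝ G z)
    (c : R) : HasFDerivAt (fun y => G y c) ((fderiv ℝ G z).flip c) z :=
  (hG.hasFDerivAt.clm_apply (hasFDerivAt_const c z)).congr_fderiv (by ext; simp)

theorem fderiv_clm_apply_eq_of_eventuallyEq {G : F → R →L[ℝ] S} {z : F} {φ : F → S}
    {φ' : F →L[ℝ] S} {c : R} (hG : DifferentiableAt ℝ G z) (hφ : HasFDerivAt φ φ' z)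
    (h : (fun y => G y c) =ᶠ[𝓝 z] φ) (v : F) : fderiv ℝ G z v c = φ' v :=
  congrArg (· v) ((hasFDerivAt_clm_apply_const hG c).unique (hφ.congr_of_eventuallyEq h))

theorem fderiv_fderiv_comm {f : F → S} {z : F} (hf : ContDiffAt ℝ 2 f z) (v w : F) :
    fderiv ℝ (fderiv ℝ f) z v w = fderiv ℝ (fderiv ℝ f) z w v :=
  hf.isSymmSndFDerivAt (by simp) v w

theorem hasFDerivAt_fderiv {f : F → S} {z : F} (hf : ContDiffAt ℝ 2 f z) :
    HasFDerivAt (fderiv ℝ f) (fderiv ℝ (fderiv ℝ f) z) z :=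
  ((hf.fderiv_right (m := 1) (by norm_num)).differentiableAt (by norm_num)).hasFDerivAt

section Graph

variable {G : F → R →L[ℝ] F × (F →L[ℝ] ℝ)} {P : F → (F →L[ℝ] ℝ) →L[ℝ] F} {z : F}

theorem dualPairing_fderiv_of_graph (hG : DifferentiableAt ℝ G z) (hP : DifferentiableAt ℝ P z)
    (hgraph : ∀ᶠ y in 𝓝 z, ∀ c, (G y c).1 = P y (G y c).2)
    (hskew : ∀ ξ η : F →L[ℝ] ℝ, η (P z ξ) = -ξ (P z η)) (v : F) (c d : R) :
    dualPairing (fderiv ℝ G z v c) (G z d) = (G z d).2 (fderiv ℝ P z v (G z c).2) := by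
  have hGc := hasFDerivAt_clm_apply_const hG c
  have h_fst : (fderiv ℝ G z v c).1 = P z (fderiv ℝ G z v c).2 + fderiv ℝ P z v (G z c).2 := by
    have h := hGc.fst.unique ((hP.hasFDerivAt.clm_apply hGc.snd).congr_of_eventuallyEq
      (hgraph.mono fun y hy => hy c))
    simpa using congrArg (· v) h
  rw [dualPairing, h_fst, hgraph.self_of_nhds d, map_add, hskew (G z d).2]
  ring

theorem cyclic_fderiv_of_courantTensor_eq_zero (hG : DifferentiableAt ℝ G z)
    (hP : DifferentiableAt ℝ P z) (hgraph : ∀ᶠ y in 𝓝 z, ∀ c, (G y c).1 = P y (G y c).2)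
    (hskew : ∀ ξ η : F →L[ℝ] ℝ, η (P z ξ) = -ξ (P z η))
    (hsurj : ∀ ξ, ∃ c, (G z c).2 = ξ) (hT : ∀ a b c, courantTensor G z a b c = 0)
    (α β γ : F →L[ℝ] ℝ) :
    γ (fderiv ℝ P z (P z α) β) + α (fderiv ℝ P z (P z β) γ) +
      β (fderiv ℝ P z (P z γ) α) = 0 := by
  obtain ⟨a, rfl⟩ := hsurj α
  obtain ⟨b, rfl⟩ := hsurj β
  obtain ⟨c, rfl⟩ := hsurj γ
  simpa only [courantTensor, dualPairing_fderiv_of_graph hG hP hgraph hskew,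
    hgraph.self_of_nhds _] using hT a b c

theorem fderiv_bracket (hP : DifferentiableAt ℝ P z)
    (hskew : ∀ ξ η : F →L[ℝ] ℝ, η (P z ξ) = -ξ (P z η)) {g h : F → ℝ}
    (hg : ContDiffAt ℝ 2 g z) (hh : ContDiffAt ℝ 2 h z) (v : F) :
    fderiv ℝ (fun y => fderiv ℝ h y (P y (fderiv ℝ g y))) z v =
      fderiv ℝ (fderiv ℝ h) z v (P z (fderiv ℝ g z)) +
      fderiv ℝ h z (fderiv ℝ P z v (fderiv ℝ g z)) -
      fderiv ℝ (fderiv ℝ g) z v (P z (fderiv ℝ h z)) := by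
  rw [((hasFDerivAt_fderiv hh).clm_apply
    (hP.hasFDerivAt.clm_apply (hasFDerivAt_fderiv hg))).fderiv]
  simp only [ContinuousLinearMap.comp_apply, ContinuousLinearMap.flip_apply, add_apply, map_add]
  rw [hskew (fderiv ℝ (fderiv ℝ g) z v)]
  ring

theorem jacobi_of_courantTensor_eq_zero (hG : DifferentiableAt ℝ G z)
    (hP : DifferentiableAt ℝ P z) (hgraph : ∀ᶠ y in 𝓝 z, ∀ c, (G y c).1 = P y (G y c).2)
    (hskew : ∀ ξ η : F →L[ℝ] ℝ, η (P z ξ) = -ξ (P z η))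
    (hsurj : ∀ ξ, ∃ c, (G z c).2 = ξ) (hT : ∀ a b c, courantTensor G z a b c = 0)
    {f g h : F → ℝ} (hf : ContDiffAt ℝ 2 f z) (hg : ContDiffAt ℝ 2 g z)
    (hh : ContDiffAt ℝ 2 h z) :
    fderiv ℝ (fun y => fderiv ℝ h y (P y (fderiv ℝ g y))) z (P z (fderiv ℝ f z)) +
      fderiv ℝ (fun y => fderiv ℝ f y (P y (fderiv ℝ h y))) z (P z (fderiv ℝ g z)) +
      fderiv ℝ (fun y => fderiv ℝ g y (P y (fderiv ℝ f y))) z (P z (fderiv ℝ h z)) = 0 := by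
  rw [fderiv_bracket hP hskew hg hh, fderiv_bracket hP hskew hh hf,
    fderiv_bracket hP hskew hf hg, fderiv_fderiv_comm hh, fderiv_fderiv_comm hf,
    fderiv_fderiv_comm hg (P z (fderiv ℝ h z))]
  linarith [cyclic_fderiv_of_courantTensor_eq_zero hG hP hgraph hskew hsurj hT
    (fderiv ℝ f z) (fderiv ℝ g z) (fderiv ℝ h z)]

end Graph

theorem dualPairing_fderiv_gauge {G G' : F → R →L[ℝ] F × (F →L[ℝ] ℝ)}
    {B : F → F →L[ℝ] F →L[ℝ] ℝ} {z : F} (hG : DifferentiableAt ℝ G z)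
    (hG' : DifferentiableAt ℝ G' z) (hB : DifferentiableAt ℝ B z)
    (hGG' : ∀ᶠ y in 𝓝 z, ∀ c, G' y c = ((G y c).1, (G y c).2 + B y (G y c).1))
    (hanti : ∀ v w, B z v w = -B z w v) (v : F) (c d : R) :
    dualPairing (fderiv ℝ G' z v c) (G' z d) =
      dualPairing (fderiv ℝ G z v c) (G z d) + fderiv ℝ B z v (G z c).1 (G z d).1 := by
  have hGc := hasFDerivAt_clm_apply_const hG c
  rw [fderiv_clm_apply_eq_of_eventuallyEq hG'
    (hGc.fst.prodMk (hGc.snd.add (hB.hasFDerivAt.clm_apply hGc.fst)))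
    (hGG'.mono fun y hy => hy c), hGG'.self_of_nhds d]
  simp only [dualPairing, ContinuousLinearMap.prod_apply, ContinuousLinearMap.comp_apply,
    ContinuousLinearMap.flip_apply, add_apply, ContinuousLinearMap.coe_fst',
    ContinuousLinearMap.coe_snd']
  rw [hanti (G z d).1]
  ring

theorem courantTensor_gauge {G G' : F → R →L[ℝ] F × (F →L[ℝ] ℝ)} {B : F → F →L[ℝ] F →L[ℝ] ℝ}
    {z : F} (hG : DifferentiableAt ℝ G z) (hG' : DifferentiableAt ℝ G' z)
    (hB : DifferentiableAt ℝ B z)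
    (hGG' : ∀ᶠ y in 𝓝 z, ∀ c, G' y c = ((G y c).1, (G y c).2 + B y (G y c).1))
    (hanti : ∀ v w, B z v w = -B z w v)
    (hclosed : ∀ u v w, fderiv ℝ B z u v w + fderiv ℝ B z v w u + fderiv ℝ B z w u v = 0)
    (a b c : R) : courantTensor G' z a b c = courantTensor G z a b c := by
  have h_fst : ∀ c, (G' z c).1 = (G z c).1 := fun c => by rw [hGG'.self_of_nhds c]
  simp only [courantTensor, dualPairing_fderiv_gauge hG hG' hB hGG' hanti, h_fst]
  linarith [hclosed (G z a).1 (G z b).1 (G z c).1]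

theorem courantTensor_pullback_fst {g : F → R →L[ℝ] F × (F →L[ℝ] ℝ)}
    {G : F × F' → (R × F') →L[ℝ] (F × F') × (F × F' →L[ℝ] ℝ)} {z : F × F'}
    (hg : DifferentiableAt ℝ g z.1) (hG : DifferentiableAt ℝ G z)
    (hGg : ∀ᶠ y in 𝓝 z, ∀ c, G y c =
      (((g y.1 c.1).1, c.2), (g y.1 c.1).2.comp (ContinuousLinearMap.fst ℝ F F')))
    (a b c : R × F') : courantTensor G z a b c = courantTensor g z.1 a.1 b.1 c.1 := by
  have h_pairing : ∀ v c d, dualPairing (fderiv ℝ G z v c) (G z d) =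
      dualPairing (fderiv ℝ g z.1 v.1 c.1) (g z.1 d.1) := by
    intro v c d
    have hgc : HasFDerivAt (fun y : F × F' => g y.1 c.1) _ z :=
      (hasFDerivAt_clm_apply_const hg c.1).comp z hasFDerivAt_fst
    rw [fderiv_clm_apply_eq_of_eventuallyEq hG
      ((hgc.fst.prodMk (hasFDerivAt_const c.2 z)).prodMk
        (hgc.snd.clm_comp (hasFDerivAt_const (ContinuousLinearMap.fst ℝ F F') z)))
      (hGg.mono fun y hy => hy c), hGg.self_of_nhds d]
    simp [dualPairing]
  have h_fst : ∀ c, (G z c).1.1 = (g z.1 c.1).1 := fun c => by rw [hGg.self_of_nhds c]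
  simp only [courantTensor, h_pairing, h_fst]

/-- The exterior derivative of a `1`-form on a vector space, as the map `v ↦ i_v dθ`. -/
def vecD1 (θ : F → F →L[ℝ] ℝ) (z : F) : F →L[ℝ] F →L[ℝ] ℝ := fderiv ℝ θ z - (fderiv ℝ θ z).flip

theorem vecD1_apply (θ : F → F →L[ℝ] ℝ) (z v w : F) :
    vecD1 θ z v w = fderiv ℝ θ z v w - fderiv ℝ θ z w v := rfl

theorem vecD1_antisymm (θ : F → F →L[ℝ] ℝ) (z v w : F) : vecD1 θ z v w = -vecD1 θ z w v := by
  rw [vecD1_apply, vecD1_apply]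
  ring

set_option synthInstance.maxHeartbeats 40000 in
-- finding the norm on `F →L[ℝ] F →L[ℝ] ℝ` exceeds the default limit
theorem contDiffAt_vecD1 {θ : F → F →L[ℝ] ℝ} {z : F} {m n : WithTop ℕ∞}
    (hθ : ContDiffAt ℝ n θ z) (hmn : m + 1 ≤ n) : ContDiffAt ℝ m (vecD1 θ) z := by
  have h : ContDiffAt ℝ m (fderiv ℝ θ) z := hθ.fderiv_right hmn
  let flip : (F →L[ℝ] F →L[ℝ] ℝ) →L[ℝ] F →L[ℝ] F →L[ℝ] ℝ :=
    (ContinuousLinearMap.flipₗᵢ ℝ F F ℝ).toContinuousLinearEquiv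
  have h_flip : ContDiffAt ℝ m (fun y => flip (fderiv ℝ θ y)) z := by fun_prop
  exact h.sub h_flip

theorem fderiv_vecD1_apply {θ : F → F →L[ℝ] ℝ} {z : F} (hθ : ContDiffAt ℝ 2 θ z) (u v w : F) :
    fderiv ℝ (vecD1 θ) z u v w =
      fderiv ℝ (fderiv ℝ θ) z u v w - fderiv ℝ (fderiv ℝ θ) z u w v := by
  have h_apply {B : F → F →L[ℝ] F →L[ℝ] ℝ} (hB : DifferentiableAt ℝ B z) (v w : F) :
      HasFDerivAt (fun y => B y v w) (((fderiv ℝ B z).flip v).flip w) z := by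
    have h := hasFDerivAt_clm_apply_const hB v
    simpa only [h.fderiv] using hasFDerivAt_clm_apply_const h.differentiableAt w
  have h_vecD1 := h_apply ((contDiffAt_vecD1 hθ (by norm_num)).differentiableAt one_ne_zero) v w
  have h_fderiv := h_apply (hasFDerivAt_fderiv hθ).differentiableAt
  exact DFunLike.congr_fun (h_vecD1.unique ((h_fderiv v w).sub (h_fderiv w v))) u

theorem fderiv_vecD1_cyclic {θ : F → F →L[ℝ] ℝ} {z : F} (hθ : ContDiffAt ℝ 2 θ z) (u v w : F) :
    fderiv ℝ (vecD1 θ) z u v w + fderiv ℝ (vecD1 θ) z v w u + fderiv ℝ (vecD1 θ) z w u v = 0 := by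
  simp only [fderiv_vecD1_apply hθ]
  rw [fderiv_fderiv_comm hθ u v, fderiv_fderiv_comm hθ v w, fderiv_fderiv_comm hθ w u]
  ring

theorem vecD1_pullback {h : F → F'} {a : F' → F' →L[ℝ] ℝ} {z : F}
    (ha : DifferentiableAt ℝ a (h z)) (hh : ContDiffAt ℝ 2 h z) (v w : F) :
    vecD1 (fun y => (a (h y)).comp (fderiv ℝ h y)) z v w =
      vecD1 a (h z) (fderiv ℝ h z v) (fderiv ℝ h z w) := by
  have h_comp : HasFDerivAt (fun y => (a (h y)).comp (fderiv ℝ h y)) _ z :=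
    (ha.hasFDerivAt.comp z (hh.differentiableAt (by norm_num)).hasFDerivAt).clm_comp
      (hasFDerivAt_fderiv hh)
  rw [vecD1_apply, vecD1_apply, h_comp.fderiv]
  simp [fderiv_fderiv_comm hh v w]

/-- The Courant bracket of sections of `F ⊕ F^*` on a vector space. -/
def vecCourantBracket (a b : F → F × (F →L[ℝ] ℝ)) (z : F) : F × (F →L[ℝ] ℝ) :=
  (VectorField.lieBracket ℝ (fun y => (a y).1) (fun y => (b y).1) z,
    vecD1 (fun y => (b y).2) z (a z).1 - vecD1 (fun y => (a y).2) z (b z).1 +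
      (1 / 2 : ℝ) • fderiv ℝ (fun y => (b y).2 (a y).1 - (a y).2 (b y).1) z)

theorem fderiv_dualPairing {a b : F → F × (F →L[ℝ] ℝ)} {z : F} (ha : DifferentiableAt ℝ a z)
    (hb : DifferentiableAt ℝ b z) (v : F) :
    fderiv ℝ (fun y => dualPairing (a y) (b y)) z v =
      dualPairing (fderiv ℝ a z v) (b z) + dualPairing (a z) (fderiv ℝ b z v) := by
  have h := (ha.hasFDerivAt.snd.clm_apply hb.hasFDerivAt.fst).add
    (hb.hasFDerivAt.snd.clm_apply ha.hasFDerivAt.fst)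
  have h' : HasFDerivAt (fun y => dualPairing (a y) (b y)) _ z := h
  rw [h'.fderiv]
  simp [dualPairing]
  ring

theorem dualPairing_vecCourantBracket {a b c : F → F × (F →L[ℝ] ℝ)} {z : F}
    (ha : DifferentiableAt ℝ a z) (hb : DifferentiableAt ℝ b z) (hc : DifferentiableAt ℝ c z)
    (hab : (fun y => dualPairing (a y) (b y)) =ᶠ[𝓝 z] 0)
    (hac : (fun y => dualPairing (a y) (c y)) =ᶠ[𝓝 z] 0) :
    dualPairing (vecCourantBracket a b z) (c z) =
      dualPairing (fderiv ℝ b z (a z).1) (c z) + dualPairing (fderiv ℝ c z (b z).1) (a z) +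
        dualPairing (fderiv ℝ a z (c z).1) (b z) := by
  have h_ab : dualPairing (fderiv ℝ a z (c z).1) (b z) +
      dualPairing (a z) (fderiv ℝ b z (c z).1) = 0 := by
    rw [← fderiv_dualPairing ha hb, hab.fderiv_eq]
    simp
  have h_ac : dualPairing (fderiv ℝ a z (b z).1) (c z) +
      dualPairing (a z) (fderiv ℝ c z (b z).1) = 0 := by
    rw [← fderiv_dualPairing ha hc, hac.fderiv_eq]
    simp
  have h_half : HasFDerivAt (fun y => (b y).2 (a y).1 - (a y).2 (b y).1) _ z :=
    (hb.hasFDerivAt.snd.clm_apply ha.hasFDerivAt.fst).sub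
      (ha.hasFDerivAt.snd.clm_apply hb.hasFDerivAt.fst)
  simp only [dualPairing] at h_ab h_ac ⊢
  simp [vecCourantBracket, h_half.fderiv, vecD1_apply, VectorField.lieBracket, fderiv.fst,
    fderiv.snd, ha, hb]
  linarith

end CourantTensor

/-! ### Dirac structures in charts -/

section Charts

variable {E : Type*} [NormedAddCommGroup E] [NormedSpace ℝ E]
  {H : Type*} [TopologicalSpace H] {I : ModelWithCorners ℝ E H}
  {M : Type*} [TopologicalSpace M] [ChartedSpace H M]

theorem eventually_extChartAt_symm_mem {x₀ : M} {U : Set M} (hU : U ∈ 𝓝 x₀) :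
    ∀ᶠ u in 𝓝 (extChartAt I x₀ x₀), (extChartAt I x₀).symm u ∈ U :=
  (continuousAt_extChartAt_symm (I := I) x₀).eventually (by simpa using hU)

theorem eventually_extChartAt_symm_mem_source [I.Boundaryless] (x₀ : M) :
    ∀ᶠ u in 𝓝 (extChartAt I x₀ x₀), (extChartAt I x₀).symm u ∈ (chartAt H x₀).source ∧
      extChartAt I x₀ ((extChartAt I x₀).symm u) = u := by
  filter_upwards [extChartAt_target_mem_nhds (I := I) x₀] with u hu
  refine ⟨?_, (extChartAt I x₀).right_inv hu⟩
  simpa using (extChartAt I x₀).map_target hu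

theorem eventually_of_eventually_extChartAt_symm {x₀ : M} {Q : M → Prop}
    (h : ∀ᶠ z in 𝓝 (extChartAt I x₀ x₀), Q ((extChartAt I x₀).symm z)) : ∀ᶠ x in 𝓝 x₀, Q x := by
  filter_upwards [(continuousAt_extChartAt (I := I) x₀).eventually h,
    chart_source_mem_nhds H x₀] with x hQ hx
  rwa [(extChartAt I x₀).left_inv (by simpa using hx)] at hQ

theorem d0_eq_fderiv [I.Boundaryless] {f : M → ℝ} {x : M}
    (hf : MDifferentiableAt I 𝓘(ℝ, ℝ) f x) :
    (d0 I f x : E →L[ℝ] ℝ) =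
      fderiv ℝ (fun u => f ((extChartAt I x).symm u)) (extChartAt I x x) := by
  rw [d0, hf.mfderiv, I.range_eq_univ, fderivWithin_univ]
  rfl

variable [IsManifold I ∞ M]

variable (I) in
/-- The trivialization of the tangent bundle near `x₀`, at the point `x`. -/
def toModel (x₀ x : M) : TangentSpace I x →L[ℝ] E :=
  (trivializationAt E (TangentSpace I : M → Type _) x₀).continuousLinearMapAt ℝ x

variable (I) in
/-- The inverse of the trivialization of the tangent bundle near `x₀`, at the point `x`. -/
def ofModel (x₀ x : M) : E →L[ℝ] TangentSpace I x :=
  (trivializationAt E (TangentSpace I : M → Type _) x₀).symmL ℝ x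

theorem toModel_ofModel {x₀ x : M} (hx : x ∈ (chartAt H x₀).source) (v : E) :
    toModel I x₀ x (ofModel I x₀ x v) = v :=
  (trivializationAt E (TangentSpace I : M → Type _) x₀).continuousLinearMapAt_symmL
    (by simpa using hx) v

theorem ofModel_toModel {x₀ x : M} (hx : x ∈ (chartAt H x₀).source) (v : TangentSpace I x) :
    ofModel I x₀ x (toModel I x₀ x v) = v :=
  (trivializationAt E (TangentSpace I : M → Type _) x₀).symmL_continuousLinearMapAt
    (by simpa using hx) v

theorem toModel_injective {x₀ x : M} (hx : x ∈ (chartAt H x₀).source) :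
    Function.Injective (toModel I x₀ x) :=
  Function.LeftInverse.injective (g := ofModel I x₀ x) (ofModel_toModel hx)

theorem toModel_eq_mfderiv {x₀ x : M} (hx : x ∈ (chartAt H x₀).source) :
    toModel I x₀ x = (mfderiv I 𝓘(ℝ, E) (extChartAt I x₀) x : TangentSpace I x →L[ℝ] E) :=
  TangentBundle.continuousLinearMapAt_trivializationAt hx

theorem ofModel_eq_mfderiv [I.Boundaryless] {x₀ x : M} (hx : x ∈ (chartAt H x₀).source) :
    ofModel I x₀ x = (mfderiv 𝓘(ℝ, E) I (extChartAt I x₀).symm (extChartAt I x₀ x) :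
      E →L[ℝ] TangentSpace I ((extChartAt I x₀).symm (extChartAt I x₀ x))) := by
  have h := TangentBundle.symmL_trivializationAt (I := I) hx
  rwa [I.range_eq_univ, mfderivWithin_univ] at h

theorem toModel_self (x : M) : toModel I x x = ContinuousLinearMap.id ℝ E := by
  rw [toModel_eq_mfderiv (mem_chart_source H x)]
  exact mfderiv_extChartAt_self

theorem ofModel_self (x : M) : ofModel I x x = ContinuousLinearMap.id ℝ E := by
  ext v
  have h := toModel_ofModel (I := I) (mem_chart_source H x) v
  rwa [toModel_self] at h

theorem smoothVectorFieldOn_iff {X : Π x : M, TangentSpace I x} {U : Set M} {x₀ : M}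
    (hU : IsOpen U) (hUs : U ⊆ (chartAt H x₀).source) :
    SmoothVectorFieldOn I X U ↔ ContMDiffOn I 𝓘(ℝ, E) ∞ (fun x => toModel I x₀ x (X x)) U := by
  have h := (trivializationAt E (TangentSpace I : M → Type _) x₀).contMDiffOn_section_iff
    (IB := I) (n := ∞) (s := X) (a := U) hU (by simpa using hUs)
  refine h.trans (contMDiffOn_congr fun x hx => ?_)
  have hb : x ∈ (trivializationAt E (TangentSpace I : M → Type _) x₀).baseSet := by
    simpa using hUs hx
  exact ((trivializationAt E (TangentSpace I : M → Type _) x₀).continuousLinearMapAt_apply_of_mem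
    ℝ hb (X x)).symm

variable (I) in
/-- A covector at `x` read in the trivialization near `x₀`. -/
def covectorToModel (x₀ x : M) (α : Cotangent I x) : E →L[ℝ] ℝ := α.comp (ofModel I x₀ x)

theorem covectorToModel_apply (x₀ x : M) (α : Cotangent I x) (v : E) :
    covectorToModel I x₀ x α v = α (ofModel I x₀ x v) := rfl

theorem trivializationAt_cotangent {x₀ x : M} (hx : x ∈ (chartAt H x₀).source)
    (α : Cotangent I x) :
    (trivializationAt (E →L[ℝ] ℝ) (fun x : M => Cotangent I x) x₀ ⟨x, α⟩).2 =
      covectorToModel I x₀ x α := by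
  rw [hom_trivializationAt_apply,
    ContinuousLinearMap.inCoordinates_eq (by simpa using hx) (by simp)]
  ext v
  simp [covectorToModel, ofModel,
    (trivializationAt E (TangentSpace I : M → Type _) x₀).symmL_apply (R := ℝ) (by simpa using hx)]

theorem smoothOneFormOn_iff {α : Π x : M, Cotangent I x} {U : Set M} {x₀ : M}
    (hU : IsOpen U) (hUs : U ⊆ (chartAt H x₀).source) :
    SmoothOneFormOn I α U ↔
      ContMDiffOn I 𝓘(ℝ, E →L[ℝ] ℝ) ∞
        (fun x => covectorToModel I x₀ x (α x)) U := by
  have h := (trivializationAt (E →L[ℝ] ℝ) (fun x : M => Cotangent I x) x₀).contMDiffOn_section_iff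
    (IB := I) (n := ∞) (s := α) (a := U) hU (by simpa using hUs)
  exact h.trans (contMDiffOn_congr fun x hx => trivializationAt_cotangent (hUs hx) (α x))

theorem contDiffAt_comp_extChartAt_symm [I.Boundaryless] {S : Type*} [NormedAddCommGroup S]
    [NormedSpace ℝ S] {f : M → S} {x₀ : M} (hf : ContMDiffAt I 𝓘(ℝ, S) ∞ f x₀) :
    ContDiffAt ℝ ∞ (fun u => f ((extChartAt I x₀).symm u)) (extChartAt I x₀ x₀) := by
  rw [← contMDiffAt_iff_contDiffAt]
  have h_symm : ContMDiffAt 𝓘(ℝ, E) I ∞ (extChartAt I x₀).symm (extChartAt I x₀ x₀) :=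
    (contMDiffOn_extChartAt_symm x₀).contMDiffAt (extChartAt_target_mem_nhds x₀)
  exact ContMDiffAt.comp (extChartAt I x₀ x₀) (by simpa using hf) h_symm

variable (I) in
/-- A vector field read in the preferred chart at `x₀`. -/
def vectorFieldInChart (X : Π x : M, TangentSpace I x) (x₀ : M) (u : E) : E :=
  toModel I x₀ ((extChartAt I x₀).symm u) (X ((extChartAt I x₀).symm u))

theorem oneFormInChart_eq [I.Boundaryless] (α : Π x : M, Cotangent I x) (x₀ : M) :
    ∀ᶠ u in 𝓝 (extChartAt I x₀ x₀), oneFormInChart I α x₀ u =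
      covectorToModel I x₀ ((extChartAt I x₀).symm u) (α ((extChartAt I x₀).symm u)) := by
  filter_upwards [eventually_extChartAt_symm_mem_source (I := I) x₀] with u hu
  have h := ofModel_eq_mfderiv (I := I) hu.1
  rw [hu.2] at h
  rw [oneFormInChart, I.range_eq_univ, mfderivWithin_univ, covectorToModel, h]

theorem contDiffAt_vectorFieldInChart [I.Boundaryless] {X : Π x : M, TangentSpace I x} {U : Set M}
    {x₀ : M} (hX : SmoothVectorFieldOn I X U) (hU : U ∈ 𝓝 x₀) :
    ContDiffAt ℝ ∞ (vectorFieldInChart I X x₀) (extChartAt I x₀ x₀) := by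
  have h_chart : SmoothVectorFieldOn I X (interior U ∩ (chartAt H x₀).source) :=
    hX.mono (inter_subset_left.trans interior_subset)
  rw [smoothVectorFieldOn_iff (isOpen_interior.inter (chartAt H x₀).open_source)
    inter_subset_right] at h_chart
  exact contDiffAt_comp_extChartAt_symm (h_chart.contMDiffAt
    (Filter.inter_mem (interior_mem_nhds.2 hU) (chart_source_mem_nhds H x₀)))

theorem contDiffAt_oneFormInChart [I.Boundaryless] {α : Π x : M, Cotangent I x} {U : Set M}
    {x₀ : M} (hα : SmoothOneFormOn I α U) (hU : U ∈ 𝓝 x₀) :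
    ContDiffAt ℝ ∞ (oneFormInChart I α x₀) (extChartAt I x₀ x₀) := by
  have h_chart : SmoothOneFormOn I α (interior U ∩ (chartAt H x₀).source) :=
    hα.mono (inter_subset_left.trans interior_subset)
  rw [smoothOneFormOn_iff (isOpen_interior.inter (chartAt H x₀).open_source)
    inter_subset_right] at h_chart
  exact (contDiffAt_comp_extChartAt_symm (h_chart.contMDiffAt
    (Filter.inter_mem (interior_mem_nhds.2 hU) (chart_source_mem_nhds H x₀)))).congr_of_eventuallyEq
    (oneFormInChart_eq α x₀)

theorem eventually_oneFormInChart_apply [I.Boundaryless] (α : Π x : M, Cotangent I x)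
    (X : Π x : M, TangentSpace I x) (x₀ : M) :
    ∀ᶠ u in 𝓝 (extChartAt I x₀ x₀), oneFormInChart I α x₀ u (vectorFieldInChart I X x₀ u) =
      α ((extChartAt I x₀).symm u) (X ((extChartAt I x₀).symm u)) := by
  filter_upwards [eventually_extChartAt_symm_mem_source (I := I) x₀, oneFormInChart_eq α x₀]
    with u hu h
  rw [h, covectorToModel_apply, vectorFieldInChart, ofModel_toModel hu.1]

theorem d1_eq_vecD1 [I.Boundaryless] (α : Π x : M, Cotangent I x) (x : M) (v : E) :
    (d1 I α x : E →ₗ[ℝ] (E →L[ℝ] ℝ)) v =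
      vecD1 (oneFormInChart I α x) (extChartAt I x x) v := by
  have h_id : (mfderiv I 𝓘(ℝ, E) (extChartAt I x) x : TangentSpace I x →L[ℝ] E) =
    ContinuousLinearMap.id ℝ E := mfderiv_extChartAt_self
  simp only [d1]
  rw [h_id, I.range_eq_univ, fderivWithin_univ]
  rfl

theorem mpullbackWithin_extChartAt_symm_eventuallyEq [I.Boundaryless]
    (X : Π x : M, TangentSpace I x) (x₀ : M) :
    (VectorField.mpullbackWithin 𝓘(ℝ, E) I (extChartAt I x₀).symm X (range I) : E → E)
      =ᶠ[𝓝 (extChartAt I x₀ x₀)] vectorFieldInChart I X x₀ := by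
  filter_upwards [eventually_extChartAt_symm_mem_source (I := I) x₀] with u hu
  have h_ofModel := ofModel_eq_mfderiv (I := I) hu.1
  rw [hu.2] at h_ofModel
  have h_inverse : (ofModel I x₀ ((extChartAt I x₀).symm u)).inverse =
      toModel I x₀ ((extChartAt I x₀).symm u) :=
    ContinuousLinearMap.inverse_eq (by ext v; exact ofModel_toModel hu.1 v)
      (by ext v; exact toModel_ofModel hu.1 v)
  rw [VectorField.mpullbackWithin_apply, I.range_eq_univ, mfderivWithin_univ, ← h_ofModel]
  exact congrArg (fun A => A (X ((extChartAt I x₀).symm u))) h_inverse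

theorem mlieBracket_eq_lieBracket_vectorFieldInChart [I.Boundaryless]
    (X Y : Π x : M, TangentSpace I x) (x : M) :
    (VectorField.mlieBracket I X Y x : E) =
      VectorField.lieBracket ℝ (vectorFieldInChart I X x) (vectorFieldInChart I Y x)
        (extChartAt I x x) := by
  have h_id : (mfderiv I 𝓘(ℝ, E) (extChartAt I x) x : TangentSpace I x →L[ℝ] E) =
    ContinuousLinearMap.id ℝ E := mfderiv_extChartAt_self
  have h_congr (A : E →L[ℝ] E) (V W : E → E) (hA : A = ContinuousLinearMap.id ℝ E)
      (hV : V =ᶠ[𝓝 (extChartAt I x x)] vectorFieldInChart I X x)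
      (hW : W =ᶠ[𝓝 (extChartAt I x x)] vectorFieldInChart I Y x) :
      A.inverse (VectorField.lieBracketWithin ℝ V W
        ((extChartAt I x).symm ⁻¹' univ ∩ range I) (extChartAt I x x)) =
      VectorField.lieBracket ℝ (vectorFieldInChart I X x) (vectorFieldInChart I Y x)
        (extChartAt I x x) := by
    rw [hA, preimage_univ, univ_inter, I.range_eq_univ, VectorField.lieBracketWithin_univ,
      ContinuousLinearMap.inverse_id]
    exact hV.lieBracket_vectorField_eq hW
  exact h_congr _ _ _ h_id (mpullbackWithin_extChartAt_symm_eventuallyEq X x)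
    (mpullbackWithin_extChartAt_symm_eventuallyEq Y x)

theorem vectorFieldInChart_self (X : Π x : M, TangentSpace I x) (x : M) :
    vectorFieldInChart I X x (extChartAt I x x) = (X x : E) := by
  have h : ∀ y : M, y = x → toModel I x y (X y) = (X x : E) := by
    rintro _ rfl
    rw [toModel_self]
    rfl
  exact h _ (extChartAt_to_inv x)

theorem oneFormInChart_self [I.Boundaryless] (α : Π x : M, Cotangent I x) (x : M) :
    oneFormInChart I α x (extChartAt I x x) = (α x : E →L[ℝ] ℝ) := by
  rw [(oneFormInChart_eq α x).self_of_nhds]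
  have h : ∀ y : M, y = x → covectorToModel I x y (α y) = (α x : E →L[ℝ] ℝ) := by
    rintro _ rfl
    rw [covectorToModel, ofModel_self]
    rfl
  exact h _ (extChartAt_to_inv x)

theorem mdifferentiableAt_of_comp_extChartAt_symm {S : Type*} [NormedAddCommGroup S]
    [NormedSpace ℝ S] {f : M → S} {x : M}
    (hf : DifferentiableAt ℝ (fun u => f ((extChartAt I x).symm u)) (extChartAt I x x)) :
    MDifferentiableAt I 𝓘(ℝ, S) f x := by
  have h_chart : MDifferentiableAt I 𝓘(ℝ, E) (extChartAt I x) x :=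
    mdifferentiableAt_extChartAt (mem_chart_source H x)
  refine (hf.mdifferentiableAt.comp x h_chart).congr_of_eventuallyEq ?_
  filter_upwards [extChartAt_source_mem_nhds (I := I) x] with y hy
  exact congrArg f ((extChartAt I x).left_inv hy).symm

variable (I) in
/-- A section of `TM ⊕ T^*M` read in the preferred chart at `x₀`. -/
def sectionInChart (X : Π x : M, TangentSpace I x) (α : Π x : M, Cotangent I x) (x₀ : M) (u : E) :
    E × (E →L[ℝ] ℝ) :=
  (vectorFieldInChart I X x₀ u, oneFormInChart I α x₀ u)

theorem sectionInChart_self [I.Boundaryless] (X : Π x : M, TangentSpace I x)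
    (α : Π x : M, Cotangent I x) (x : M) :
    sectionInChart I X α x (extChartAt I x x) = ((X x : E), (α x : E →L[ℝ] ℝ)) :=
  Prod.ext (vectorFieldInChart_self X x) (oneFormInChart_self α x)

theorem contDiffAt_sectionInChart [I.Boundaryless] {X : Π x : M, TangentSpace I x}
    {α : Π x : M, Cotangent I x} {U : Set M} {x₀ : M} (hX : SmoothVectorFieldOn I X U)
    (hα : SmoothOneFormOn I α U) (hU : U ∈ 𝓝 x₀) :
    ContDiffAt ℝ ∞ (sectionInChart I X α x₀) (extChartAt I x₀ x₀) :=
  (contDiffAt_vectorFieldInChart hX hU).prodMk (contDiffAt_oneFormInChart hα hU)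

theorem courantBracket_eq_vecCourantBracket [I.Boundaryless] {X Y : Π x : M, TangentSpace I x}
    {α β : Π x : M, Cotangent I x} {x : M}
    (hX : DifferentiableAt ℝ (sectionInChart I X α x) (extChartAt I x x))
    (hY : DifferentiableAt ℝ (sectionInChart I Y β x) (extChartAt I x x)) :
    (courantBracket I X α Y β x : E × (E →L[ℝ] ℝ)) =
      vecCourantBracket (sectionInChart I X α x) (sectionInChart I Y β x)
        (extChartAt I x x) := by
  have h_eq : (fun u => (β ((extChartAt I x).symm u) (X ((extChartAt I x).symm u)) -
        α ((extChartAt I x).symm u) (Y ((extChartAt I x).symm u)) : ℝ)) =ᶠ[𝓝 (extChartAt I x x)]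
      fun u => oneFormInChart I β x u (vectorFieldInChart I X x u) -
        oneFormInChart I α x u (vectorFieldInChart I Y x u) := by
    filter_upwards [eventually_oneFormInChart_apply β X x,
      eventually_oneFormInChart_apply α Y x] with u hu hu'
    rw [hu, hu']
  have h_diff : MDifferentiableAt I 𝓘(ℝ, ℝ) (fun y => (β y (X y) - α y (Y y) : ℝ)) x :=
    mdifferentiableAt_of_comp_extChartAt_symm (h_eq.differentiableAt_iff.2
      ((hY.snd.clm_apply hX.fst).sub (hX.snd.clm_apply hY.fst)))
  have h_d0 : (d0 I (fun y => (β y (X y) - α y (Y y) : ℝ)) x : E →L[ℝ] ℝ) =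
      fderiv ℝ (fun u => oneFormInChart I β x u (vectorFieldInChart I X x u) -
        oneFormInChart I α x u (vectorFieldInChart I Y x u)) (extChartAt I x x) :=
    (d0_eq_fderiv h_diff).trans h_eq.fderiv_eq
  have h_d1 (γ : Π x : M, Cotangent I x) (Z : Π x : M, TangentSpace I x) :
      (d1 I γ x : E →ₗ[ℝ] (E →L[ℝ] ℝ)) (Z x) =
        vecD1 (oneFormInChart I γ x) (extChartAt I x x)
          (vectorFieldInChart I Z x (extChartAt I x x)) :=
    (d1_eq_vecD1 γ x (Z x)).trans (congrArg _ (vectorFieldInChart_self Z x).symm)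
  exact Prod.ext (mlieBracket_eq_lieBracket_vectorFieldInChart X Y x)
    (congrArg₂ (fun p q : E →L[ℝ] ℝ => p + (1 / 2 : ℝ) • q)
      (congrArg₂ (fun p q : E →L[ℝ] ℝ => p - q) (h_d1 β X) (h_d1 α Y)) h_d0)

theorem eventually_dualPairing_sectionInChart [I.Boundaryless] (X Y : Π x : M, TangentSpace I x)
    (α β : Π x : M, Cotangent I x) (x₀ : M) :
    ∀ᶠ u in 𝓝 (extChartAt I x₀ x₀),
      dualPairing (sectionInChart I X α x₀ u) (sectionInChart I Y β x₀ u) =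
        α ((extChartAt I x₀).symm u) (Y ((extChartAt I x₀).symm u)) +
          β ((extChartAt I x₀).symm u) (X ((extChartAt I x₀).symm u)) := by
  filter_upwards [eventually_oneFormInChart_apply α Y x₀,
    eventually_oneFormInChart_apply β X x₀] with u hu hu'
  exact congrArg₂ (· + ·) hu hu'

theorem DiracStructure.cyclic_fderiv_sectionInChart_eq_zero [I.Boundaryless]
    (L : DiracStructure I M) {U : Set M} (hU : IsOpen U) {x₀ : M} (hx : x₀ ∈ U)
    {X Y Z : Π x : M, TangentSpace I x} {α β γ : Π x : M, Cotangent I x}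
    (hX : SmoothVectorFieldOn I X U) (hα : SmoothOneFormOn I α U)
    (hY : SmoothVectorFieldOn I Y U) (hβ : SmoothOneFormOn I β U)
    (hZ : SmoothVectorFieldOn I Z U) (hγ : SmoothOneFormOn I γ U)
    (ha : ∀ x ∈ U, (X x, α x) ∈ L.fiber x) (hb : ∀ x ∈ U, (Y x, β x) ∈ L.fiber x)
    (hc : ∀ x ∈ U, (Z x, γ x) ∈ L.fiber x) :
    dualPairing (fderiv ℝ (sectionInChart I Y β x₀) (extChartAt I x₀ x₀)
          (vectorFieldInChart I X x₀ (extChartAt I x₀ x₀)))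
        (sectionInChart I Z γ x₀ (extChartAt I x₀ x₀)) +
      dualPairing (fderiv ℝ (sectionInChart I Z γ x₀) (extChartAt I x₀ x₀)
          (vectorFieldInChart I Y x₀ (extChartAt I x₀ x₀)))
        (sectionInChart I X α x₀ (extChartAt I x₀ x₀)) +
      dualPairing (fderiv ℝ (sectionInChart I X α x₀) (extChartAt I x₀ x₀)
          (vectorFieldInChart I Z x₀ (extChartAt I x₀ x₀)))
        (sectionInChart I Y β x₀ (extChartAt I x₀ x₀)) = 0 := by
  have hU₀ := hU.mem_nhds hx
  have h_diff {V : Π x : M, TangentSpace I x} {δ : Π x : M, Cotangent I x}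
      (hV : SmoothVectorFieldOn I V U) (hδ : SmoothOneFormOn I δ U) :
      DifferentiableAt ℝ (sectionInChart I V δ x₀) (extChartAt I x₀ x₀) :=
    (contDiffAt_sectionInChart hV hδ hU₀).differentiableAt (by simp)
  have h_isotropic {V : Π x : M, TangentSpace I x} {δ : Π x : M, Cotangent I x}
      (hV : ∀ x ∈ U, (V x, δ x) ∈ L.fiber x) :
      (fun u => dualPairing (sectionInChart I X α x₀ u) (sectionInChart I V δ x₀ u))
        =ᶠ[𝓝 (extChartAt I x₀ x₀)] 0 := by
    filter_upwards [eventually_dualPairing_sectionInChart X V α δ x₀,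
      eventually_extChartAt_symm_mem hU₀] with u hu hu_mem
    exact hu.trans (L.isotropic _ _ (ha _ hu_mem) _ (hV _ hu_mem))
  refine (dualPairing_vecCourantBracket (h_diff hX hα) (h_diff hY hβ) (h_diff hZ hγ)
    (h_isotropic hb) (h_isotropic hc)).symm.trans ?_
  rw [← courantBracket_eq_vecCourantBracket (h_diff hX hα) (h_diff hY hβ), sectionInChart_self]
  exact L.isotropic x₀ _ (L.integrable U hU X α Y β hX hα hY hβ ha hb x₀ hx) _ (hc x₀ hx)

end Charts

section FrameMap

variable {S : Type*} [NormedAddCommGroup S] [NormedSpace ℝ S] {m : ℕ}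

/-- The map `c ↦ ∑ cᵢ wᵢ` of a finite family of vectors, as a continuous linear map. -/
def frameCLM (w : Fin m → S) : (Fin m → ℝ) →L[ℝ] S :=
  LinearMap.toContinuousLinearMap (Fintype.linearCombination ℝ w)

theorem frameCLM_apply (w : Fin m → S) (c : Fin m → ℝ) : frameCLM w c = ∑ i, c i • w i := rfl

theorem contDiff_frameCLM : ContDiff ℝ ∞ (frameCLM : (Fin m → S) → _) := by
  rw [contDiff_clm_apply_iff]
  intro c
  simp only [frameCLM_apply]
  fun_prop

end FrameMap

section DiracFrames

variable {E : Type*} [NormedAddCommGroup E] [NormedSpace ℝ E]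
  {H : Type*} [TopologicalSpace H] {I : ModelWithCorners ℝ E H}
  {M : Type*} [TopologicalSpace M] [ChartedSpace H M] [IsManifold I ∞ M]

variable (I) in
/-- An element of `TM ⊕ T^*M` read in the trivialization near `x₀`. -/
def pairToModel (x₀ x : M) : (TangentSpace I x × Cotangent I x) →ₗ[ℝ] E × (E →L[ℝ] ℝ) where
  toFun p := (toModel I x₀ x p.1, covectorToModel I x₀ x p.2)
  map_add' p q := by
    refine Prod.ext (map_add _ _ _) ?_
    ext v; rfl
  map_smul' c p := by
    refine Prod.ext (map_smul _ _ _) ?_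
    ext v; rfl

theorem covectorToModel_toModel {x₀ x : M} (hx : x ∈ (chartAt H x₀).source) (α : Cotangent I x)
    (v : TangentSpace I x) : covectorToModel I x₀ x α (toModel I x₀ x v) = α v := by
  rw [covectorToModel_apply, ofModel_toModel hx]

theorem covectorToModel_comp_toModel {x₀ x : M} (hx : x ∈ (chartAt H x₀).source)
    (ξ : E →L[ℝ] ℝ) :
    covectorToModel I x₀ x (ξ.comp (toModel I x₀ x) : TangentSpace I x →L[ℝ] ℝ) = ξ := by
  ext v
  rw [covectorToModel_apply]
  exact congrArg ξ (toModel_ofModel hx v)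

theorem pairToModel_ofModel {x₀ x : M} (hx : x ∈ (chartAt H x₀).source) (p : E × (E →L[ℝ] ℝ)) :
    pairToModel I x₀ x
      (ofModel I x₀ x p.1, (p.2.comp (toModel I x₀ x) : TangentSpace I x →L[ℝ] ℝ)) = p :=
  Prod.ext (toModel_ofModel hx p.1) (covectorToModel_comp_toModel hx p.2)

theorem pairToModel_injective {x₀ x : M} (hx : x ∈ (chartAt H x₀).source) :
    Function.Injective (pairToModel I x₀ x) := by
  rintro ⟨v, α⟩ ⟨w, β⟩ h
  have h_fst : toModel I x₀ x v = toModel I x₀ x w := congrArg Prod.fst h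
  have h_snd : covectorToModel I x₀ x α = covectorToModel I x₀ x β := congrArg Prod.snd h
  refine Prod.ext ?_ ?_
  · exact toModel_injective hx h_fst
  · ext z
    exact (covectorToModel_toModel hx α z).symm.trans
      ((congrArg (· (toModel I x₀ x z)) h_snd).trans (covectorToModel_toModel hx β z))

theorem DiracStructure.courantTensor_eq_zero [I.Boundaryless] (L : DiracStructure I M)
    {R : Type*} [NormedAddCommGroup R] [NormedSpace ℝ R] {U : Set M} (hU : IsOpen U) {x₀ : M}
    (hx₀ : x₀ ∈ U) (hUs : U ⊆ (chartAt H x₀).source) {G : M → R →L[ℝ] E × (E →L[ℝ] ℝ)}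
    (hG : ContMDiffOn I 𝓘(ℝ, R →L[ℝ] E × (E →L[ℝ] ℝ)) ∞ G U)
    (hGL : ∀ x ∈ U, ∀ c, ∃ p ∈ L.fiber x, G x c = pairToModel I x₀ x p) (a b c : R) :
    courantTensor (fun u => G ((extChartAt I x₀).symm u)) (extChartAt I x₀ x₀) a b c = 0 := by
  have hU₀ := hU.mem_nhds hx₀
  let X (c : R) (x : M) : TangentSpace I x := ofModel I x₀ x (G x c).1
  let α (c : R) (x : M) : Cotangent I x := (G x c).2.comp (toModel I x₀ x)
  have h_read (c : R) {x : M} (hx : x ∈ U) : pairToModel I x₀ x (X c x, α c x) = G x c :=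
    pairToModel_ofModel (hUs hx) (G x c)
  have h_mem (c : R) : ∀ x ∈ U, (X c x, α c x) ∈ L.fiber x := fun x hx => by
    obtain ⟨p, hp, hGp⟩ := hGL x hx c
    rwa [pairToModel_injective (hUs hx) ((h_read c hx).trans hGp)]
  have hGc (c : R) : ContMDiffOn I 𝓘(ℝ, E × (E →L[ℝ] ℝ)) ∞ (fun x => G x c) U :=
    hG.clm_apply contMDiffOn_const
  have hX (c : R) : SmoothVectorFieldOn I (X c) U := (smoothVectorFieldOn_iff hU hUs).2
    ((contDiff_fst.contMDiff.comp_contMDiffOn (hGc c)).congr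
      fun x hx => congrArg Prod.fst (h_read c hx))
  have hα (c : R) : SmoothOneFormOn I (α c) U := (smoothOneFormOn_iff hU hUs).2
    ((contDiff_snd.contMDiff.comp_contMDiffOn (hGc c)).congr
      fun x hx => congrArg Prod.snd (h_read c hx))
  have h_section (c : R) : (fun u => G ((extChartAt I x₀).symm u) c) =ᶠ[𝓝 (extChartAt I x₀ x₀)]
      sectionInChart I (X c) (α c) x₀ := by
    filter_upwards [oneFormInChart_eq (α c) x₀, eventually_extChartAt_symm_mem hU₀] with u hu hu_mem
    exact (h_read c hu_mem).symm.trans (Prod.ext rfl hu.symm)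
  have h_fderiv (c : R) (v : E) :=
    fderiv_clm_apply_eq_of_eventuallyEq
      ((contDiffAt_comp_extChartAt_symm (hG.contMDiffAt hU₀)).differentiableAt (by simp))
      ((contDiffAt_sectionInChart (hX c) (hα c) hU₀).differentiableAt (by simp)).hasFDerivAt
      (h_section c) v
  have h_center (c : R) := (h_section c).self_of_nhds
  rw [courantTensor, h_fderiv, h_fderiv, h_fderiv]
  simp only [h_center]
  exact L.cyclic_fderiv_sectionInChart_eq_zero hU hx₀ (hX a) (hα a) (hX b) (hα b) (hX c) (hα c)
    (h_mem a) (h_mem b) (h_mem c)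

theorem DiracStructure.exists_frame [I.Boundaryless] (L : DiracStructure I M) (x₀ : M) :
    ∃ U : Set M, IsOpen U ∧ x₀ ∈ U ∧ U ⊆ (chartAt H x₀).source ∧
    ∃ G : M → (Fin (Module.finrank ℝ E) → ℝ) →L[ℝ] E × (E →L[ℝ] ℝ),
      ContMDiffOn I 𝓘(ℝ, (Fin (Module.finrank ℝ E) → ℝ) →L[ℝ] E × (E →L[ℝ] ℝ)) ∞ G U ∧
      (∀ x ∈ U, Function.Injective (G x) ∧
        ∀ p, p ∈ L.fiber x ↔ ∃ c, G x c = pairToModel I x₀ x p) ∧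
      ∀ a b c, courantTensor (fun u => G ((extChartAt I x₀).symm u)) (extChartAt I x₀ x₀)
        a b c = 0 := by
  obtain ⟨U₀, hU₀, hx₀, X, α, h_smooth, h_span⟩ := L.smooth x₀
  have hU := hU₀.inter (chartAt H x₀).open_source
  set U := U₀ ∩ (chartAt H x₀).source
  have hx₀U : x₀ ∈ U := ⟨hx₀, mem_chart_source H x₀⟩
  have hUs : U ⊆ (chartAt H x₀).source := inter_subset_right
  let G (x : M) : (Fin (Module.finrank ℝ E) → ℝ) →L[ℝ] E × (E →L[ℝ] ℝ) :=
    frameCLM fun i => pairToModel I x₀ x (X i x, α i x)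
  have hG : ContMDiffOn I 𝓘(ℝ, (Fin (Module.finrank ℝ E) → ℝ) →L[ℝ] E × (E →L[ℝ] ℝ)) ∞ G U := by
    refine (contDiff_frameCLM (S := E × (E →L[ℝ] ℝ))).contMDiff.comp_contMDiffOn ?_
    rw [contMDiffOn_pi_space]
    intro i
    exact ((smoothVectorFieldOn_iff hU hUs).1 ((h_smooth i).1.mono inter_subset_left)).prodMk_space
      ((smoothOneFormOn_iff hU hUs).1 ((h_smooth i).2.mono inter_subset_left))
  have hG_apply (x c) : G x c = pairToModel I x₀ x (∑ i, c i • (X i x, α i x)) := by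
    rw [map_sum]
    simp only [map_smul]
    rfl
  have h_injective : ∀ x ∈ U, Function.Injective (G x) := fun x hx => by
    have h_indep : LinearIndependent ℝ (fun i => (X i x, α i x)) := by
      rw [linearIndependent_iff_card_eq_finrank_span, Set.finrank, ← h_span x hx.1,
        L.finrank_fiber, Fintype.card_fin]
    rw [injective_iff_map_eq_zero]
    intro c hc
    rw [hG_apply, map_eq_zero_iff _ (pairToModel_injective (hUs hx))] at hc
    exact funext fun i => Fintype.linearIndependent_iff.1 h_indep c hc i
  have h_mem_iff : ∀ x ∈ U, ∀ p, p ∈ L.fiber x ↔ ∃ c, G x c = pairToModel I x₀ x p :=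
    fun x hx p => by
      rw [h_span x hx.1, Submodule.mem_span_range_iff_exists_fun]
      simp only [hG_apply, (pairToModel_injective (hUs hx)).eq_iff]
  refine ⟨U, hU, hx₀U, hUs, G, hG, fun x hx => ⟨h_injective x hx, h_mem_iff x hx⟩,
    L.courantTensor_eq_zero hU hx₀U hUs hG fun x hx c => ⟨_, ?_, hG_apply x c⟩⟩
  exact (h_mem_iff x hx _).2 ⟨c, hG_apply x c⟩

theorem extChartAt_comp_fderiv_eventuallyEq {F : Type*} [NormedAddCommGroup F] [NormedSpace ℝ F]
    {f : F → M} {z : F} (hf : ContMDiffAt 𝓘(ℝ, F) I 2 f z) :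
    fderiv ℝ (fun y => extChartAt I (f z) (f y)) =ᶠ[𝓝 z]
      fun y => (toModel I (f z) (f y)).comp
        (mfderiv 𝓘(ℝ, F) I f y : F →L[ℝ] TangentSpace I (f y)) := by
  filter_upwards [hf.continuousAt.eventually (chart_source_mem_nhds H (f z)),
    (contMDiffAt_iff_contMDiffAt_nhds (by simp)).1 hf] with y hy_source hy_smooth
  rw [← mfderiv_eq_fderiv, toModel_eq_mfderiv hy_source]
  exact mfderiv_comp y (mdifferentiableAt_extChartAt (I := I) hy_source)
    (hy_smooth.mdifferentiableAt (by simp))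

theorem d1_comp [I.Boundaryless] {F : Type*} [NormedAddCommGroup F] [NormedSpace ℝ F]
    {f : F → M} {z : F} (hf : ContMDiffAt 𝓘(ℝ, F) I 2 f z) {α : Π x : M, Cotangent I x}
    (hα : DifferentiableAt ℝ (oneFormInChart I α (f z)) (extChartAt I (f z) (f z))) (v w : F) :
    d1 I α (f z) (mfderiv 𝓘(ℝ, F) I f z v) (mfderiv 𝓘(ℝ, F) I f z w) =
      vecD1 (fun y => ((α (f y)).comp (mfderiv 𝓘(ℝ, F) I f y : F →L[ℝ] TangentSpace I (f y)) :
        F →L[ℝ] ℝ)) z v w := by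
  let h (y : F) : E := extChartAt I (f z) (f y)
  have h_smooth : ContDiffAt ℝ 2 h z := by
    rw [← contMDiffAt_iff_contDiffAt]
    exact (contMDiffAt_extChartAt (I := I) (n := 2) (x := f z)).comp z hf
  have h_fderiv : fderiv ℝ h =ᶠ[𝓝 z] _ := extChartAt_comp_fderiv_eventuallyEq hf
  have h_form : (fun y => ((α (f y)).comp (mfderiv 𝓘(ℝ, F) I f y : F →L[ℝ] TangentSpace I (f y)) :
        F →L[ℝ] ℝ)) =ᶠ[𝓝 z] fun y => (oneFormInChart I α (f z) (h y)).comp (fderiv ℝ h y) := by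
    filter_upwards [h_smooth.continuousAt.eventually (oneFormInChart_eq α (f z)),
      hf.continuousAt.eventually (chart_source_mem_nhds H (f z)), h_fderiv]
      with y hy_form hy_source hy_fderiv
    have hy_symm : (extChartAt I (f z)).symm (h y) = f y :=
      (extChartAt I (f z)).left_inv (by rwa [extChartAt_source])
    rw [hy_form, hy_symm, hy_fderiv]
    ext v
    exact (covectorToModel_toModel hy_source (α (f y)) (mfderiv 𝓘(ℝ, F) I f y v)).symm
  have h_fderiv_center : fderiv ℝ h z = (mfderiv 𝓘(ℝ, F) I f z : F →L[ℝ] E) :=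
    h_fderiv.self_of_nhds.trans
      (congrArg (fun A : E →L[ℝ] E => A ∘L (mfderiv 𝓘(ℝ, F) I f z : F →L[ℝ] E))
        (toModel_self (f z)))
  have h_pullback := vecD1_pullback (a := oneFormInChart I α (f z)) (h := h) hα h_smooth v w
  rw [h_fderiv_center] at h_pullback
  rw [vecD1, h_form.fderiv_eq, ← vecD1, h_pullback]
  exact congrArg (fun β : E →L[ℝ] ℝ => β (mfderiv 𝓘(ℝ, F) I f z w)) (d1_eq_vecD1 α (f z) _)

end DiracFrames

section Immersion

variable {E : Type*} [NormedAddCommGroup E] [NormedSpace ℝ E]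
  {H : Type*} [TopologicalSpace H] {I : ModelWithCorners ℝ E H}
  {M : Type*} [TopologicalSpace M] [ChartedSpace H M]
  {E' : Type*} [NormedAddCommGroup E'] [NormedSpace ℝ E']
  {H' : Type*} [TopologicalSpace H'] {J : ModelWithCorners ℝ E' H'}
  {P : Type*} [TopologicalSpace P] [ChartedSpace H' P]

theorem mfderiv_injective_of_eventually_leftInverse {i : M → P} {g : P → M} {x : M}
    (hi : MDifferentiableAt I J i x) (hg : MDifferentiableAt J I g (i x))
    (hgi : ∀ᶠ y in 𝓝 x, g (i y) = y) : Function.Injective (mfderiv I J i x) := by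
  have h_comp : (mfderiv J I g (i x)).comp (mfderiv I J i x) = mfderiv I I id x :=
    (mfderiv_comp x hg hi).symm.trans (Filter.EventuallyEq.mfderiv_eq hgi)
  rw [mfderiv_id] at h_comp
  have h_left (v : TangentSpace I x) : mfderiv J I g (i x) (mfderiv I J i x v) = v :=
    congrArg (fun A : E →L[ℝ] E => A v) h_comp
  exact fun v w hvw => (h_left v).symm.trans ((congrArg _ hvw).trans (h_left w))

theorem exists_leftInverse_of_isImmersionAt [I.Boundaryless] {i : M → P} {x : M}
    (h : Manifold.IsImmersionAt I J ∞ i x) :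
    ∃ g : P → M, MDifferentiableAt J I g (i x) ∧ ∀ᶠ y in 𝓝 x, g (i y) = y := by
  obtain ⟨F, _, _, h⟩ := h
  have h_coord {y : M} (hy : y ∈ h.domChart.source) :
      (h.equiv.symm (h.codChart.extend J (i y))).1 = h.domChart.extend I y := by
    have h_eq := h.writtenInCharts ((h.domChart.extend I).map_source (by simpa using hy))
    simp only [Function.comp_apply] at h_eq
    rw [(h.domChart.extend I).left_inv (by simpa using hy)] at h_eq
    rw [h_eq, ContinuousLinearEquiv.symm_apply_apply]
  have h_cod : MDifferentiableAt J 𝓘(ℝ, E') (h.codChart.extend J) (i x) :=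
    (h.codChart.contMDiffAt_extend h.codChart_mem_maximalAtlas
      h.mem_codChart_source).mdifferentiableAt (by simp)
  have h_proj : MDifferentiableAt 𝓘(ℝ, E') 𝓘(ℝ, E) (fun v => (h.equiv.symm v).1)
      (h.codChart.extend J (i x)) :=
    (ContinuousLinearMap.fst ℝ E F ∘L
      (h.equiv.symm : E' →L[ℝ] E × F)).differentiableAt.mdifferentiableAt
  have h_dom : MDifferentiableAt 𝓘(ℝ, E) I (h.domChart.extend I).symm
      (h.equiv.symm (h.codChart.extend J (i x))).1 := by
    rw [h_coord h.mem_domChart_source]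
    refine ((contMDiffOn_extend_symm h.domChart_mem_maximalAtlas).contMDiffAt ?_).mdifferentiableAt
      (by simp)
    rw [← h.domChart.extend_target']
    exact (h.domChart.isOpen_extend_target (I := I)).mem_nhds
      ((h.domChart.extend I).map_source (by simpa using h.mem_domChart_source))
  refine ⟨fun p => (h.domChart.extend I).symm (h.equiv.symm (h.codChart.extend J p)).1,
    MDifferentiableAt.comp (i x) (g := fun v => (h.domChart.extend I).symm (h.equiv.symm v).1)
      (MDifferentiableAt.comp _ h_dom h_proj) h_cod, ?_⟩
  filter_upwards [h.domChart.open_source.mem_nhds h.mem_domChart_source] with y hy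
  rw [h_coord hy]
  exact (h.domChart.extend I).left_inv (by simpa using hy)

theorem mfderiv_injective_of_isImmersionAt [I.Boundaryless] {i : M → P} {x : M}
    (h : Manifold.IsImmersionAt I J ∞ i x) : Function.Injective (mfderiv I J i x) :=
  have ⟨_, hg, hgi⟩ := exists_leftInverse_of_isImmersionAt h
  mfderiv_injective_of_eventually_leftInverse (h.contMDiffAt.mdifferentiableAt (by simp)) hg hgi

end Immersion

/-! ### Coisotropic embeddings force the rank to be locally constant -/

section Sharp

variable {E : Type*} [NormedAddCommGroup E] [NormedSpace ℝ E]
  {H : Type*} [TopologicalSpace H] {I : ModelWithCorners ℝ E H}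
  {M : Type*} [TopologicalSpace M] [ChartedSpace H M] [IsManifold I ∞ M]

variable (I) in
/-- A map `T*M → TM` at `x`, such as the contraction with a bivector, read in the trivializations
near `x₀`. -/
def sharpToModel (x₀ x : M) (s : Cotangent I x →L[ℝ] TangentSpace I x) :
    (E →L[ℝ] ℝ) →L[ℝ] E :=
  ((toModel I x₀ x).comp s).comp
    (ContinuousLinearMap.precomp ℝ (toModel I x₀ x) :
      (E →L[ℝ] ℝ) →L[ℝ] (TangentSpace I x →L[ℝ] ℝ))

theorem sharpToModel_apply (x₀ x : M) (s : Cotangent I x →L[ℝ] TangentSpace I x)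
    (ξ : E →L[ℝ] ℝ) : sharpToModel I x₀ x s ξ =
      toModel I x₀ x (s (ξ.comp (toModel I x₀ x) : TangentSpace I x →L[ℝ] ℝ)) := rfl

theorem symmL_trivializationAt_cotangent {x₀ x : M} (hx : x ∈ (chartAt H x₀).source)
    (ξ : E →L[ℝ] ℝ) :
    (trivializationAt (E →L[ℝ] ℝ) (fun x : M => Cotangent I x) x₀).symmL ℝ x ξ =
      (ξ.comp (toModel I x₀ x) : TangentSpace I x →L[ℝ] ℝ) := by
  set e := trivializationAt (E →L[ℝ] ℝ) (fun x : M => Cotangent I x) x₀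
  have hb : x ∈ e.baseSet := by simpa [e] using hx
  have h_apply := (e.continuousLinearMapAt_apply_of_mem ℝ hb
    (ξ.comp (toModel I x₀ x) : TangentSpace I x →L[ℝ] ℝ)).trans
      ((trivializationAt_cotangent hx _).trans (covectorToModel_comp_toModel hx ξ))
  have h_symm := e.symmL_continuousLinearMapAt (R := ℝ) hb
    (ξ.comp (toModel I x₀ x) : TangentSpace I x →L[ℝ] ℝ)
  rwa [h_apply] at h_symm

theorem contMDiffAt_sharp_iff {s : Π x : M, Cotangent I x →L[ℝ] TangentSpace I x} {x₀ : M} :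
    ContMDiffAt I (I.prod 𝓘(ℝ, (E →L[ℝ] ℝ) →L[ℝ] E)) ∞
      (fun x => (⟨x, s x⟩ : TotalSpace ((E →L[ℝ] ℝ) →L[ℝ] E)
        (fun x : M => Cotangent I x →L[ℝ] TangentSpace I x))) x₀ ↔
    ContMDiffAt I 𝓘(ℝ, (E →L[ℝ] ℝ) →L[ℝ] E) ∞ (fun x => sharpToModel I x₀ x (s x)) x₀ := by
  rw [contMDiffAt_hom_bundle]
  have h_eq : (fun x => ContinuousLinearMap.inCoordinates (E →L[ℝ] ℝ)
      (fun x : M => Cotangent I x) E (TangentSpace I : M → Type _) x₀ x x₀ x (s x)) =ᶠ[𝓝 x₀]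
      fun x => sharpToModel I x₀ x (s x) := by
    filter_upwards [chart_source_mem_nhds H x₀] with x hx
    ext ξ
    rw [sharpToModel_apply, ← symmL_trivializationAt_cotangent hx]
    rfl
  exact ⟨fun h => h.2.congr_of_eventuallyEq h_eq.symm,
    fun h => ⟨contMDiffAt_id, h.congr_of_eventuallyEq h_eq⟩⟩

end Sharp

section ConormalRank

theorem finrank_map_ker_add_finrank_ker_prod {V W X : Type*} [AddCommGroup V] [Module ℝ V]
    [FiniteDimensional ℝ V] [AddCommGroup W] [Module ℝ W] [AddCommGroup X] [Module ℝ X]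
    (f : V →ₗ[ℝ] W) (g : V →ₗ[ℝ] X) :
    Module.finrank ℝ (f.ker.map g) + Module.finrank ℝ (f.prod g).ker =
      Module.finrank ℝ f.ker := by
  have h_ker : (f.prod g).ker = (g.domRestrict f.ker).ker.map f.ker.subtype := by
    rw [LinearMap.ker_domRestrict, Submodule.map_comap_subtype, LinearMap.ker_prod]
  rw [← LinearMap.range_domRestrict, h_ker, Submodule.finrank_map_subtype_eq]
  exact LinearMap.finrank_range_add_finrank_ker _

variable {E E' F : Type*} [NormedAddCommGroup E] [NormedSpace ℝ E] [FiniteDimensional ℝ E]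
  [NormedAddCommGroup E'] [NormedSpace ℝ E'] [FiniteDimensional ℝ E']
  [NormedAddCommGroup F] [NormedSpace ℝ F]

theorem finrank_continuousDual : Module.finrank ℝ (E →L[ℝ] ℝ) = Module.finrank ℝ E :=
  (LinearMap.toContinuousLinearMap (𝕜 := ℝ) (E := E) (F' := ℝ)).finrank_eq.symm.trans
    Subspace.dual_finrank_eq

theorem finrank_ker_precomp_add {A : E →L[ℝ] E'} (hA : Function.Injective A) :
    Module.finrank ℝ (A.precomp ℝ : (E' →L[ℝ] ℝ) →L[ℝ] (E →L[ℝ] ℝ)).ker + Module.finrank ℝ E =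
      Module.finrank ℝ E' := by
  obtain ⟨R, hR⟩ := ContinuousLinearMap.HasLeftInverse.of_injective_of_finiteDimensional hA
  have h_range : (A.precomp ℝ : (E' →L[ℝ] ℝ) →L[ℝ] (E →L[ℝ] ℝ)).range = ⊤ :=
    LinearMap.range_eq_top.2 fun ξ =>
      ⟨ξ ∘L R, ContinuousLinearMap.ext fun v => congrArg ξ (hR v)⟩
  have h_rank := LinearMap.finrank_range_add_finrank_ker
    (A.precomp ℝ : (E' →L[ℝ] ℝ) →L[ℝ] (E →L[ℝ] ℝ)).toLinearMap
  rw [h_range, finrank_top, finrank_continuousDual, finrank_continuousDual] at h_rank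
  rwa [add_comm]

theorem finrank_map_ker_precomp_add {A : E →L[ℝ] E'} (hA : Function.Injective A)
    (s : (E' →L[ℝ] ℝ) →L[ℝ] F) :
    Module.finrank ℝ ((A.precomp ℝ : (E' →L[ℝ] ℝ) →L[ℝ] (E →L[ℝ] ℝ)).ker.map
        (s : (E' →L[ℝ] ℝ) →ₗ[ℝ] F)) +
      Module.finrank ℝ ((A.precomp ℝ : (E' →L[ℝ] ℝ) →L[ℝ] (E →L[ℝ] ℝ)).prod s).ker +
      Module.finrank ℝ E = Module.finrank ℝ E' := by
  rw [← finrank_ker_precomp_add hA]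
  exact congrArg (· + Module.finrank ℝ E) (finrank_map_ker_add_finrank_ker_prod
    (A.precomp ℝ : (E' →L[ℝ] ℝ) →L[ℝ] (E →L[ℝ] ℝ)).toLinearMap s.toLinearMap)

end ConormalRank

section Necessity

variable {E : Type*} [NormedAddCommGroup E] [NormedSpace ℝ E]
  {H : Type*} [TopologicalSpace H] {I : ModelWithCorners ℝ E H}
  {M : Type*} [TopologicalSpace M] [ChartedSpace H M] [IsManifold I ∞ M]

theorem DiracStructure.finrank_ker_snd_frame (L : DiracStructure I M) {x₀ x : M}
    (hx : x ∈ (chartAt H x₀).source) {R : Type*} [NormedAddCommGroup R] [NormedSpace ℝ R]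
    {g : R →L[ℝ] E × (E →L[ℝ] ℝ)} (h_injective : Function.Injective g)
    (hg : ∀ p, p ∈ L.fiber x ↔ ∃ c, g c = pairToModel I x₀ x p) :
    Module.finrank ℝ (ContinuousLinearMap.snd ℝ E (E →L[ℝ] ℝ) ∘L g).ker = L.charRank x := by
  let f : TangentSpace I x →ₗ[ℝ] E × (E →L[ℝ] ℝ) :=
    pairToModel I x₀ x ∘ₗ LinearMap.inl ℝ (TangentSpace I x) (Cotangent I x)
  have hf : Function.Injective f := (pairToModel_injective hx).comp LinearMap.inl_injective
  have hf_snd (v : TangentSpace I x) : (f v).2 = 0 :=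
    map_zero (LinearMap.snd ℝ _ _ ∘ₗ pairToModel I x₀ x ∘ₗ LinearMap.inr ℝ _ _)
  have h_map : (ContinuousLinearMap.snd ℝ E (E →L[ℝ] ℝ) ∘L g).ker.map
      (g : R →ₗ[ℝ] E × (E →L[ℝ] ℝ)) = (L.char x).map f := by
    ext p
    constructor
    · rintro ⟨c, hc, rfl⟩
      have h_eq : f (ofModel I x₀ x (g c).1) = g c :=
        Prod.ext (toModel_ofModel hx _) ((hf_snd _).trans (Eq.symm hc))
      exact ⟨_, (hg _).2 ⟨c, h_eq.symm⟩, h_eq⟩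
    · rintro ⟨v, hv, rfl⟩
      obtain ⟨c, hc⟩ := (hg _).1 hv
      exact ⟨c, (congrArg Prod.snd hc).trans (hf_snd v), hc⟩
  rw [(Submodule.equivMapOfInjective (g : R →ₗ[ℝ] E × (E →L[ℝ] ℝ)) h_injective _).finrank_eq,
    h_map]
  exact (Submodule.equivMapOfInjective f hf (L.char x)).finrank_eq.symm

theorem DiracStructure.eventually_charRank_le [I.Boundaryless]
    (L : DiracStructure I M) (x₀ : M) : ∀ᶠ x in 𝓝 x₀, L.charRank x ≤ L.charRank x₀ := by
  obtain ⟨U, hU, hx₀, hUs, G, hG, hGL, -⟩ := L.exists_frame x₀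
  have h_cont : ContinuousAt (fun x => ContinuousLinearMap.snd ℝ E (E →L[ℝ] ℝ) ∘L G x) x₀ :=
    continuousAt_const.clm_comp (hG.continuousOn.continuousAt (hU.mem_nhds hx₀))
  filter_upwards [eventually_finrank_ker_le h_cont, hU.mem_nhds hx₀] with x hx hxU
  rwa [L.finrank_ker_snd_frame (hUs hxU) (hGL x hxU).1 (hGL x hxU).2,
    L.finrank_ker_snd_frame (hUs hx₀) (hGL x₀ hx₀).1 (hGL x₀ hx₀).2] at hx

variable {E' : Type*} [NormedAddCommGroup E'] [NormedSpace ℝ E']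
  {H' : Type*} [TopologicalSpace H'] {J : ModelWithCorners ℝ E' H'}
  {P : Type*} [TopologicalSpace P] [ChartedSpace H' P] [IsManifold J ∞ P]

variable (I J) in
/-- The differential of `i` at `x`, read in the trivializations near `x₀` and `i x₀`. -/
def mfderivToModel (i : M → P) (x₀ x : M) : E →L[ℝ] E' :=
  (toModel J (i x₀) (i x)).comp
    ((mfderiv I J i x : TangentSpace I x →L[ℝ] TangentSpace J (i x)).comp (ofModel I x₀ x))

theorem continuousAt_mfderivToModel {i : M → P} (hi : ContMDiff I J ∞ i) (x₀ : M) :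
    ContinuousAt (mfderivToModel I J i x₀) x₀ :=
  ((hi.contMDiffAt (x := x₀)).mfderiv_const (m := ∞) (by simp)).continuousAt

theorem mfderivToModel_toModel (i : M → P) {x₀ x : M} (hx : x ∈ (chartAt H x₀).source)
    (v : TangentSpace I x) :
    mfderivToModel I J i x₀ (x := x) (toModel I x₀ x v) =
      toModel J (i x₀) (i x) (mfderiv I J i x v) :=
  congrArg (fun w => toModel J (i x₀) (i x) (mfderiv I J i x w)) (ofModel_toModel hx v)

theorem mfderivToModel_injective {i : M → P} {x₀ x : M} (hx : x ∈ (chartAt H x₀).source)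
    (hix : i x ∈ (chartAt H' (i x₀)).source) (h : Function.Injective (mfderiv I J i x)) :
    Function.Injective (mfderivToModel I J i x₀ x) :=
  (toModel_injective hix).comp
    (h.comp (Function.LeftInverse.injective (toModel_ofModel hx)))

theorem DiracStructure.IsCoisotropicEmbedding.mfderiv_injective [I.Boundaryless]
    {L : DiracStructure I M} {S : PoissonStructure J P} {i : M → P}
    (h : L.IsCoisotropicEmbedding S i) (x : M) : Function.Injective (mfderiv I J i x) :=
  mfderiv_injective_of_isImmersionAt (h.isSmoothEmbedding.isImmersion.isImmersionAt x)

theorem DiracStructure.IsCoisotropicEmbedding.mem_char_iff {L : DiracStructure I M}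
    {S : PoissonStructure J P} {i : M → P} (h : L.IsCoisotropicEmbedding S i) {x : M}
    {v : TangentSpace I x} :
    v ∈ L.char x ↔ ∃ ξ : Cotangent J (i x),
      mfderiv I J i x v = S.sharp (i x) ξ ∧ ξ.comp (mfderiv I J i x) = 0 := by
  change (v, (0 : Cotangent I x)) ∈ L.fiber x ↔ _
  rw [← h.pullback_eq]
  constructor
  · rintro ⟨ξ, ⟨η, hη⟩, hξ⟩
    obtain rfl : η = ξ := congrArg Prod.snd hη
    exact ⟨η, (congrArg Prod.fst hη).symm, hξ.symm⟩
  · rintro ⟨ξ, hv, hξ⟩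
    exact ⟨ξ, ⟨ξ, Prod.ext hv.symm rfl⟩, hξ.symm⟩

theorem DiracStructure.IsCoisotropicEmbedding.map_char {L : DiracStructure I M}
    {S : PoissonStructure J P} {i : M → P} (h : L.IsCoisotropicEmbedding S i) {x₀ x : M}
    (hx : x ∈ (chartAt H x₀).source) (hix : i x ∈ (chartAt H' (i x₀)).source) :
    (L.char x).map ((mfderivToModel I J i x₀ x).comp (toModel I x₀ x) :
        TangentSpace I x →ₗ[ℝ] E') =
      ((mfderivToModel I J i x₀ x).precomp ℝ).ker.map
        (sharpToModel J (i x₀) (i x) (S.sharp (i x)) : (E' →L[ℝ] ℝ) →ₗ[ℝ] E') := by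
  ext w
  constructor
  · rintro ⟨v, hv, rfl⟩
    obtain ⟨ξ, hvξ, hξ⟩ := h.mem_char_iff.1 hv
    refine ⟨covectorToModel J (i x₀) (i x) ξ, ContinuousLinearMap.ext fun u => ?_, ?_⟩
    · exact (covectorToModel_toModel hix ξ (mfderiv I J i x (ofModel I x₀ x u))).trans
        (congrArg (fun β : TangentSpace I x →L[ℝ] ℝ => β (ofModel I x₀ x u)) hξ)
    · have hξ_toModel : ((covectorToModel J (i x₀) (i x) ξ).comp (toModel J (i x₀) (i x)) :
          TangentSpace J (i x) →L[ℝ] ℝ) = ξ :=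
        ContinuousLinearMap.ext (covectorToModel_toModel hix ξ)
      exact (congrArg (toModel J (i x₀) (i x))
        ((congrArg (S.sharp (i x)) hξ_toModel).trans hvξ.symm)).trans
          (mfderivToModel_toModel i hx v).symm
  · rintro ⟨η, hη, rfl⟩
    let ξ : Cotangent J (i x) := η.comp (toModel J (i x₀) (i x))
    have hξ : ξ.comp (mfderiv I J i x) = 0 := ContinuousLinearMap.ext fun v =>
      (congrArg η (mfderivToModel_toModel i hx v)).symm.trans
        (congrArg (fun β : E →L[ℝ] ℝ => β (toModel I x₀ x v)) hη)
    obtain ⟨v, hv⟩ := h.coisotropic x ξ hξ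
    exact ⟨v, h.mem_char_iff.2 ⟨ξ, hv, hξ⟩, (mfderivToModel_toModel i hx v).trans
      (congrArg (toModel J (i x₀) (i x)) hv)⟩

variable [I.Boundaryless] [FiniteDimensional ℝ E] [FiniteDimensional ℝ E']

theorem DiracStructure.IsCoisotropicEmbedding.charRank_add {L : DiracStructure I M}
    {S : PoissonStructure J P} {i : M → P} (h : L.IsCoisotropicEmbedding S i) {x₀ x : M}
    (hx : x ∈ (chartAt H x₀).source) (hix : i x ∈ (chartAt H' (i x₀)).source) :
    L.charRank x + Module.finrank ℝ (((mfderivToModel I J i x₀ x).precomp ℝ).prod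
        (sharpToModel J (i x₀) (i x) (S.sharp (i x)))).ker + Module.finrank ℝ E =
      Module.finrank ℝ E' := by
  have h_injective := mfderivToModel_injective hx hix (h.mfderiv_injective x)
  rw [← finrank_map_ker_precomp_add h_injective (sharpToModel J (i x₀) (i x) (S.sharp (i x))),
    ← h.map_char hx hix]
  have h_injective' : Function.Injective ((mfderivToModel I J i x₀ x).comp (toModel I x₀ x) :
      TangentSpace I x →ₗ[ℝ] E') :=
    h_injective.comp (toModel_injective hx)
  congr 2
  exact (Submodule.equivMapOfInjective _ h_injective' (L.char x)).finrank_eq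

-- The conormal spaces have constant rank, and the rank of `ker ♯ ∩ N*` can only drop nearby.
theorem DiracStructure.IsCoisotropicEmbedding.eventually_le_charRank {L : DiracStructure I M}
    {S : PoissonStructure J P} {i : M → P} (h : L.IsCoisotropicEmbedding S i) (x₀ : M) :
    ∀ᶠ x in 𝓝 x₀, L.charRank x₀ ≤ L.charRank x := by
  have hi : ContMDiff I J ∞ i := h.isSmoothEmbedding.contMDiff
  have h_sharp : ContinuousAt (fun x => sharpToModel J (i x₀) (i x) (S.sharp (i x))) x₀ :=
    ContinuousAt.comp (g := fun q => sharpToModel J (i x₀) q (S.sharp q))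
      (contMDiffAt_sharp_iff.1 (S.smooth (i x₀))).continuousAt hi.continuous.continuousAt
  have h_precomp : ContinuousAt (fun x => (mfderivToModel I J i x₀ x).precomp ℝ) x₀ :=
    ((ContinuousLinearMap.compL ℝ E E' ℝ).flip.continuous).continuousAt.comp
      (continuousAt_mfderivToModel hi x₀)
  have h_prod : ContinuousAt (fun x => ((mfderivToModel I J i x₀ x).precomp ℝ).prod
      (sharpToModel J (i x₀) (i x) (S.sharp (i x)))) x₀ :=
    (ContinuousLinearMap.prodₗᵢ ℝ).continuous.continuousAt.comp (h_precomp.prodMk h_sharp)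
  filter_upwards [eventually_finrank_ker_le h_prod, chart_source_mem_nhds H x₀,
    hi.continuous.continuousAt.eventually (chart_source_mem_nhds H' (i x₀))] with x h_ker hx hix
  have h_sum := h.charRank_add hx hix
  have h_sum₀ := h.charRank_add (mem_chart_source H x₀) (mem_chart_source H' (i x₀))
  omega

end Necessity

theorem DiracStructure.EmbedsCoisotropically.isLocallyConstant_charRank
    {E : Type*} [NormedAddCommGroup E] [NormedSpace ℝ E] [FiniteDimensional ℝ E]
    {H : Type*} [TopologicalSpace H] {I : ModelWithCorners ℝ E H} [I.Boundaryless]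
    {M : Type*} [TopologicalSpace M] [ChartedSpace H M] [IsManifold I ∞ M]
    {L : DiracStructure I M} (h : L.EmbedsCoisotropically) : IsLocallyConstant L.charRank := by
  obtain ⟨E', _, _, _, H', _, J, _, P, _, _, _, _, _, S, i, hi⟩ := h
  refine (IsLocallyConstant.iff_eventually_eq _).2 fun x₀ => ?_
  filter_upwards [L.eventually_charRank_le x₀, hi.eventually_le_charRank x₀] with x h_le h_ge
  exact le_antisymm h_le h_ge

/-! ### The dual of the characteristic distribution -/

section CharFrame

variable {E : Type*} [NormedAddCommGroup E] [NormedSpace ℝ E]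
  {H : Type*} [TopologicalSpace H] {I : ModelWithCorners ℝ E H}
  {M : Type*} [TopologicalSpace M] [ChartedSpace H M] [IsManifold I ∞ M]

/-- A smooth frame `Y` of `L ∩ TM` with model `N` near `x₀`, read in the chart at `x₀`, with a
smooth family `Φ` of left inverses. -/
structure CharFrame (L : DiracStructure I M) (N : Type*) [NormedAddCommGroup N] [NormedSpace ℝ N]
    (x₀ : M) where
  /-- The domain of the frame. -/
  U : Set M
  /-- The frame. -/
  Y : M → N →L[ℝ] E
  /-- The left inverses. -/
  Φ : M → E →L[ℝ] N
  isOpen : IsOpen U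
  mem : x₀ ∈ U
  subset : U ⊆ (chartAt H x₀).source
  smooth_Y : ContMDiffOn I 𝓘(ℝ, N →L[ℝ] E) ∞ Y U
  smooth_Φ : ContMDiffOn I 𝓘(ℝ, E →L[ℝ] N) ∞ Φ U
  leftInv : ∀ x ∈ U, ∀ c, Φ x (Y x c) = c
  mem_iff : ∀ x ∈ U, ∀ v : TangentSpace I x, v ∈ L.char x ↔ ∃ c, Y x c = toModel I x₀ x v

variable {N : Type*} [NormedAddCommGroup N] [NormedSpace ℝ N]

theorem DiracStructure.nonempty_charFrame [I.Boundaryless] [FiniteDimensional ℝ E]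
    [FiniteDimensional ℝ N] (L : DiracStructure I M)
    (hN : ∀ x, L.charRank x = Module.finrank ℝ N) (x₀ : M) : Nonempty (CharFrame L N x₀) := by
  obtain ⟨U, hU, hx₀, hUs, G, hG, hGL, -⟩ := L.exists_frame x₀
  have h_snd : ContMDiffOn I 𝓘(ℝ, (Fin (Module.finrank ℝ E) → ℝ) →L[ℝ] (E →L[ℝ] ℝ)) ∞
      (fun x => ContinuousLinearMap.snd ℝ E (E →L[ℝ] ℝ) ∘L G x) U :=
    contMDiffOn_const.clm_comp hG
  obtain ⟨V, hVU, hV, hx₀V, K, hK, hKG⟩ := exists_smooth_kernel_frame (N := N) hU hx₀ h_snd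
    fun x hx => (L.finrank_ker_snd_frame (hUs hx) (hGL x hx).1 (hGL x hx).2).trans (hN x)
  let Y : M → N →L[ℝ] E := fun x => ContinuousLinearMap.fst ℝ E (E →L[ℝ] ℝ) ∘L G x ∘L K x
  have hY : ContMDiffOn I 𝓘(ℝ, N →L[ℝ] E) ∞ Y V :=
    contMDiffOn_const.clm_comp ((hG.mono hVU).clm_comp hK)
  have hGK : ∀ x ∈ V, ∀ c, G x (K x c) = (Y x c, 0) := fun x hx c =>
    Prod.ext rfl ((hKG x hx).2.le ⟨c, rfl⟩)
  have hY_inj : ∀ x ∈ V, Function.Injective (Y x) := fun x hx c d hcd =>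
    (hKG x hx).1 ((hGL x (hVU hx)).1 (by rw [hGK x hx, hGK x hx, hcd]))
  obtain ⟨W, hWV, hW, hx₀W, Φ, hΦ, hΦY⟩ := exists_smooth_leftInverse hV hx₀V hY (hY_inj x₀ hx₀V)
  refine ⟨⟨W, Y, Φ, hW, hx₀W, hWV.trans (hVU.trans hUs), hY.mono hWV, hΦ, hΦY, ?_⟩⟩
  intro x hx v
  refine ((hGL x (hVU (hWV hx))).2 (v, 0)).trans ⟨?_, ?_⟩
  · rintro ⟨c, hc⟩
    obtain ⟨d, rfl⟩ := (hKG x (hWV hx)).2.ge (show c ∈ _ from congrArg Prod.snd hc)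
    exact ⟨d, congrArg Prod.fst hc⟩
  · rintro ⟨c, hc⟩
    exact ⟨K x c, (hGK x (hWV hx) c).trans (Prod.ext hc rfl)⟩

end CharFrame

section CharDual

variable {E : Type*} [NormedAddCommGroup E] [NormedSpace ℝ E]
  {H : Type*} [TopologicalSpace H] {I : ModelWithCorners ℝ E H}
  {M : Type*} [TopologicalSpace M] [ChartedSpace H M] [IsManifold I ∞ M]

theorem contMDiffOn_toModel_comp_ofModel (x₀ x₁ : M) :
    ContMDiffOn I 𝓘(ℝ, E →L[ℝ] E) ∞ (fun x => (toModel I x₀ x).comp (ofModel I x₁ x))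
      ((chartAt H x₁).source ∩ (chartAt H x₀).source) := by
  set e₀ := trivializationAt E (TangentSpace I : M → Type _) x₀
  set e₁ := trivializationAt E (TangentSpace I : M → Type _) x₁
  refine (contMDiffOn_coordChangeL (IB := I) (n := ∞) e₁ e₀).congr fun x hx => ?_
  ext v
  have h_toModel := e₀.continuousLinearMapAt_apply_of_mem ℝ hx.2 (ofModel I x₁ x v)
  exact (h_toModel.trans (congrArg (fun w => (e₀ ⟨x, w⟩).2) (e₁.symmL_apply (R := ℝ) hx.1 v))).trans
    (e₁.coordChangeL_apply (R := ℝ) e₀ hx v).symm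

theorem contMDiffAt_covectorToModel (p : CotangentBundle I M) :
    ContMDiffAt (I.prod 𝓘(ℝ, E →L[ℝ] ℝ)) 𝓘(ℝ, E →L[ℝ] ℝ) ∞
      (fun q : CotangentBundle I M => covectorToModel I p.1 q.1 q.2) p := by
  refine ((contMDiffAt_totalSpace (IM := I.prod 𝓘(ℝ, E →L[ℝ] ℝ)) (IB := I) (n := ∞)
    (f := fun q : CotangentBundle I M => q) (x₀ := p)).1 contMDiffAt_id).2.congr_of_eventuallyEq ?_
  filter_upwards [(FiberBundle.continuous_proj (E →L[ℝ] ℝ)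
    (fun x : M => Cotangent I x)).continuousAt.eventually (chart_source_mem_nhds H p.1)] with q hq
  exact (trivializationAt_cotangent hq q.2).symm

variable {N : Type*} [NormedAddCommGroup N] [NormedSpace ℝ N] {L : DiracStructure I M} {x₀ x₁ : M}

namespace CharFrame

variable (f : CharFrame L N x₀)

theorem ofModel_Y_mem {x : M} (hx : x ∈ f.U) (c : N) : ofModel I x₀ x (f.Y x c) ∈ L.char x :=
  (f.mem_iff x hx _).2 ⟨c, (toModel_ofModel (f.subset hx) _).symm⟩

open Classical in
/-- The frame as a map into `L ∩ TM`, with value `0` outside the domain of the frame. -/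
def toChar (x : M) : N →L[ℝ] L.char x :=
  if hx : x ∈ f.U then ((ofModel I x₀ x).comp (f.Y x)).codRestrict (L.char x) (f.ofModel_Y_mem hx)
  else 0

theorem coe_toChar {x : M} (hx : x ∈ f.U) (c : N) :
    (f.toChar x c : TangentSpace I x) = ofModel I x₀ x (f.Y x c) := by
  rw [toChar, dif_pos hx]
  rfl

/-- The coordinates on `L ∩ TM` given by the left inverses of the frame. -/
def ofChar (x : M) : L.char x →L[ℝ] N :=
  ((f.Φ x).comp (toModel I x₀ x)).comp (L.char x).subtypeL

theorem ofChar_apply (x : M) (v : L.char x) : f.ofChar x v = f.Φ x (toModel I x₀ x v) := rfl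

theorem ofChar_toChar {x : M} (hx : x ∈ f.U) (c : N) : f.ofChar x (f.toChar x c) = c := by
  rw [ofChar_apply, f.coe_toChar hx, toModel_ofModel (f.subset hx), f.leftInv x hx]

theorem toChar_ofChar {x : M} (hx : x ∈ f.U) (v : L.char x) : f.toChar x (f.ofChar x v) = v := by
  obtain ⟨c, hc⟩ := (f.mem_iff x hx v).1 v.2
  have h_toChar : f.toChar x c = v := Subtype.ext <| by
    rw [f.coe_toChar hx, hc, ofModel_toModel (f.subset hx)]
  rw [← h_toChar, f.ofChar_toChar hx]

end CharFrame

variable [FiniteDimensional ℝ N]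

variable (N) in
/-- An arbitrary linear isomorphism of `N*` with `N`, through which `N` serves as the model of the
dual of a bundle with model `N`. -/
def dualModel : (N →L[ℝ] ℝ) ≃L[ℝ] N :=
  ContinuousLinearEquiv.ofFinrankEq finrank_continuousDual

namespace CharFrame

variable (f : CharFrame L N x₀) (g : CharFrame L N x₁)

/-- The coordinates on `(L ∩ TM)*` dual to those of the frame. -/
def dualCoord (x : M) : L.CharDual x →L[ℝ] N :=
  (dualModel N : (N →L[ℝ] ℝ) →L[ℝ] N).comp (ContinuousLinearMap.precomp ℝ (f.toChar x))

/-- The element of `(L ∩ TM)*` with given coordinates. -/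
def dualCoordSymm (x : M) : N →L[ℝ] L.CharDual x :=
  (ContinuousLinearMap.precomp ℝ (f.ofChar x)).comp ((dualModel N).symm : N →L[ℝ] (N →L[ℝ] ℝ))

theorem dualCoord_apply (x : M) (e : L.CharDual x) :
    f.dualCoord x e = dualModel N (e.comp (f.toChar x)) := rfl

theorem dualCoordSymm_apply (x : M) (a : N) :
    f.dualCoordSymm x a = ((dualModel N).symm a).comp (f.ofChar x) := rfl

theorem dualCoord_dualCoordSymm {x : M} (hx : x ∈ f.U) (a : N) :
    f.dualCoord x (f.dualCoordSymm x a) = a := by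
  have h_comp : (((dualModel N).symm a).comp (f.ofChar x)).comp (f.toChar x) =
      (dualModel N).symm a :=
    ContinuousLinearMap.ext fun c => congrArg ((dualModel N).symm a) (f.ofChar_toChar hx c)
  rw [dualCoord_apply, dualCoordSymm_apply, h_comp, ContinuousLinearEquiv.apply_symm_apply]

theorem dualCoordSymm_dualCoord {x : M} (hx : x ∈ f.U) (e : L.CharDual x) :
    f.dualCoordSymm x (f.dualCoord x e) = e := by
  rw [dualCoord_apply, dualCoordSymm_apply, ContinuousLinearEquiv.symm_apply_apply]
  exact ContinuousLinearMap.ext fun v => congrArg e (f.toChar_ofChar hx v)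

theorem isInducing_dualCoord {x : M} (hx : x ∈ f.U) : Topology.IsInducing (f.dualCoord x) :=
  Topology.IsInducing.of_comp (f.dualCoord x).continuous (f.dualCoordSymm x).continuous <| by
    rw [show f.dualCoordSymm x ∘ f.dualCoord x = id from
      funext fun e => f.dualCoordSymm_dualCoord hx e]
    exact Topology.IsInducing.id

theorem dualCoord_comp_subtypeL {x : M} (hx : x ∈ f.U) (ξ : Cotangent I x) :
    f.dualCoord x (ξ.comp (L.char x).subtypeL) =
      dualModel N ((covectorToModel I x₀ x ξ).comp (f.Y x)) :=
  congrArg (dualModel N) (ContinuousLinearMap.ext fun c => congrArg ξ (f.coe_toChar hx c))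

/-- The pretrivialization of `(L ∩ TM)*` given by a frame of `L ∩ TM`. -/
def pretrivialization : Pretrivialization N (TotalSpace.proj : TotalSpace N L.CharDual → M) where
  toFun p := (p.1, f.dualCoord p.1 p.2)
  invFun p := ⟨p.1, f.dualCoordSymm p.1 p.2⟩
  source := TotalSpace.proj ⁻¹' f.U
  target := f.U ×ˢ univ
  map_source' _ hp := ⟨hp, mem_univ _⟩
  map_target' _ hp := hp.1
  left_inv' p hp := congrArg (TotalSpace.mk p.1) (f.dualCoordSymm_dualCoord hp p.2)
  right_inv' p hp := Prod.ext rfl (f.dualCoord_dualCoordSymm hp.1 p.2)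
  open_target := f.isOpen.prod isOpen_univ
  baseSet := f.U
  open_baseSet := f.isOpen
  source_eq := rfl
  target_eq := rfl
  proj_toFun _ _ := rfl

theorem pretrivialization_symm {x : M} (hx : x ∈ f.U) (a : N) :
    f.pretrivialization.symm x a = f.dualCoordSymm x a :=
  eq_of_heq (TotalSpace.mk.inj (f.pretrivialization.mk_symm hx a)).2

/-- The change of coordinates on `(L ∩ TM)*` between two frames. -/
def coordChange (x : M) : N →L[ℝ] N := (g.dualCoord x).comp (f.dualCoordSymm x)

theorem coordChange_eq {x : M} (hx : x ∈ g.U) :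
    f.coordChange g x = ((dualModel N : (N →L[ℝ] ℝ) →L[ℝ] N).comp (ContinuousLinearMap.precomp ℝ
      ((f.Φ x).comp (((toModel I x₀ x).comp (ofModel I x₁ x)).comp (g.Y x))))).comp
        ((dualModel N).symm : N →L[ℝ] (N →L[ℝ] ℝ)) :=
  ContinuousLinearMap.ext fun a => congrArg (dualModel N) <| ContinuousLinearMap.ext fun c =>
    congrArg (fun v : TangentSpace I x => (dualModel N).symm a (f.Φ x (toModel I x₀ x v)))
      (g.coe_toChar hx c)

theorem contMDiffOn_coordChange :
    ContMDiffOn I 𝓘(ℝ, N →L[ℝ] N) ∞ (f.coordChange g) (f.U ∩ g.U) := by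
  have h_frames : ContMDiffOn I 𝓘(ℝ, N →L[ℝ] N) ∞
      (fun x => (f.Φ x).comp (((toModel I x₀ x).comp (ofModel I x₁ x)).comp (g.Y x)))
      (f.U ∩ g.U) :=
    (f.smooth_Φ.mono inter_subset_left).clm_comp
      (((contMDiffOn_toModel_comp_ofModel x₀ x₁).mono fun x hx =>
        ⟨g.subset hx.2, f.subset hx.1⟩).clm_comp (g.smooth_Y.mono inter_subset_right))
  have h_dual : ContDiff ℝ ∞ (fun C : N →L[ℝ] N =>
      ((dualModel N : (N →L[ℝ] ℝ) →L[ℝ] N).comp (ContinuousLinearMap.precomp ℝ C)).comp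
        ((dualModel N).symm : N →L[ℝ] (N →L[ℝ] ℝ))) :=
    contDiff_clm_apply_iff.2 fun a =>
      (dualModel N).contDiff.comp (contDiff_const.clm_comp contDiff_id)
  exact (h_dual.contMDiff.comp_contMDiffOn h_frames).congr fun x hx => f.coordChange_eq g hx.2

theorem coordChange_apply {x : M} (hx : x ∈ f.U) (a : N) :
    f.coordChange g x a = (g.pretrivialization ⟨x, f.pretrivialization.symm x a⟩).2 :=
  congrArg (g.dualCoord x) (f.pretrivialization_symm hx a).symm

end CharFrame

/-- The vector prebundle `(L ∩ TM)*` given by a family of frames of `L ∩ TM`. -/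
def charDualPrebundle (f : ∀ x₀, CharFrame L N x₀) : VectorPrebundle ℝ N L.CharDual where
  pretrivializationAtlas := range fun x₀ => (f x₀).pretrivialization
  pretrivialization_linear' := by
    rintro _ ⟨x₀, rfl⟩
    exact ⟨fun x _ => ⟨fun a b => map_add ((f x₀).dualCoord x) a b,
      fun c a => map_smul ((f x₀).dualCoord x) c a⟩⟩
  pretrivializationAt x₀ := (f x₀).pretrivialization
  mem_base_pretrivializationAt x₀ := (f x₀).mem
  pretrivialization_mem_atlas x₀ := ⟨x₀, rfl⟩
  exists_coordChange := by
    rintro _ ⟨x₀, rfl⟩ _ ⟨x₁, rfl⟩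
    exact ⟨(f x₀).coordChange (f x₁), ((f x₀).contMDiffOn_coordChange (f x₁)).continuousOn,
      fun x hx a => (f x₀).coordChange_apply (f x₁) hx.1 a⟩
  totalSpaceMk_isInducing x :=
    (isInducing_prodMkRight x).comp ((f x).isInducing_dualCoord (f x).mem)

instance (f : ∀ x₀, CharFrame L N x₀) : (charDualPrebundle f).IsContMDiff I ∞ where
  exists_contMDiffCoordChange := by
    rintro _ ⟨x₀, rfl⟩ _ ⟨x₁, rfl⟩
    exact ⟨(f x₀).coordChange (f x₁), (f x₀).contMDiffOn_coordChange (f x₁),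
      fun x hx a => (f x₀).coordChange_apply (f x₁) hx.1 a⟩

theorem contMDiff_restrict_charDualPrebundle (f : ∀ x₀, CharFrame L N x₀) :
    letI := (charDualPrebundle f).totalSpaceTopology
    letI := (charDualPrebundle f).toFiberBundle
    letI := (charDualPrebundle f).toVectorBundle
    ContMDiff (I.prod 𝓘(ℝ, E →L[ℝ] ℝ)) (I.prod 𝓘(ℝ, N)) ∞
      (fun p : CotangentBundle I M =>
        (⟨p.1, p.2.comp (L.char p.1).subtypeL⟩ : TotalSpace N L.CharDual)) := by
  let := (charDualPrebundle f).totalSpaceTopology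
  let := (charDualPrebundle f).toFiberBundle
  let := (charDualPrebundle f).toVectorBundle
  intro p
  rw [contMDiffAt_totalSpace]
  have h_proj : ContMDiffAt (I.prod 𝓘(ℝ, E →L[ℝ] ℝ)) I ∞
    (fun q : CotangentBundle I M => q.1) p := contMDiffAt_proj _
  have hU : (f p.1).U ∈ 𝓝 p.1 := (f p.1).isOpen.mem_nhds (f p.1).mem
  have hY := ((f p.1).smooth_Y.contMDiffAt hU).comp p h_proj
  refine ⟨h_proj, ((dualModel N).contDiff (n := ∞) |>.contMDiff.contMDiffAt.comp p
    ((contMDiffAt_covectorToModel p).clm_comp hY)).congr_of_eventuallyEq ?_⟩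
  filter_upwards [h_proj.continuousAt.eventually hU] with q hq
  exact (f p.1).dualCoord_comp_subtypeL hq q.2

/-- The smooth vector bundle `(L ∩ TM)*` given by a family of frames of `L ∩ TM`. -/
abbrev charDualBundle {k : ℕ} (f : ∀ x₀, CharFrame L (EuclideanSpace ℝ (Fin k)) x₀) :
    L.CharDualBundle k :=
  letI := (charDualPrebundle f).totalSpaceTopology
  letI := (charDualPrebundle f).toFiberBundle
  letI := (charDualPrebundle f).toVectorBundle
  { topology := (charDualPrebundle f).totalSpaceTopology
    fiberBundle := (charDualPrebundle f).toFiberBundle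
    vectorBundle := (charDualPrebundle f).toVectorBundle
    contMDiffVectorBundle := (charDualPrebundle f).contMDiffVectorBundle I
    contMDiff_restrict := contMDiff_restrict_charDualPrebundle f }

/-- The trivializations of the bundle `(L ∩ TM)*` are those given by the frames `f`. -/
def IsFrameFamily {k : ℕ} [L.CharDualBundle k]
    (f : ∀ x₀, CharFrame L (EuclideanSpace ℝ (Fin k)) x₀) : Prop :=
  ∀ x₀, (trivializationAt (EuclideanSpace ℝ (Fin k)) L.CharDual x₀).baseSet = (f x₀).U ∧
    ∀ x e, (trivializationAt (EuclideanSpace ℝ (Fin k)) L.CharDual x₀ ⟨x, e⟩).2 =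
      (f x₀).dualCoord x e

theorem isFrameFamily_charDualBundle {k : ℕ}
    (f : ∀ x₀, CharFrame L (EuclideanSpace ℝ (Fin k)) x₀) :
    letI := charDualBundle f
    IsFrameFamily f :=
  fun _ => ⟨rfl, fun _ _ => rfl⟩

end CharDual

section Complement

variable {E : Type*} [NormedAddCommGroup E] [NormedSpace ℝ E]
  {H : Type*} [TopologicalSpace H] {I : ModelWithCorners ℝ E H}
  {M : Type*} [TopologicalSpace M] [ChartedSpace H M] [IsManifold I ∞ M]

theorem contMDiffOn_end_iff {P : Π x : M, TangentSpace I x →L[ℝ] TangentSpace I x} {x₀ : M}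
    {U : Set M} (hU : IsOpen U) (hUs : U ⊆ (chartAt H x₀).source) :
    ContMDiffOn I (I.prod 𝓘(ℝ, E →L[ℝ] E)) ∞ (fun x => (⟨x, P x⟩ :
      TotalSpace (E →L[ℝ] E) (fun x : M => TangentSpace I x →L[ℝ] TangentSpace I x))) U ↔
    ContMDiffOn I 𝓘(ℝ, E →L[ℝ] E) ∞
      (fun x => ((toModel I x₀ x).comp ((P x).comp (ofModel I x₀ x)) : E →L[ℝ] E)) U :=
  (trivializationAt (E →L[ℝ] E)
    (fun x : M => TangentSpace I x →L[ℝ] TangentSpace I x) x₀).contMDiffOn_section_iff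
    (IB := I) (n := ∞) (s := P) (a := U) hU (by simpa using hUs)

theorem isSmoothDistribution_of_frames {V : Π x : M, Submodule ℝ (TangentSpace I x)} {r : ℕ}
    (h : ∀ x₀ : M, ∃ U : Set M, IsOpen U ∧ x₀ ∈ U ∧ U ⊆ (chartAt H x₀).source ∧
      ∃ K : M → (Fin r → ℝ) →L[ℝ] E, ContMDiffOn I 𝓘(ℝ, (Fin r → ℝ) →L[ℝ] E) ∞ K U ∧
        ∀ x ∈ U, Function.Injective (K x) ∧ ∀ v, v ∈ V x ↔ ∃ c, K x c = toModel I x₀ x v) :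
    IsSmoothDistribution I V := by
  intro x₀
  obtain ⟨U, hU, hx₀, hUs, K, hK, hKV⟩ := h x₀
  let b := Pi.basisFun ℝ (Fin r)
  refine ⟨U, hU, hx₀, r, fun i x => ofModel I x₀ x (K x (b i)), fun i => ?_, fun x hx => ?_⟩
  · exact (smoothVectorFieldOn_iff hU hUs).2 ((hK.clm_apply contMDiffOn_const).congr
      fun x hx => toModel_ofModel (hUs hx) _)
  · let g : (Fin r → ℝ) →ₗ[ℝ] TangentSpace I x :=
      ((ofModel I x₀ x).comp (K x) : (Fin r → ℝ) →L[ℝ] TangentSpace I x)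
    have hg : Function.Injective g :=
      (Function.LeftInverse.injective (g := toModel I x₀ x) (toModel_ofModel (hUs hx))).comp
        (hKV x hx).1
    have h_range : V x = LinearMap.range g := by
      ext v
      refine ((hKV x hx).2 v).trans (exists_congr fun c => ⟨fun hc => ?_, fun hc => ?_⟩)
      · exact (congrArg (ofModel I x₀ x) hc).trans (ofModel_toModel (hUs hx) v)
      · exact (toModel_ofModel (hUs hx) (K x c)).symm.trans (congrArg (toModel I x₀ x) hc)
    refine ⟨b.linearIndependent.map' g (LinearMap.ker_eq_bot.2 hg), ?_⟩
    rw [h_range, LinearMap.range_eq_map, ← b.span_eq, Submodule.map_span, ← range_comp]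
    rfl

theorem isSmoothDistribution_ker [FiniteDimensional ℝ E]
    {P : Π x : M, TangentSpace I x →L[ℝ] TangentSpace I x}
    (hP : ContMDiff I (I.prod 𝓘(ℝ, E →L[ℝ] E)) ∞ (fun x => (⟨x, P x⟩ :
      TotalSpace (E →L[ℝ] E) (fun x : M => TangentSpace I x →L[ℝ] TangentSpace I x))))
    {r : ℕ} (hr : ∀ x, Module.finrank ℝ (P x).ker = r) :
    IsSmoothDistribution I fun x => (P x).ker := by
  refine isSmoothDistribution_of_frames (r := r) fun x₀ => ?_
  let A : M → E →L[ℝ] E := fun x => (toModel I x₀ x).comp ((P x).comp (ofModel I x₀ x))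
  have h_ker : ∀ x ∈ (chartAt H x₀).source,
      (A x).ker.comap (toModel I x₀ x : TangentSpace I x →ₗ[ℝ] E) = (P x).ker := by
    intro x hx
    ext v
    have hAv : A x (toModel I x₀ x v) = toModel I x₀ x (P x v) :=
      congrArg (fun w => toModel I x₀ x (P x w)) (ofModel_toModel hx v)
    exact (Eq.congr_left hAv).trans (map_eq_zero_iff _ (toModel_injective hx))
  have h_rank : ∀ x ∈ (chartAt H x₀).source, Module.finrank ℝ (A x).ker =
      Module.finrank ℝ (Fin r → ℝ) := by
    intro x hx
    let e : TangentSpace I x ≃ₗ[ℝ] E := LinearEquiv.ofLinearMap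
      (toModel I x₀ x : TangentSpace I x →ₗ[ℝ] E) (ofModel I x₀ x : E →ₗ[ℝ] TangentSpace I x)
      (LinearMap.ext (toModel_ofModel hx)) (LinearMap.ext (ofModel_toModel hx))
    rw [Module.finrank_fin_fun, ← hr x, ← h_ker x hx]
    have h_map : (A x).ker.map (e.symm : E →ₗ[ℝ] TangentSpace I x) =
        (A x).ker.comap (toModel I x₀ x : TangentSpace I x →ₗ[ℝ] E) :=
      (Submodule.comap_equiv_eq_map_symm e (A x).ker).symm
    rw [← h_map]
    exact (LinearEquiv.finrank_map_eq e.symm (A x).ker).symm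
  obtain ⟨U, hUs, hU, hx₀, K, hK, hKA⟩ := exists_smooth_kernel_frame
    (chartAt H x₀).open_source (mem_chart_source H x₀)
    ((contMDiffOn_end_iff (chartAt H x₀).open_source subset_rfl).1 hP.contMDiffOn) h_rank
  refine ⟨U, hU, hx₀, hUs, K, hK, fun x hx => ⟨(hKA x hx).1, fun v => ?_⟩⟩
  rw [← h_ker x (hUs hx)]
  exact (SetLike.ext_iff.1 (hKA x hx).2 (toModel I x₀ x v)).symm

variable {L : DiracStructure I M} {N : Type*} [NormedAddCommGroup N] [NormedSpace ℝ N]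

theorem CharFrame.exists_isProj {x₀ : M} (f : CharFrame L N x₀) :
    ∃ P : Π x : M, TangentSpace I x →L[ℝ] TangentSpace I x,
      ContMDiffOn I (I.prod 𝓘(ℝ, E →L[ℝ] E)) ∞ (fun x => (⟨x, P x⟩ :
        TotalSpace (E →L[ℝ] E) (fun x : M => TangentSpace I x →L[ℝ] TangentSpace I x))) f.U ∧
      ∀ x ∈ f.U, LinearMap.IsProj (L.char x) (P x) := by
  refine ⟨fun x => (ofModel I x₀ x).comp (((f.Y x).comp (f.Φ x)).comp (toModel I x₀ x)), ?_, ?_⟩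
  · refine (contMDiffOn_end_iff f.isOpen f.subset).2
      ((f.smooth_Y.clm_comp f.smooth_Φ).congr fun x hx => ContinuousLinearMap.ext fun v => ?_)
    have hv := toModel_ofModel (I := I) (f.subset hx) v
    exact (toModel_ofModel (f.subset hx) _).trans (congrArg (fun w => f.Y x (f.Φ x w)) hv)
  · intro x hx
    refine ⟨fun v => f.ofModel_Y_mem hx _, fun v hv => ?_⟩
    obtain ⟨c, hc⟩ := (f.mem_iff x hx v).1 hv
    have hYΦ : f.Y x (f.Φ x (toModel I x₀ x v)) = toModel I x₀ x v := by
      rw [← hc, f.leftInv x hx]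
    exact (congrArg (ofModel I x₀ x) hYΦ).trans (ofModel_toModel (f.subset hx) v)

variable [FiniteDimensional ℝ E] [T2Space M] [SigmaCompactSpace M]

theorem exists_smooth_isProj (f : ∀ x₀, CharFrame L N x₀) :
    ∃ P : Π x : M, TangentSpace I x →L[ℝ] TangentSpace I x,
      ContMDiff I (I.prod 𝓘(ℝ, E →L[ℝ] E)) ∞ (fun x => (⟨x, P x⟩ :
        TotalSpace (E →L[ℝ] E) (fun x : M => TangentSpace I x →L[ℝ] TangentSpace I x))) ∧
      ∀ x, LinearMap.IsProj (L.char x) (P x) := by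
  have h_convex (x : M) : Convex ℝ {P : TangentSpace I x →L[ℝ] TangentSpace I x |
      LinearMap.IsProj (L.char x) P} := by
    refine fun P hP Q hQ a b _ _ hab => ⟨fun v => (L.char x).add_mem
      ((L.char x).smul_mem a (hP.1 v)) ((L.char x).smul_mem b (hQ.1 v)), fun v hv => ?_⟩
    change a • P v + b • Q v = v
    rw [show P v = v from hP.2 v hv, show Q v = v from hQ.2 v hv, ← add_smul, hab, one_smul]
  obtain ⟨s, hs⟩ := exists_contMDiffSection_forall_mem_convex_of_local (I := I) (n := ⊤)
    (F_fiber := E →L[ℝ] E) (fun x : M => TangentSpace I x →L[ℝ] TangentSpace I x)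
    (fun x => {P | LinearMap.IsProj (L.char x) P}) h_convex fun x₀ => by
      obtain ⟨P, hP, hPL⟩ := (f x₀).exists_isProj
      exact ⟨(f x₀).U, (f x₀).isOpen.mem_nhds (f x₀).mem, P, hP, hPL⟩
  exact ⟨s, s.contMDiff, hs⟩

theorem exists_isSmoothComplement (f : ∀ x₀, CharFrame L N x₀) {k : ℕ}
    (hk : ∀ x, L.charRank x = k) :
    ∃ V : Π x : M, Submodule ℝ (TangentSpace I x), L.IsSmoothComplement V := by
  obtain ⟨P, hP, hPL⟩ := exists_smooth_isProj f
  have h_compl (x : M) : IsCompl (L.char x) (P x).ker :=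
    LinearMap.IsProj.isCompl (f := (P x : TangentSpace I x →ₗ[ℝ] TangentSpace I x))
      ⟨(hPL x).1, (hPL x).2⟩
  have h_rank (x : M) : Module.finrank ℝ (P x).ker = Module.finrank ℝ E - k := by
    have h_finite : FiniteDimensional ℝ (TangentSpace I x) :=
      inferInstanceAs (FiniteDimensional ℝ E)
    rw [← hk x]
    exact Nat.eq_sub_of_add_eq' (Submodule.finrank_add_eq_of_isCompl (h_compl x))
  exact ⟨fun x => (P x).ker, isSmoothDistribution_ker hP h_rank, h_compl⟩

end Complement

section BundleCharts

variable {E : Type*} [NormedAddCommGroup E] [NormedSpace ℝ E]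
  {H : Type*} [TopologicalSpace H] {I : ModelWithCorners ℝ E H}
  {M : Type*} [TopologicalSpace M] [ChartedSpace H M]
  {F : Type*} [NormedAddCommGroup F] {Z : M → Type*}
  [TopologicalSpace (TotalSpace F Z)] [∀ x, TopologicalSpace (Z x)] [FiberBundle F Z]

theorem mem_chart_source_totalSpace {p₀ p : TotalSpace F Z} :
    p ∈ (chartAt (ModelProd H F) p₀).source ↔
      p.1 ∈ (trivializationAt F Z p₀.1).baseSet ∧ p.1 ∈ (chartAt H p₀.1).source := by
  rw [FiberBundle.chartedSpace_chartAt]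
  simp only [mfld_simps]
  rw [(trivializationAt F Z p₀.1).mem_source]
  exact and_congr_right fun hp => by rw [(trivializationAt F Z p₀.1).coe_fst' hp]

variable [NormedSpace ℝ F]

theorem extChartAt_totalSpace {p₀ p : TotalSpace F Z}
    (hp : p.1 ∈ (trivializationAt F Z p₀.1).baseSet) :
    extChartAt (I.prod 𝓘(ℝ, F)) p₀ p =
      (extChartAt I p₀.1 p.1, (trivializationAt F Z p₀.1 p).2) := by
  rw [FiberBundle.extChartAt]
  simp only [PartialEquiv.coe_trans, Function.comp_apply, PartialEquiv.prod_coe,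
    PartialEquiv.refl_coe, id_eq]
  exact Prod.ext (congrArg (extChartAt I p₀.1) ((trivializationAt F Z p₀.1).coe_fst' hp)) rfl

theorem extChartAt_symm_fst_extChartAt {p₀ p : TotalSpace F Z}
    (hp : p ∈ (chartAt (ModelProd H F) p₀).source) :
    (extChartAt I p₀.1).symm (extChartAt (I.prod 𝓘(ℝ, F)) p₀ p).1 = p.1 := by
  obtain ⟨hpF, hpM⟩ := mem_chart_source_totalSpace.1 hp
  rw [extChartAt_totalSpace hpF]
  exact (extChartAt I p₀.1).left_inv (by simpa using hpM)

variable [∀ x, AddCommMonoid (Z x)] [∀ x, Module ℝ (Z x)] [VectorBundle ℝ F Z]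
  [IsManifold I ∞ M] [ContMDiffVectorBundle ∞ F Z I]

theorem toModel_mfderiv_proj {p₀ p : TotalSpace F Z}
    (hp : p ∈ (chartAt (ModelProd H F) p₀).source) (X : TangentSpace (I.prod 𝓘(ℝ, F)) p) :
    toModel I p₀.1 p.1 (mfderiv (I.prod 𝓘(ℝ, F)) I (TotalSpace.proj : TotalSpace F Z → M) p X) =
      (toModel (I.prod 𝓘(ℝ, F)) p₀ p X).1 := by
  obtain ⟨hpF, hpM⟩ := mem_chart_source_totalSpace.1 hp
  have h_proj : (extChartAt I p₀.1 ∘ (TotalSpace.proj : TotalSpace F Z → M)) =ᶠ[𝓝 p]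
      (ContinuousLinearMap.fst ℝ E F ∘ extChartAt (I.prod 𝓘(ℝ, F)) p₀) := by
    filter_upwards [(FiberBundle.continuous_proj F Z).continuousAt.eventually
      ((trivializationAt F Z p₀.1).open_baseSet.mem_nhds hpF)] with q hq
    exact (congrArg Prod.fst (extChartAt_totalSpace hq)).symm
  have h_deriv := h_proj.mfderiv_eq (I := I.prod 𝓘(ℝ, F)) (I' := 𝓘(ℝ, E))
  rw [mfderiv_comp p (mdifferentiableAt_extChartAt (I := I) hpM)
      ((contMDiffAt_proj Z (n := ∞)).mdifferentiableAt (by simp)),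
    mfderiv_comp (I'' := 𝓘(ℝ, E)) p
      ((ContinuousLinearMap.fst ℝ E F).differentiableAt.mdifferentiableAt)
      (mdifferentiableAt_extChartAt (I := I.prod 𝓘(ℝ, F)) hp)] at h_deriv
  rw [toModel_eq_mfderiv hp, toModel_eq_mfderiv hpM]
  refine (congrArg (fun A => A X) h_deriv).trans ?_
  rw [mfderiv_eq_fderiv, (ContinuousLinearMap.fst ℝ E F).fderiv]
  rfl

theorem mfderiv_proj_ofModel {p₀ p : TotalSpace F Z}
    (hp : p ∈ (chartAt (ModelProd H F) p₀).source) (v : E × F) :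
    mfderiv (I.prod 𝓘(ℝ, F)) I (TotalSpace.proj : TotalSpace F Z → M) p
      (ofModel (I.prod 𝓘(ℝ, F)) p₀ p v) = ofModel I p₀.1 p.1 v.1 := by
  have h_model := (toModel_mfderiv_proj hp (ofModel (I.prod 𝓘(ℝ, F)) p₀ p v)).trans
    (congrArg Prod.fst (toModel_ofModel (I := I.prod 𝓘(ℝ, F)) hp v))
  exact (ofModel_toModel (mem_chart_source_totalSpace.1 hp).2 _).symm.trans
    (congrArg (ofModel I p₀.1 p.1) h_model)

variable [I.Boundaryless]

theorem oneFormInChart_canonicalOneForm (q : CotangentBundle I M) :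
    oneFormInChart (I.prod 𝓘(ℝ, E →L[ℝ] ℝ)) (canonicalOneForm I) q =ᶠ[
      𝓝 (extChartAt (I.prod 𝓘(ℝ, E →L[ℝ] ℝ)) q q)]
      fun y => y.2.comp (ContinuousLinearMap.fst ℝ E (E →L[ℝ] ℝ)) := by
  filter_upwards [oneFormInChart_eq (I := I.prod 𝓘(ℝ, E →L[ℝ] ℝ)) (canonicalOneForm I) q,
    eventually_extChartAt_symm_mem_source (I := I.prod 𝓘(ℝ, E →L[ℝ] ℝ)) q]
    with y h_form ⟨h_source, h_right⟩
  obtain ⟨hqF, hqM⟩ := mem_chart_source_totalSpace.1 h_source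
  have h_snd := (congrArg Prod.snd (extChartAt_totalSpace (I := I) hqF)).symm.trans
    (congrArg Prod.snd h_right)
  rw [trivializationAt_cotangent hqM] at h_snd
  rw [h_form]
  refine ContinuousLinearMap.ext fun v => ?_
  exact (congrArg (((extChartAt (I.prod 𝓘(ℝ, E →L[ℝ] ℝ)) q).symm y).2)
    (mfderiv_proj_ofModel (I := I) h_source v)).trans (congrArg (fun ξ => ξ v.1) h_snd)

theorem differentiableAt_canonicalOneForm (q : CotangentBundle I M) :
    DifferentiableAt ℝ (oneFormInChart (I.prod 𝓘(ℝ, E →L[ℝ] ℝ)) (canonicalOneForm I) q)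
      (extChartAt (I.prod 𝓘(ℝ, E →L[ℝ] ℝ)) q q) :=
  (differentiableAt_snd.clm_comp (differentiableAt_const _)).congr_of_eventuallyEq
    (oneFormInChart_canonicalOneForm q)

end BundleCharts

/-! ### Poisson structures from Courant frames -/

section FrameSharp

variable {F : Type*} [NormedAddCommGroup F] [NormedSpace ℝ F]
  {R : Type*} [NormedAddCommGroup R] [NormedSpace ℝ R]
  {A : R →L[ℝ] F × (F →L[ℝ] ℝ)}

/-- The linear map `F^* → F` whose graph is the subspace of `F ⊕ F^*` with frame `A`. It has junk
values unless the second component of `A` is invertible. -/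
def frameSharp (A : R →L[ℝ] F × (F →L[ℝ] ℝ)) : (F →L[ℝ] ℝ) →L[ℝ] F :=
  (ContinuousLinearMap.fst ℝ F (F →L[ℝ] ℝ) ∘L A) ∘L
    (ContinuousLinearMap.snd ℝ F (F →L[ℝ] ℝ) ∘L A).inverse

theorem frameSharp_apply_snd (hA : (ContinuousLinearMap.snd ℝ F (F →L[ℝ] ℝ) ∘L A).IsInvertible)
    (c : R) : frameSharp A (A c).2 = (A c).1 :=
  congrArg (fun c => (A c).1) (DFunLike.congr_fun hA.inverse_comp_self c)

theorem exists_eq_iff_eq_frameSharp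
    (hA : (ContinuousLinearMap.snd ℝ F (F →L[ℝ] ℝ) ∘L A).IsInvertible)
    (q : F × (F →L[ℝ] ℝ)) : (∃ c, A c = q) ↔ q.1 = frameSharp A q.2 := by
  constructor
  · rintro ⟨c, rfl⟩
    exact (frameSharp_apply_snd hA c).symm
  · intro hq
    obtain ⟨c, hc⟩ : ∃ c, (A c).2 = q.2 := hA.surjective q.2
    exact ⟨c, Prod.ext (by rw [← frameSharp_apply_snd hA c, hc, hq]) hc⟩

theorem contDiffAt_frameSharp [CompleteSpace R] {X : Type*} [NormedAddCommGroup X]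
    [NormedSpace ℝ X] {n : WithTop ℕ∞} {G : X → R →L[ℝ] F × (F →L[ℝ] ℝ)} {z : X}
    (hG : ContDiffAt ℝ n G z)
    (hz : (ContinuousLinearMap.snd ℝ F (F →L[ℝ] ℝ) ∘L G z).IsInvertible) :
    ContDiffAt ℝ n (fun y => frameSharp (G y)) z := by
  have h_snd : ContDiffAt ℝ n (fun y => ContinuousLinearMap.snd ℝ F (F →L[ℝ] ℝ) ∘L G y) z :=
    contDiffAt_const.clm_comp hG
  exact (contDiffAt_const.clm_comp hG).clm_comp
    (ContDiffAt.comp (g := ContinuousLinearMap.inverse) z hz.contDiffAt_map_inverse h_snd)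

end FrameSharp

section CourantFrames

variable {F : Type*} [NormedAddCommGroup F] [NormedSpace ℝ F]
  {H : Type*} [TopologicalSpace H] {I : ModelWithCorners ℝ F H}
  {N : Type*} [TopologicalSpace N] [ChartedSpace H N] [IsManifold I ∞ N]
  {R : Type*} [NormedAddCommGroup R] [NormedSpace ℝ R]

/-- The subspace `D` of `T_pN ⊕ T_p^*N` meets `T_pN` in zero only. For a maximal isotropic `D` this
means that `D` is the graph of a map `T_p^*N → T_pN`. -/
def IsTransverse {p : N} (D : Submodule ℝ (TangentSpace I p × Cotangent I p)) : Prop :=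
  ∀ X : TangentSpace I p, (X, (0 : Cotangent I p)) ∈ D → X = 0

/-- The map `G`, defined near the image of `p₀` in the chart at `p₀`, is a smooth frame of the
family of subspaces `D` of `TN ⊕ T^*N`, and its Courant tensor vanishes at the image of `p₀`. -/
structure IsCourantFrameAt (D : Π p : N, Submodule ℝ (TangentSpace I p × Cotangent I p)) (p₀ : N)
    (G : F → R →L[ℝ] F × (F →L[ℝ] ℝ)) : Prop where
  contDiffAt : ContDiffAt ℝ ∞ G (extChartAt I p₀ p₀)
  injective : Function.Injective (G (extChartAt I p₀ p₀))
  mem_iff : ∀ᶠ z in 𝓝 (extChartAt I p₀ p₀), ∀ q, q ∈ D ((extChartAt I p₀).symm z) ↔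
    ∃ c, G z c = pairToModel I p₀ ((extChartAt I p₀).symm z) q
  courantTensor_eq_zero : ∀ a b c, courantTensor G (extChartAt I p₀ p₀) a b c = 0

theorem DiracStructure.exists_isCourantFrameAt [I.Boundaryless]
    (L : DiracStructure I N) (p₀ : N) :
    ∃ G : F → (Fin (Module.finrank ℝ F) → ℝ) →L[ℝ] F × (F →L[ℝ] ℝ),
      IsCourantFrameAt L.fiber p₀ G := by
  obtain ⟨U, hU, hp₀, -, G, hG, hGL, hT⟩ := L.exists_frame p₀
  refine ⟨fun z => G ((extChartAt I p₀).symm z),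
    contDiffAt_comp_extChartAt_symm (hG.contMDiffAt (hU.mem_nhds hp₀)), ?_, ?_, hT⟩
  · rw [extChartAt_to_inv]
    exact (hGL p₀ hp₀).1
  · filter_upwards [eventually_extChartAt_symm_mem (I := I) (hU.mem_nhds hp₀)] with z hz
    exact (hGL _ hz).2

variable {D : Π p : N, Submodule ℝ (TangentSpace I p × Cotangent I p)} {p₀ : N}
  {G : F → R →L[ℝ] F × (F →L[ℝ] ℝ)}

theorem IsCourantFrameAt.mem_iff_self (hG : IsCourantFrameAt D p₀ G)
    (q : TangentSpace I p₀ × Cotangent I p₀) :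
    q ∈ D p₀ ↔ ∃ c, G (extChartAt I p₀ p₀) c = pairToModel I p₀ p₀ q := by
  have h := hG.mem_iff.self_of_nhds
  rw [extChartAt_to_inv] at h
  exact h q

variable [FiniteDimensional ℝ F] [FiniteDimensional ℝ R]

theorem IsCourantFrameAt.isInvertible_snd (hG : IsCourantFrameAt D p₀ G)
    (hR : Module.finrank ℝ R = Module.finrank ℝ F) (hp₀ : IsTransverse (D p₀)) :
    (ContinuousLinearMap.snd ℝ F (F →L[ℝ] ℝ) ∘L G (extChartAt I p₀ p₀)).IsInvertible := by
  have h_inj : Function.Injective (ContinuousLinearMap.snd ℝ F (F →L[ℝ] ℝ) ∘L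
      G (extChartAt I p₀ p₀) : R →ₗ[ℝ] (F →L[ℝ] ℝ)) := by
    rw [injective_iff_map_eq_zero]
    intro c hc
    have h_pair : G (extChartAt I p₀ p₀) c = pairToModel I p₀ p₀
        (ofModel I p₀ p₀ (G (extChartAt I p₀ p₀) c).1, 0) :=
      Prod.ext (toModel_ofModel (mem_chart_source H p₀) _).symm hc
    rw [hp₀ _ ((hG.mem_iff_self _).2 ⟨c, h_pair⟩)] at h_pair
    exact hG.injective ((h_pair.trans (map_zero (pairToModel I p₀ p₀))).trans (map_zero _).symm)
  refine isInvertible_of_bijective ⟨h_inj, ?_⟩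
  exact (LinearMap.injective_iff_surjective_of_finrank_eq_finrank
    (hR.trans finrank_continuousDual.symm)).1 h_inj

theorem IsCourantFrameAt.eventually_isInvertible_snd (hG : IsCourantFrameAt D p₀ G)
    (hR : Module.finrank ℝ R = Module.finrank ℝ F) (hp₀ : IsTransverse (D p₀)) :
    ∀ᶠ z in 𝓝 (extChartAt I p₀ p₀),
      (ContinuousLinearMap.snd ℝ F (F →L[ℝ] ℝ) ∘L G z).IsInvertible := by
  have h_cont : ContinuousAt (fun z => ContinuousLinearMap.snd ℝ F (F →L[ℝ] ℝ) ∘L G z)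
      (extChartAt I p₀ p₀) := continuousAt_const.clm_comp hG.contDiffAt.continuousAt
  exact h_cont.eventually (isOpen_setOf_isInvertible.mem_nhds (hG.isInvertible_snd hR hp₀))

theorem IsCourantFrameAt.exists_sharp (hG : IsCourantFrameAt D p₀ G)
    (hR : Module.finrank ℝ R = Module.finrank ℝ F) (hp₀ : IsTransverse (D p₀)) :
    ∃ s : Cotangent I p₀ →L[ℝ] TangentSpace I p₀, ∀ q, q ∈ D p₀ ↔ q.1 = s q.2 := by
  have h_source := mem_chart_source H p₀
  let A := G (extChartAt I p₀ p₀)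
  refine ⟨(ofModel I p₀ p₀ ∘L frameSharp A) ∘L (ContinuousLinearMap.precomp ℝ (ofModel I p₀ p₀) :
    (TangentSpace I p₀ →L[ℝ] ℝ) →L[ℝ] (F →L[ℝ] ℝ)), fun q => ?_⟩
  refine (hG.mem_iff_self q).trans ((exists_eq_iff_eq_frameSharp
    (hG.isInvertible_snd hR hp₀) _).trans ⟨fun h => ?_, fun h => ?_⟩)
  · exact (ofModel_toModel h_source q.1).symm.trans (congrArg (ofModel I p₀ p₀) h)
  · exact (congrArg (toModel I p₀ p₀) h).trans (toModel_ofModel h_source _)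

variable [I.Boundaryless]

theorem IsCourantFrameAt.eventually_isTransverse (hG : IsCourantFrameAt D p₀ G)
    (hR : Module.finrank ℝ R = Module.finrank ℝ F) (hp₀ : IsTransverse (D p₀)) :
    ∀ᶠ p in 𝓝 p₀, IsTransverse (D p) := by
  refine eventually_of_eventually_extChartAt_symm (I := I) ?_
  filter_upwards [hG.eventually_isInvertible_snd hR hp₀, hG.mem_iff,
    eventually_extChartAt_symm_mem_source (I := I) p₀] with z h_inv h_mem ⟨h_source, _⟩ X hX
  obtain ⟨c, hc⟩ := (h_mem _).1 hX
  have hc₂ : (ContinuousLinearMap.snd ℝ F (F →L[ℝ] ℝ) ∘L G z) c = 0 := congrArg Prod.snd hc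
  rw [h_inv.injective (hc₂.trans (map_zero _).symm), map_zero] at hc
  exact congrArg Prod.fst (pairToModel_injective h_source
    (hc.symm.trans (map_zero (pairToModel I p₀ ((extChartAt I p₀).symm z))).symm))

theorem isOpen_setOf_isTransverse {G : N → F → R →L[ℝ] F × (F →L[ℝ] ℝ)}
    (hG : ∀ p₀, IsCourantFrameAt D p₀ (G p₀)) (hR : Module.finrank ℝ R = Module.finrank ℝ F) :
    IsOpen {p : N | IsTransverse (D p)} :=
  isOpen_iff_mem_nhds.2 fun p₀ hp₀ => (hG p₀).eventually_isTransverse hR hp₀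

end CourantFrames

section PoissonOfFrames

variable {F : Type*} [NormedAddCommGroup F] [NormedSpace ℝ F]
  {H : Type*} [TopologicalSpace H] {I : ModelWithCorners ℝ F H}
  {N : Type*} [TopologicalSpace N] [ChartedSpace H N] [IsManifold I ∞ N]
  {R : Type*} [NormedAddCommGroup R] [NormedSpace ℝ R]
  {D : Π p : N, Submodule ℝ (TangentSpace I p × Cotangent I p)} {p₀ : N}
  {G : F → R →L[ℝ] F × (F →L[ℝ] ℝ)}

/-- The contraction with a bivector field, read in the preferred chart at `p₀`. -/
def sharpInChart (s : Π p : N, Cotangent I p →L[ℝ] TangentSpace I p) (p₀ : N) (z : F) :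
    (F →L[ℝ] ℝ) →L[ℝ] F :=
  sharpToModel I p₀ ((extChartAt I p₀).symm z) (s ((extChartAt I p₀).symm z))

theorem contMDiffAt_sharp_of_sharpInChart {s : Π p : N, Cotangent I p →L[ℝ] TangentSpace I p}
    (hs : ContDiffAt ℝ ∞ (sharpInChart s p₀) (extChartAt I p₀ p₀)) :
    ContMDiffAt I (I.prod 𝓘(ℝ, (F →L[ℝ] ℝ) →L[ℝ] F)) ∞
      (fun p => (⟨p, s p⟩ : TotalSpace ((F →L[ℝ] ℝ) →L[ℝ] F)
        (fun p : N => Cotangent I p →L[ℝ] TangentSpace I p))) p₀ := by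
  refine contMDiffAt_sharp_iff.2
    ((hs.contMDiffAt.comp p₀ contMDiffAt_extChartAt).congr_of_eventuallyEq ?_)
  filter_upwards [chart_source_mem_nhds H p₀] with p hp
  have h_left := (extChartAt I p₀).left_inv (x := p) (by simpa using hp)
  exact (congrArg (fun p => sharpToModel I p₀ p (s p)) h_left).symm

variable [I.Boundaryless]

theorem covectorToModel_d0 {z : F} (hz : z ∈ (extChartAt I p₀).target) {f : N → ℝ}
    (hf : MDifferentiableAt I 𝓘(ℝ, ℝ) f ((extChartAt I p₀).symm z)) :
    covectorToModel I p₀ ((extChartAt I p₀).symm z) (d0 I f ((extChartAt I p₀).symm z)) =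
      fderiv ℝ (fun y => f ((extChartAt I p₀).symm y)) z := by
  have h_source : (extChartAt I p₀).symm z ∈ (chartAt H p₀).source := by
    simpa using (extChartAt I p₀).map_target hz
  have h_ofModel := ofModel_eq_mfderiv (I := I) h_source
  rw [(extChartAt I p₀).right_inv hz] at h_ofModel
  have h_symm : MDifferentiableAt 𝓘(ℝ, F) I (extChartAt I p₀).symm z :=
    ((contMDiffOn_extChartAt_symm (I := I) (n := ∞) p₀).contMDiffAt
      ((isOpen_extChartAt_target p₀).mem_nhds hz)).mdifferentiableAt (by simp)
  rw [covectorToModel, h_ofModel, ← mfderiv_eq_fderiv]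
  exact (mfderiv_comp z hf h_symm).symm

theorem bracketOf_extChartAt_symm {z : F} (hz : z ∈ (extChartAt I p₀).target) {f g : N → ℝ}
    (s : Π p : N, Cotangent I p →L[ℝ] TangentSpace I p)
    (hf : MDifferentiableAt I 𝓘(ℝ, ℝ) f ((extChartAt I p₀).symm z))
    (hg : MDifferentiableAt I 𝓘(ℝ, ℝ) g ((extChartAt I p₀).symm z)) :
    bracketOf I s f g ((extChartAt I p₀).symm z) =
      fderiv ℝ (fun y => g ((extChartAt I p₀).symm y)) z (sharpInChart s p₀ z
        (fderiv ℝ (fun y => f ((extChartAt I p₀).symm y)) z)) := by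
  have h_source : (extChartAt I p₀).symm z ∈ (chartAt H p₀).source := by
    simpa using (extChartAt I p₀).map_target hz
  rw [← covectorToModel_d0 hz hf, ← covectorToModel_d0 hz hg, sharpInChart, sharpToModel_apply,
    covectorToModel_toModel h_source]
  have h_d0 : ((covectorToModel I p₀ ((extChartAt I p₀).symm z)
      (d0 I f ((extChartAt I p₀).symm z))).comp (toModel I p₀ ((extChartAt I p₀).symm z)) :
        TangentSpace I ((extChartAt I p₀).symm z) →L[ℝ] ℝ) =
      d0 I f ((extChartAt I p₀).symm z) :=
    ContinuousLinearMap.ext fun v => covectorToModel_toModel h_source _ v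
  rw [h_d0]
  rfl

theorem bracketOf_extChartAt_symm_eventuallyEq {s : Π p : N, Cotangent I p →L[ℝ] TangentSpace I p}
    {f g : N → ℝ} (hf : ContMDiff I 𝓘(ℝ, ℝ) ∞ f) (hg : ContMDiff I 𝓘(ℝ, ℝ) ∞ g) :
    (fun y => bracketOf I s f g ((extChartAt I p₀).symm y)) =ᶠ[𝓝 (extChartAt I p₀ p₀)] fun y =>
      fderiv ℝ (fun y => g ((extChartAt I p₀).symm y)) y (sharpInChart s p₀ y
        (fderiv ℝ (fun y => f ((extChartAt I p₀).symm y)) y)) := by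
  filter_upwards [extChartAt_target_mem_nhds (I := I) p₀] with y hy
  exact bracketOf_extChartAt_symm hy s ((hf _).mdifferentiableAt (by simp))
    ((hg _).mdifferentiableAt (by simp))

theorem mdifferentiableAt_bracketOf {s : Π p : N, Cotangent I p →L[ℝ] TangentSpace I p}
    (hs : ContDiffAt ℝ ∞ (sharpInChart s p₀) (extChartAt I p₀ p₀)) {f g : N → ℝ}
    (hf : ContMDiff I 𝓘(ℝ, ℝ) ∞ f) (hg : ContMDiff I 𝓘(ℝ, ℝ) ∞ g) :
    MDifferentiableAt I 𝓘(ℝ, ℝ) (bracketOf I s f g) p₀ := by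
  have h_fderiv {h : N → ℝ} (hh : ContMDiff I 𝓘(ℝ, ℝ) ∞ h) : ContDiffAt ℝ ∞
      (fderiv ℝ fun y => h ((extChartAt I p₀).symm y)) (extChartAt I p₀ p₀) :=
    (contDiffAt_comp_extChartAt_symm (hh p₀)).fderiv_right (by simp)
  exact mdifferentiableAt_of_comp_extChartAt_symm
    ((((h_fderiv hg).clm_apply (hs.clm_apply (h_fderiv hf))).differentiableAt
      (by simp)).congr_of_eventuallyEq (bracketOf_extChartAt_symm_eventuallyEq hf hg))

theorem bracketOf_bracketOf {s : Π p : N, Cotangent I p →L[ℝ] TangentSpace I p}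
    (hs : ContDiffAt ℝ ∞ (sharpInChart s p₀) (extChartAt I p₀ p₀)) {f g h : N → ℝ}
    (hf : ContMDiff I 𝓘(ℝ, ℝ) ∞ f) (hg : ContMDiff I 𝓘(ℝ, ℝ) ∞ g) (hh : ContMDiff I 𝓘(ℝ, ℝ) ∞ h) :
    bracketOf I s f (bracketOf I s g h) p₀ =
      fderiv ℝ (fun y => fderiv ℝ (fun y => h ((extChartAt I p₀).symm y)) y
          (sharpInChart s p₀ y (fderiv ℝ (fun y => g ((extChartAt I p₀).symm y)) y)))
        (extChartAt I p₀ p₀) (sharpInChart s p₀ (extChartAt I p₀ p₀)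
          (fderiv ℝ (fun y => f ((extChartAt I p₀).symm y)) (extChartAt I p₀ p₀))) := by
  have h_symm : (extChartAt I p₀).symm (extChartAt I p₀ p₀) = p₀ := extChartAt_to_inv p₀
  have h_bracket := bracketOf_extChartAt_symm (f := f) (g := bracketOf I s g h)
    (mem_extChartAt_target p₀) s ((hf _).mdifferentiableAt (by simp))
    (by rw [h_symm]; exact mdifferentiableAt_bracketOf hs hg hh)
  rwa [h_symm, (bracketOf_extChartAt_symm_eventuallyEq hg hh).fderiv_eq] at h_bracket

theorem IsCourantFrameAt.eventually_fst_eq_sharpInChart (hG : IsCourantFrameAt D p₀ G)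
    {s : Π p : N, Cotangent I p →L[ℝ] TangentSpace I p} (hs : ∀ p q, q ∈ D p ↔ q.1 = s p q.2) :
    ∀ᶠ z in 𝓝 (extChartAt I p₀ p₀), ∀ c, (G z c).1 = sharpInChart s p₀ z (G z c).2 := by
  filter_upwards [hG.mem_iff, eventually_extChartAt_symm_mem_source (I := I) p₀]
    with z h_mem ⟨h_source, _⟩ c
  have h_graph := (hs _ _).1 ((h_mem _).2 ⟨c, (pairToModel_ofModel h_source (G z c)).symm⟩)
  exact (toModel_ofModel h_source _).symm.trans
    (congrArg (toModel I p₀ ((extChartAt I p₀).symm z)) h_graph)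

variable [FiniteDimensional ℝ F] [FiniteDimensional ℝ R]

theorem IsCourantFrameAt.contDiffAt_sharpInChart (hG : IsCourantFrameAt D p₀ G)
    (hR : Module.finrank ℝ R = Module.finrank ℝ F) (hp₀ : IsTransverse (D p₀))
    {s : Π p : N, Cotangent I p →L[ℝ] TangentSpace I p} (hs : ∀ p q, q ∈ D p ↔ q.1 = s p q.2) :
    ContDiffAt ℝ ∞ (sharpInChart s p₀) (extChartAt I p₀ p₀) := by
  have h_complete := FiniteDimensional.complete ℝ R
  refine (contDiffAt_frameSharp hG.contDiffAt (hG.isInvertible_snd hR hp₀)).congr_of_eventuallyEq ?_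
  filter_upwards [hG.eventually_fst_eq_sharpInChart hs, hG.eventually_isInvertible_snd hR hp₀]
    with z h_graph h_inv
  refine ContinuousLinearMap.ext fun ξ => ?_
  obtain ⟨c, rfl⟩ : ∃ c, (G z c).2 = ξ := h_inv.surjective ξ
  exact (h_graph c).symm.trans (frameSharp_apply_snd h_inv c).symm

theorem IsCourantFrameAt.bracketOf_jacobi (hG : IsCourantFrameAt D p₀ G)
    (hR : Module.finrank ℝ R = Module.finrank ℝ F) (hp₀ : IsTransverse (D p₀))
    {s : Π p : N, Cotangent I p →L[ℝ] TangentSpace I p} (hs : ∀ p q, q ∈ D p ↔ q.1 = s p q.2)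
    (h_skew : ∀ p (ξ η : Cotangent I p), (η (s p ξ) : ℝ) = -ξ (s p η)) {f g h : N → ℝ}
    (hf : ContMDiff I 𝓘(ℝ, ℝ) ∞ f) (hg : ContMDiff I 𝓘(ℝ, ℝ) ∞ g) (hh : ContMDiff I 𝓘(ℝ, ℝ) ∞ h) :
    bracketOf I s f (bracketOf I s g h) p₀ + bracketOf I s g (bracketOf I s h f) p₀ +
      bracketOf I s h (bracketOf I s f g) p₀ = 0 := by
  have hP := hG.contDiffAt_sharpInChart hR hp₀ hs
  have h_smooth {u : N → ℝ} (hu : ContMDiff I 𝓘(ℝ, ℝ) ∞ u) :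
      ContDiffAt ℝ 2 (fun y => u ((extChartAt I p₀).symm y)) (extChartAt I p₀ p₀) :=
    (contDiffAt_comp_extChartAt_symm (hu p₀)).of_le ENat.LEInfty.out
  rw [bracketOf_bracketOf hP hf hg hh, bracketOf_bracketOf hP hg hh hf,
    bracketOf_bracketOf hP hh hf hg]
  exact jacobi_of_courantTensor_eq_zero (hG.contDiffAt.differentiableAt (by simp))
    (hP.differentiableAt (by simp)) (hG.eventually_fst_eq_sharpInChart hs)
    (fun ξ η => h_skew ((extChartAt I p₀).symm (extChartAt I p₀ p₀))
      (ξ.comp (toModel I p₀ _)) (η.comp (toModel I p₀ _)))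
    (hG.isInvertible_snd hR hp₀).surjective hG.courantTensor_eq_zero
    (h_smooth hf) (h_smooth hg) (h_smooth hh)

theorem exists_poissonStructure_graph_eq {G : N → F → R →L[ℝ] F × (F →L[ℝ] ℝ)}
    (hG : ∀ p₀, IsCourantFrameAt D p₀ (G p₀)) (hR : Module.finrank ℝ R = Module.finrank ℝ F)
    (h_iso : ∀ p, ∀ a ∈ D p, ∀ b ∈ D p, (a.2 b.1 + b.2 a.1 : ℝ) = 0)
    (h_trans : ∀ p, IsTransverse (D p)) :
    ∃ S : PoissonStructure I N, ∀ p, S.graph p = D p := by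
  choose s hs using fun p => (hG p).exists_sharp hR (h_trans p)
  have h_skew (p : N) (ξ η : Cotangent I p) : (η (s p ξ) : ℝ) = -ξ (s p η) :=
    eq_neg_of_add_eq_zero_right
      (h_iso p (s p ξ, ξ) ((hs p _).2 rfl) (s p η, η) ((hs p _).2 rfl))
  refine ⟨⟨s, h_skew, fun p₀ => contMDiffAt_sharp_of_sharpInChart
    ((hG p₀).contDiffAt_sharpInChart hR (h_trans p₀) hs), fun f g h hf hg hh p₀ =>
    (hG p₀).bracketOf_jacobi hR (h_trans p₀) hs h_skew hf hg hh⟩, fun p => ?_⟩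
  ext q
  refine Iff.trans ⟨?_, fun h => ⟨q.2, Prod.ext h.symm rfl⟩⟩ (hs p q).symm
  rintro ⟨ξ, rfl⟩
  rfl

end PoissonOfFrames

section Opens

variable {F : Type*} [NormedAddCommGroup F] [NormedSpace ℝ F]
  {H : Type*} [TopologicalSpace H] {I : ModelWithCorners ℝ F H}
  {N : Type*} [TopologicalSpace N] [ChartedSpace H N] {U : Opens N}

theorem mem_chart_source_opens {p₀ p : U} :
    p ∈ (chartAt H p₀).source ↔ p.1 ∈ (chartAt H p₀.1).source := by
  change p ∈ ((chartAt H p₀.1).subtypeRestr ⟨p₀⟩).source ↔ _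
  rw [OpenPartialHomeomorph.subtypeRestr_source]
  rfl

theorem eventually_extChartAt_opens_symm [I.Boundaryless] (p₀ : U) :
    ∀ᶠ z in 𝓝 (extChartAt I p₀ p₀),
      (((extChartAt I p₀).symm z : U) : N) = (extChartAt I p₀.1).symm z := by
  filter_upwards [eventually_extChartAt_symm_mem_source (I := I) p₀] with z hz
  have h_left := (extChartAt I p₀.1).left_inv (x := ((extChartAt I p₀).symm z).1)
    (by simpa using mem_chart_source_opens.1 hz.1)
  exact h_left.symm.trans (congrArg _ hz.2)

variable [IsManifold I ∞ N]

theorem toModel_mfderiv_val {p₀ p : U} (hp : p ∈ (chartAt H p₀).source) (X : TangentSpace I p) :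
    toModel I p₀.1 p.1 (mfderiv I I (Subtype.val : U → N) p X) = toModel I p₀ p X := by
  have h_val : MDifferentiableAt I I (Subtype.val : U → N) p :=
    (contMDiff_subtype_val (n := ∞) p).mdifferentiableAt (by simp)
  rw [toModel_eq_mfderiv (mem_chart_source_opens.1 hp), toModel_eq_mfderiv hp]
  exact (congrArg (fun A : F →L[ℝ] F => A X) (mfderiv_comp p
    (mdifferentiableAt_extChartAt (I := I) (mem_chart_source_opens.1 hp)) h_val)).symm

theorem mfderiv_val_ofModel {p₀ p : U} (hp : p ∈ (chartAt H p₀).source) (v : F) :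
    mfderiv I I (Subtype.val : U → N) p (ofModel I p₀ p v) = ofModel I p₀.1 p.1 v :=
  (ofModel_toModel (mem_chart_source_opens.1 hp) _).symm.trans
    (congrArg _ ((toModel_mfderiv_val hp _).trans (toModel_ofModel hp v)))

theorem mfderiv_val_bijective (p : U) :
    Function.Bijective (mfderiv I I (Subtype.val : U → N) p) := by
  have hp := mem_chart_source H p
  refine ⟨fun v w h => ?_, fun v => ⟨ofModel I p p (toModel I p.1 p.1 v),
    (mfderiv_val_ofModel hp _).trans (ofModel_toModel (mem_chart_source H p.1) v)⟩⟩
  have h_model : toModel I p p v = toModel I p p w := by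
    rw [← toModel_mfderiv_val hp, ← toModel_mfderiv_val hp, h]
  exact toModel_injective hp h_model

theorem pairToModel_mfderiv_val {p₀ p : U} (hp : p ∈ (chartAt H p₀).source) (X : TangentSpace I p)
    (ξ : Cotangent I p.1) :
    pairToModel I p₀.1 p.1 (mfderiv I I (Subtype.val : U → N) p X, ξ) =
      pairToModel I p₀ p (X, ξ.comp (mfderiv I I (Subtype.val : U → N) p)) :=
  Prod.ext (toModel_mfderiv_val hp X)
    (ContinuousLinearMap.ext fun v => congrArg ξ (mfderiv_val_ofModel hp v).symm)

theorem IsTransverse.restrict {p : U} {D : Submodule ℝ (TangentSpace I p.1 × Cotangent I p.1)}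
    (hD : IsTransverse D) :
    IsTransverse (pullbackDirac (mfderiv I I (Subtype.val : U → N) p) D) := by
  rintro X ⟨ξ, hξ, h_comp⟩
  have hξ_zero : ξ = 0 := ContinuousLinearMap.ext fun v => by
    obtain ⟨w, rfl⟩ := (mfderiv_val_bijective p).2 v
    exact (congrArg (fun η : F →L[ℝ] ℝ => η w) h_comp).symm
  rw [hξ_zero] at hξ
  exact (mfderiv_val_bijective p).1 ((hD _ hξ).trans (map_zero _).symm)

variable {R : Type*} [NormedAddCommGroup R] [NormedSpace ℝ R]
  {D : Π p : N, Submodule ℝ (TangentSpace I p × Cotangent I p)} [I.Boundaryless]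

theorem IsCourantFrameAt.restrict {p₀ : U} {G : F → R →L[ℝ] F × (F →L[ℝ] ℝ)}
    (hG : IsCourantFrameAt D p₀.1 G) :
    IsCourantFrameAt (fun p : U => pullbackDirac (mfderiv I I (Subtype.val : U → N) p) (D p.1))
      p₀ G := by
  refine ⟨hG.contDiffAt, hG.injective, ?_, hG.courantTensor_eq_zero⟩
  filter_upwards [hG.mem_iff, eventually_extChartAt_opens_symm (I := I) p₀,
    eventually_extChartAt_symm_mem_source (I := I) p₀] with z h_mem h_val ⟨hp, _⟩
  rw [← h_val] at h_mem
  generalize (extChartAt I p₀).symm z = p at *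
  rintro ⟨X, ζ⟩
  constructor
  · rintro ⟨ξ, hξ, rfl : ζ = _⟩
    obtain ⟨c, hc⟩ := (h_mem _).1 hξ
    exact ⟨c, hc.trans (pairToModel_mfderiv_val hp X ξ)⟩
  · rintro ⟨c, hc⟩
    let ξ : Cotangent I p.1 := ζ.comp ((ofModel I p₀ p).comp (toModel I p₀.1 p.1))
    have hξ : ζ = ξ.comp (mfderiv I I (Subtype.val : U → N) p) :=
      ContinuousLinearMap.ext fun v => congrArg ζ ((ofModel_toModel hp v).symm.trans
        (congrArg _ (toModel_mfderiv_val hp v).symm))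
    refine ⟨ξ, (h_mem _).2 ⟨c, ?_⟩, hξ⟩
    rw [hc, hξ]
    exact (pairToModel_mfderiv_val hp X ξ).symm

theorem exists_poissonStructure_opens [FiniteDimensional ℝ F] [FiniteDimensional ℝ R]
    {G : N → F → R →L[ℝ] F × (F →L[ℝ] ℝ)} (hG : ∀ p₀, IsCourantFrameAt D p₀ (G p₀))
    (hR : Module.finrank ℝ R = Module.finrank ℝ F)
    (h_iso : ∀ p, ∀ a ∈ D p, ∀ b ∈ D p, (a.2 b.1 + b.2 a.1 : ℝ) = 0)
    (h_trans : ∀ p ∈ U, IsTransverse (D p)) :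
    ∃ S : PoissonStructure I U, ∀ p : U,
      S.graph p = pullbackDirac (mfderiv I I (Subtype.val : U → N) p) (D p.1) := by
  refine exists_poissonStructure_graph_eq (fun p₀ => (hG p₀.1).restrict) hR ?_
    fun p => (h_trans p.1 p.2).restrict
  rintro p ⟨X, _⟩ ⟨ξ, hξ, rfl⟩ ⟨Y, _⟩ ⟨η, hη, rfl⟩
  exact h_iso p.1 _ hξ _ hη

end Opens

/-! ### Gauge transformations of pulled back Dirac structures -/

section GaugedFrames

variable {F R K : Type*} [NormedAddCommGroup F] [NormedSpace ℝ F]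
  [NormedAddCommGroup R] [NormedSpace ℝ R] [NormedAddCommGroup K] [NormedSpace ℝ K]

/-- A frame of the gauge transform by `B` of the pullback to `F × K` of the subspace of `F ⊕ F^*`
with frame `a`. -/
def gaugedFrame (a : R →L[ℝ] F × (F →L[ℝ] ℝ)) (B : F × K →L[ℝ] (F × K →L[ℝ] ℝ)) :
    (R × K) →L[ℝ] (F × K) × (F × K →L[ℝ] ℝ) :=
  let X : R × K →L[ℝ] F × K :=
    (ContinuousLinearMap.fst ℝ F (F →L[ℝ] ℝ) ∘L a).prodMap (ContinuousLinearMap.id ℝ K)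
  X.prod (((ContinuousLinearMap.fst ℝ F K).precomp ℝ : (F →L[ℝ] ℝ) →L[ℝ] (F × K →L[ℝ] ℝ)) ∘L
    ContinuousLinearMap.snd ℝ F (F →L[ℝ] ℝ) ∘L a ∘L ContinuousLinearMap.fst ℝ R K + B ∘L X)

theorem gaugedFrame_apply (a : R →L[ℝ] F × (F →L[ℝ] ℝ)) (B : F × K →L[ℝ] (F × K →L[ℝ] ℝ))
    (c : R × K) : gaugedFrame a B c = (((a c.1).1, c.2),
      (a c.1).2.comp (ContinuousLinearMap.fst ℝ F K) + B ((a c.1).1, c.2)) := rfl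

theorem gaugedFrame_injective {a : R →L[ℝ] F × (F →L[ℝ] ℝ)} (ha : Function.Injective a)
    (B : F × K →L[ℝ] (F × K →L[ℝ] ℝ)) : Function.Injective (gaugedFrame a B) := by
  intro c d h
  simp only [gaugedFrame_apply, Prod.mk.injEq] at h
  obtain ⟨⟨h_vec, h_fibre⟩, h_cov⟩ := h
  rw [h_vec, h_fibre, add_left_inj] at h_cov
  exact Prod.ext (ha (Prod.ext h_vec (ContinuousLinearMap.ext fun v =>
    DFunLike.congr_fun h_cov (v, 0)))) h_fibre

variable [FiniteDimensional ℝ R] [FiniteDimensional ℝ K]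

theorem contDiffAt_gaugedFrame {n : WithTop ℕ∞} {G : F → R →L[ℝ] F × (F →L[ℝ] ℝ)}
    {B : F × K → F × K →L[ℝ] (F × K →L[ℝ] ℝ)} {z : F × K} (hG : ContDiffAt ℝ n G z.1)
    (hB : ContDiffAt ℝ n B z) : ContDiffAt ℝ n (fun y => gaugedFrame (G y.1) (B y)) z := by
  rw [contDiffAt_clm_apply_iff]
  intro c
  simp only [gaugedFrame_apply]
  have h_frame : ContDiffAt ℝ n (fun y : F × K => G y.1 c.1) z :=
    (hG.comp z contDiffAt_fst).clm_apply contDiffAt_const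
  have h_vec : ContDiffAt ℝ n (fun y : F × K => ((G y.1 c.1).1, c.2)) z :=
    h_frame.fst.prodMk contDiffAt_const
  exact h_vec.prodMk ((h_frame.snd.clm_comp contDiffAt_const).add (hB.clm_apply h_vec))

theorem courantTensor_gaugedFrame {G : F → R →L[ℝ] F × (F →L[ℝ] ℝ)}
    {θ : F × K → (F × K →L[ℝ] ℝ)} {z : F × K} (hG : ContDiffAt ℝ ∞ G z.1)
    (hθ : ContDiffAt ℝ ∞ θ z) (a b c : R × K) :
    courantTensor (fun y => gaugedFrame (G y.1) (vecD1 θ y)) z a b c =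
      courantTensor G z.1 a.1 b.1 c.1 := by
  have hB : ContDiffAt ℝ ∞ (vecD1 θ) z := contDiffAt_vecD1 hθ (by simp)
  let pulledFrame (y : F × K) := gaugedFrame (G y.1) (0 : F × K →L[ℝ] (F × K →L[ℝ] ℝ))
  have h_pulled : DifferentiableAt ℝ pulledFrame z :=
    (contDiffAt_gaugedFrame hG contDiffAt_const).differentiableAt (by simp)
  have h_gauge := courantTensor_gauge h_pulled
    ((contDiffAt_gaugedFrame hG hB).differentiableAt (by simp)) (hB.differentiableAt (by simp))
    (.of_forall fun y c => by simp [pulledFrame, gaugedFrame_apply])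
    (vecD1_antisymm θ z)
    (fderiv_vecD1_cyclic (hθ.of_le ENat.LEInfty.out)) a b c
  have h_pullback := courantTensor_pullback_fst (hG.differentiableAt (by simp)) h_pulled
    (.of_forall fun y c => by simp [pulledFrame, gaugedFrame_apply]) a b c
  exact h_gauge.trans h_pullback

end GaugedFrames

section GaugedPullback

variable {E : Type*} [NormedAddCommGroup E] [NormedSpace ℝ E]
  {H : Type*} [TopologicalSpace H] {I : ModelWithCorners ℝ E H}
  {M : Type*} [TopologicalSpace M] [ChartedSpace H M] [IsManifold I ∞ M]

section Chart

variable [I.Boundaryless]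

theorem mfderiv_comp_extChartAt_symm {E' : Type*} [NormedAddCommGroup E'] [NormedSpace ℝ E']
    {H' : Type*} [TopologicalSpace H'] {J : ModelWithCorners ℝ E' H'}
    {N : Type*} [TopologicalSpace N] [ChartedSpace H' N] {s : M → N} {x₀ : M} {y : E}
    (hy : y ∈ (extChartAt I x₀).target)
    (hs : MDifferentiableAt I J s ((extChartAt I x₀).symm y)) (v : E) :
    (mfderiv 𝓘(ℝ, E) J (s ∘ (extChartAt I x₀).symm) y v : E') =
      mfderiv I J s ((extChartAt I x₀).symm y) (ofModel I x₀ ((extChartAt I x₀).symm y) v) := by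
  have h_source : (extChartAt I x₀).symm y ∈ (chartAt H x₀).source := by
    simpa using (extChartAt I x₀).map_target hy
  have h_smooth : ContMDiffAt 𝓘(ℝ, E) I ∞ (extChartAt I x₀).symm y :=
    (contMDiffOn_extChartAt_symm x₀).contMDiffAt ((isOpen_extChartAt_target x₀).mem_nhds hy)
  have h_ofModel := ofModel_eq_mfderiv (I := I) h_source
  rw [(extChartAt I x₀).right_inv hy] at h_ofModel
  rw [h_ofModel]
  exact congrArg (fun A : E →L[ℝ] E' => A v)
    (mfderiv_comp y hs (h_smooth.mdifferentiableAt (by simp)))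

end Chart

variable {K : Type*} [NormedAddCommGroup K] [NormedSpace ℝ K] {Z : M → Type*}
  [TopologicalSpace (TotalSpace K Z)] [∀ x, TopologicalSpace (Z x)] [FiberBundle K Z]

/-- The bundle map from a vector bundle on `M` to `T*M` whose value at `p` is the covector
`σ p`. It need not be linear in the fibres. -/
def toCotangent (σ : Π p : TotalSpace K Z, Cotangent I p.1) (p : TotalSpace K Z) :
    CotangentBundle I M := ⟨p.1, σ p⟩

/-- The pullback of the canonical symplectic form of `T*M` by the bundle map `toCotangent σ`. -/
def pullbackSymplecticForm (σ : Π p : TotalSpace K Z, Cotangent I p.1) (p : TotalSpace K Z) :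
    TangentSpace (I.prod 𝓘(ℝ, K)) p →ₗ[ℝ] Cotangent (I.prod 𝓘(ℝ, K)) p :=
  pullbackTensor (mfderiv (I.prod 𝓘(ℝ, K)) (I.prod 𝓘(ℝ, E →L[ℝ] ℝ)) (toCotangent σ) p)
    (canonicalSymplecticForm I (toCotangent σ p))

/-- The family `τ_B (π^* D)` on the total space of a vector bundle `π` on `M`, with `D` a family of
subspaces of `TM ⊕ T*M` and `B` the form `pullbackSymplecticForm σ`. -/
def gaugedPullback (D : Π x : M, Submodule ℝ (TangentSpace I x × Cotangent I x))
    (σ : Π p : TotalSpace K Z, Cotangent I p.1) (p : TotalSpace K Z) :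
    Submodule ℝ (TangentSpace (I.prod 𝓘(ℝ, K)) p × Cotangent (I.prod 𝓘(ℝ, K)) p) :=
  gaugeTransform (pullbackSymplecticForm σ p)
    (pullbackDirac (mfderiv (I.prod 𝓘(ℝ, K)) I (TotalSpace.proj : TotalSpace K Z → M) p) (D p.1))

/-- The pullback of the canonical `1`-form of `T*M` by the bundle map `toCotangent σ`, read in the
chart at `p₀`. -/
def tautologicalFormInChart (σ : Π p : TotalSpace K Z, Cotangent I p.1) (p₀ : TotalSpace K Z)
    (z : E × K) : E × K →L[ℝ] ℝ :=
  let p := (extChartAt (I.prod 𝓘(ℝ, K)) p₀).symm z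
  covectorToModel I p₀.1 p.1 (σ p) ∘L ContinuousLinearMap.fst ℝ E K

variable {D : Π x : M, Submodule ℝ (TangentSpace I x × Cotangent I x)}
  {σ : Π p : TotalSpace K Z, Cotangent I p.1} {p₀ : TotalSpace K Z}

theorem mem_gaugedPullback_iff {p : TotalSpace K Z}
    (q : TangentSpace (I.prod 𝓘(ℝ, K)) p × Cotangent (I.prod 𝓘(ℝ, K)) p) :
    q ∈ gaugedPullback D σ p ↔ ∃ ζ : Cotangent I p.1,
      (mfderiv (I.prod 𝓘(ℝ, K)) I (TotalSpace.proj : TotalSpace K Z → M) p q.1, ζ) ∈ D p.1 ∧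
      q.2 = ζ.comp (mfderiv (I.prod 𝓘(ℝ, K)) I (TotalSpace.proj : TotalSpace K Z → M) p) +
        pullbackSymplecticForm σ p q.1 := by
  constructor
  · rintro ⟨⟨X, η⟩, ⟨ζ, hζ, hη⟩, rfl⟩
    exact ⟨ζ, hζ, congrArg (· + pullbackSymplecticForm σ p X) hη⟩
  · rintro ⟨ζ, hζ, hq⟩
    exact ⟨(q.1, ζ.comp (mfderiv (I.prod 𝓘(ℝ, K)) I (TotalSpace.proj : TotalSpace K Z → M) p)),
      ⟨ζ, hζ, rfl⟩, Prod.ext rfl hq.symm⟩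

theorem canonicalOneForm_comp_mfderiv_toCotangent {p : TotalSpace K Z}
    (hσ : MDifferentiableAt (I.prod 𝓘(ℝ, K)) (I.prod 𝓘(ℝ, E →L[ℝ] ℝ)) (toCotangent σ) p)
    (X : TangentSpace (I.prod 𝓘(ℝ, K)) p) :
    canonicalOneForm I (toCotangent σ p)
        (mfderiv (I.prod 𝓘(ℝ, K)) (I.prod 𝓘(ℝ, E →L[ℝ] ℝ)) (toCotangent σ) p X) =
      σ p (mfderiv (I.prod 𝓘(ℝ, K)) I (TotalSpace.proj : TotalSpace K Z → M) p X) := by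
  have h_proj : MDifferentiableAt (I.prod 𝓘(ℝ, E →L[ℝ] ℝ)) I
      (TotalSpace.proj : CotangentBundle I M → M) (toCotangent σ p) :=
    (contMDiffAt_proj _ (n := ∞)).mdifferentiableAt (by simp)
  have h_chain := congrArg (fun A : E × K →L[ℝ] E => A X) (mfderiv_comp p h_proj hσ)
  exact congrArg (σ p) h_chain.symm

variable [I.Boundaryless]

theorem canonicalSymplecticForm_antisymm (q : CotangentBundle I M)
    (X Y : TangentSpace (I.prod 𝓘(ℝ, E →L[ℝ] ℝ)) q) :
    canonicalSymplecticForm I q X Y = (-canonicalSymplecticForm I q Y X : ℝ) := by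
  have h_coord := d1_eq_vecD1 (I := I.prod 𝓘(ℝ, E →L[ℝ] ℝ)) (canonicalOneForm I) q
  have h_apply (X Y : E × (E →L[ℝ] ℝ)) := congrArg (fun η => η Y) (h_coord X)
  exact (h_apply X Y).trans <|
    (vecD1_antisymm (F := E × (E →L[ℝ] ℝ)) _ _ X Y).trans (congrArg Neg.neg (h_apply Y X).symm)

theorem isotropic_gaugedPullback
    (hD : ∀ x, ∀ a ∈ D x, ∀ b ∈ D x, (a.2 b.1 + b.2 a.1 : ℝ) = 0) (p : TotalSpace K Z) :
    ∀ a ∈ gaugedPullback D σ p, ∀ b ∈ gaugedPullback D σ p, (a.2 b.1 + b.2 a.1 : ℝ) = 0 := by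
  intro a ha b hb
  obtain ⟨ζ, hζ, ha₂⟩ := (mem_gaugedPullback_iff a).1 ha
  obtain ⟨η, hη, hb₂⟩ := (mem_gaugedPullback_iff b).1 hb
  have h_iso := hD p.1 _ hζ _ hη
  have h_anti : pullbackSymplecticForm σ p a.1 b.1 = (-pullbackSymplecticForm σ p b.1 a.1 : ℝ) :=
    canonicalSymplecticForm_antisymm _ _ _
  have h_sum {s t x y : ℝ} (h : s + t = 0) (h' : x = -y) : s + x + (t + y) = 0 := by linarith
  rw [ha₂, hb₂]
  exact h_sum h_iso h_anti

variable [∀ x, AddCommMonoid (Z x)] [∀ x, Module ℝ (Z x)] [VectorBundle ℝ K Z]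
  [ContMDiffVectorBundle ∞ K Z I]

theorem contDiffAt_tautologicalFormInChart
    (hσ : ContMDiff (I.prod 𝓘(ℝ, K)) (I.prod 𝓘(ℝ, E →L[ℝ] ℝ)) ∞ (toCotangent σ)) :
    ContDiffAt ℝ ∞ (tautologicalFormInChart σ p₀) (extChartAt (I.prod 𝓘(ℝ, K)) p₀ p₀) := by
  have h_fibre := (contMDiffAt_totalSpace.1 (hσ p₀)).2
  have h_source : ∀ᶠ p : TotalSpace K Z in 𝓝 p₀, p.1 ∈ (chartAt H p₀.1).source :=
    (FiberBundle.continuous_proj K Z).continuousAt (chart_source_mem_nhds H p₀.1)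
  have h_model : ContMDiffAt (I.prod 𝓘(ℝ, K)) 𝓘(ℝ, E →L[ℝ] ℝ) ∞
      (fun p : TotalSpace K Z => covectorToModel I p₀.1 p.1 (σ p)) p₀ :=
    h_fibre.congr_of_eventuallyEq (h_source.mono fun p hp => (trivializationAt_cotangent hp _).symm)
  exact (contDiffAt_comp_extChartAt_symm h_model).clm_comp contDiffAt_const

theorem canonicalOneForm_comp_mfderiv_toCotangent_chart
    (hσ : ContMDiff (I.prod 𝓘(ℝ, K)) (I.prod 𝓘(ℝ, E →L[ℝ] ℝ)) ∞ (toCotangent σ)) {z : E × K}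
    (hz : z ∈ (extChartAt (I.prod 𝓘(ℝ, K)) p₀).target) :
    (canonicalOneForm I (toCotangent σ ((extChartAt (I.prod 𝓘(ℝ, K)) p₀).symm z))).comp
        (mfderiv 𝓘(ℝ, E × K) (I.prod 𝓘(ℝ, E →L[ℝ] ℝ))
          (toCotangent σ ∘ (extChartAt (I.prod 𝓘(ℝ, K)) p₀).symm) z) =
      tautologicalFormInChart σ p₀ z := by
  let p := (extChartAt (I.prod 𝓘(ℝ, K)) p₀).symm z
  have h_source : p ∈ (chartAt (ModelProd H K) p₀).source := by
    simpa only [extChartAt_source] using (extChartAt (I.prod 𝓘(ℝ, K)) p₀).map_target hz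
  have h_diff := (hσ p).mdifferentiableAt (by simp)
  refine ContinuousLinearMap.ext fun v => ?_
  calc _ = canonicalOneForm I (toCotangent σ p) (mfderiv (I.prod 𝓘(ℝ, K))
          (I.prod 𝓘(ℝ, E →L[ℝ] ℝ)) (toCotangent σ) p (ofModel (I.prod 𝓘(ℝ, K)) p₀ p v)) :=
        congrArg (canonicalOneForm I (toCotangent σ p)) (mfderiv_comp_extChartAt_symm hz h_diff v)
    _ = σ p (mfderiv (I.prod 𝓘(ℝ, K)) I (TotalSpace.proj : TotalSpace K Z → M) p
          (ofModel (I.prod 𝓘(ℝ, K)) p₀ p v)) :=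
        canonicalOneForm_comp_mfderiv_toCotangent h_diff _
    _ = σ p (ofModel I p₀.1 p.1 v.1) := congrArg (σ p) (mfderiv_proj_ofModel h_source v)

theorem pullbackSymplecticForm_ofModel
    (hσ : ContMDiff (I.prod 𝓘(ℝ, K)) (I.prod 𝓘(ℝ, E →L[ℝ] ℝ)) ∞ (toCotangent σ)) {z : E × K}
    (hz : z ∈ (extChartAt (I.prod 𝓘(ℝ, K)) p₀).target) (v w : E × K) :
    pullbackSymplecticForm σ ((extChartAt (I.prod 𝓘(ℝ, K)) p₀).symm z)
        (ofModel (I.prod 𝓘(ℝ, K)) p₀ ((extChartAt (I.prod 𝓘(ℝ, K)) p₀).symm z) v)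
        (ofModel (I.prod 𝓘(ℝ, K)) p₀ ((extChartAt (I.prod 𝓘(ℝ, K)) p₀).symm z) w) =
      vecD1 (tautologicalFormInChart σ p₀) z v w := by
  let ψ := (extChartAt (I.prod 𝓘(ℝ, K)) p₀).symm
  have h_nhds := (isOpen_extChartAt_target (I := I.prod 𝓘(ℝ, K)) p₀).mem_nhds hz
  have hψ : ContMDiffAt 𝓘(ℝ, E × K) (I.prod 𝓘(ℝ, K)) ∞ ψ z :=
    (contMDiffOn_extChartAt_symm p₀).contMDiffAt h_nhds
  have h_push := mfderiv_comp_extChartAt_symm hz ((hσ (ψ z)).mdifferentiableAt (by simp))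
  let B : E × (E →L[ℝ] ℝ) →ₗ[ℝ] (E × (E →L[ℝ] ℝ) →L[ℝ] ℝ) :=
    canonicalSymplecticForm I (toCotangent σ (ψ z))
  refine (congrArg₂ (fun X Y => B X Y) (h_push v) (h_push w)).symm.trans ?_
  refine (d1_comp (I := I.prod 𝓘(ℝ, E →L[ℝ] ℝ)) (((hσ (ψ z)).comp z hψ).of_le ENat.LEInfty.out)
    (differentiableAt_canonicalOneForm _) v w).trans ?_
  let α (y : E × K) : E × K →L[ℝ] ℝ := (canonicalOneForm I ((toCotangent σ ∘ ψ) y)).comp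
    (mfderiv 𝓘(ℝ, E × K) (I.prod 𝓘(ℝ, E →L[ℝ] ℝ)) (toCotangent σ ∘ ψ) y)
  have h_eq : α =ᶠ[𝓝 z] tautologicalFormInChart σ p₀ := Filter.eventually_of_mem h_nhds
    fun y hy => canonicalOneForm_comp_mfderiv_toCotangent_chart hσ hy
  have h_vecD1 : vecD1 α z = vecD1 (tautologicalFormInChart σ p₀) z := by
    rw [vecD1, vecD1, h_eq.fderiv_eq]
  exact congrArg (fun B => B v w) h_vecD1

theorem gaugedFrame_eq_pairToModel
    (hσ : ContMDiff (I.prod 𝓘(ℝ, K)) (I.prod 𝓘(ℝ, E →L[ℝ] ℝ)) ∞ (toCotangent σ))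
    {R : Type*} [NormedAddCommGroup R] [NormedSpace ℝ R] {a : R →L[ℝ] E × (E →L[ℝ] ℝ)}
    {p : TotalSpace K Z} (hp : p ∈ (chartAt (ModelProd H K) p₀).source) {c : R}
    {X : TangentSpace (I.prod 𝓘(ℝ, K)) p} {ζ : Cotangent I p.1}
    (h : a c = pairToModel I p₀.1 p.1
      (mfderiv (I.prod 𝓘(ℝ, K)) I (TotalSpace.proj : TotalSpace K Z → M) p X, ζ)) :
    gaugedFrame a (vecD1 (tautologicalFormInChart σ p₀) (extChartAt (I.prod 𝓘(ℝ, K)) p₀ p))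
        (c, (toModel (I.prod 𝓘(ℝ, K)) p₀ p X).2) =
      pairToModel (I.prod 𝓘(ℝ, K)) p₀ p
        (X, ζ.comp (mfderiv (I.prod 𝓘(ℝ, K)) I (TotalSpace.proj : TotalSpace K Z → M) p) +
          pullbackSymplecticForm σ p X) := by
  have h_vec : ((a c).1, (toModel (I.prod 𝓘(ℝ, K)) p₀ p X).2) = toModel (I.prod 𝓘(ℝ, K)) p₀ p X :=
    Prod.ext ((congrArg Prod.fst h).trans (toModel_mfderiv_proj hp X)) rfl
  rw [gaugedFrame_apply]
  simp only [h_vec]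
  refine Prod.ext rfl (ContinuousLinearMap.ext fun v => ?_)
  have h_form := pullbackSymplecticForm_ofModel hσ
    ((extChartAt (I.prod 𝓘(ℝ, K)) p₀).map_source (by simpa using hp))
    (toModel (I.prod 𝓘(ℝ, K)) p₀ p X) v
  rw [(extChartAt (I.prod 𝓘(ℝ, K)) p₀).left_inv (by simpa using hp), ofModel_toModel hp] at h_form
  have h_cov : (a c).2 v.1 = ζ (ofModel I p₀.1 p.1 v.1) :=
    congrArg (fun η : E × (E →L[ℝ] ℝ) => η.2 v.1) h
  exact congrArg₂ (· + ·) (h_cov.trans (congrArg ζ (mfderiv_proj_ofModel hp v)).symm) h_form.symm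

theorem mem_gaugedPullback_iff_exists_gaugedFrame
    (hσ : ContMDiff (I.prod 𝓘(ℝ, K)) (I.prod 𝓘(ℝ, E →L[ℝ] ℝ)) ∞ (toCotangent σ))
    {R : Type*} [NormedAddCommGroup R] [NormedSpace ℝ R] {a : R →L[ℝ] E × (E →L[ℝ] ℝ)}
    {p : TotalSpace K Z} (hp : p ∈ (chartAt (ModelProd H K) p₀).source)
    (ha : ∀ q, q ∈ D p.1 ↔ ∃ c, a c = pairToModel I p₀.1 p.1 q)
    (q : TangentSpace (I.prod 𝓘(ℝ, K)) p × Cotangent (I.prod 𝓘(ℝ, K)) p) :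
    q ∈ gaugedPullback D σ p ↔ ∃ c,
      gaugedFrame a (vecD1 (tautologicalFormInChart σ p₀) (extChartAt (I.prod 𝓘(ℝ, K)) p₀ p)) c =
        pairToModel (I.prod 𝓘(ℝ, K)) p₀ p q := by
  rw [mem_gaugedPullback_iff]
  constructor
  · rintro ⟨ζ, hζ, hq⟩
    obtain ⟨c, hc⟩ := (ha _).1 hζ
    exact ⟨_, (gaugedFrame_eq_pairToModel hσ hp hc).trans (by rw [← hq])⟩
  · rintro ⟨⟨c, w⟩, hc⟩
    let ζ : TangentSpace I p.1 →L[ℝ] ℝ := (a c).2.comp (toModel I p₀.1 p.1)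
    have h_vec : ((a c).1, w) = toModel (I.prod 𝓘(ℝ, K)) p₀ p q.1 := congrArg Prod.fst hc
    have h_frame : a c = pairToModel I p₀.1 p.1
        (mfderiv (I.prod 𝓘(ℝ, K)) I (TotalSpace.proj : TotalSpace K Z → M) p q.1, ζ) :=
      Prod.ext ((congrArg Prod.fst h_vec).trans (toModel_mfderiv_proj hp q.1).symm)
        (covectorToModel_comp_toModel (mem_chart_source_totalSpace.1 hp).2 _).symm
    have h_gauged := gaugedFrame_eq_pairToModel hσ hp h_frame
    rw [← congrArg Prod.snd h_vec] at h_gauged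
    exact ⟨ζ, (ha _).2 ⟨c, h_frame⟩,
      congrArg Prod.snd (pairToModel_injective hp (hc.symm.trans h_gauged))⟩

theorem IsCourantFrameAt.gaugedPullback [FiniteDimensional ℝ K] {R : Type*}
    [NormedAddCommGroup R] [NormedSpace ℝ R] [FiniteDimensional ℝ R]
    {G : E → R →L[ℝ] E × (E →L[ℝ] ℝ)} (hG : IsCourantFrameAt D p₀.1 G)
    (hσ : ContMDiff (I.prod 𝓘(ℝ, K)) (I.prod 𝓘(ℝ, E →L[ℝ] ℝ)) ∞ (toCotangent σ)) :
    IsCourantFrameAt (gaugedPullback D σ) p₀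
      (fun z => gaugedFrame (G z.1) (vecD1 (tautologicalFormInChart σ p₀) z)) := by
  have h_point : (extChartAt (I.prod 𝓘(ℝ, K)) p₀ p₀).1 = extChartAt I p₀.1 p₀.1 :=
    congrArg Prod.fst (extChartAt_totalSpace (FiberBundle.mem_baseSet_trivializationAt' p₀.1))
  have h_smooth : ContDiffAt ℝ ∞ G (extChartAt (I.prod 𝓘(ℝ, K)) p₀ p₀).1 :=
    h_point ▸ hG.contDiffAt
  have h_form := contDiffAt_tautologicalFormInChart (p₀ := p₀) hσ
  have h_fst : Filter.Tendsto Prod.fst (𝓝 (extChartAt (I.prod 𝓘(ℝ, K)) p₀ p₀))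
      (𝓝 (extChartAt I p₀.1 p₀.1)) := h_point ▸ continuousAt_fst
  refine ⟨contDiffAt_gaugedFrame h_smooth (contDiffAt_vecD1 h_form (by simp)),
    gaugedFrame_injective (h_point ▸ hG.injective) _, ?_, fun a b c => ?_⟩
  · filter_upwards [h_fst.eventually hG.mem_iff,
      eventually_extChartAt_symm_mem_source (I := I.prod 𝓘(ℝ, K)) p₀] with z hz ⟨h_source, h_right⟩
    have h_base := extChartAt_symm_fst_extChartAt (I := I) h_source
    rw [h_right] at h_base
    rw [h_base] at hz
    simpa only [h_right] using mem_gaugedPullback_iff_exists_gaugedFrame hσ h_source hz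
  · rw [courantTensor_gaugedFrame h_smooth h_form, h_point]
    exact hG.courantTensor_eq_zero _ _ _

end GaugedPullback

section Splitting

variable {E : Type*} [NormedAddCommGroup E] [NormedSpace ℝ E]
  {H : Type*} [TopologicalSpace H] {I : ModelWithCorners ℝ E H}
  {M : Type*} [TopologicalSpace M] [ChartedSpace H M] [IsManifold I ∞ M]
  {V : Π x : M, Submodule ℝ (TangentSpace I x)}

theorem IsSmoothDistribution.exists_frame (hV : IsSmoothDistribution I V) (x₀ : M) :
    ∃ U : Set M, IsOpen U ∧ x₀ ∈ U ∧ U ⊆ (chartAt H x₀).source ∧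
      ∃ (r : ℕ) (W : M → (Fin r → ℝ) →L[ℝ] E), ContMDiffOn I 𝓘(ℝ, (Fin r → ℝ) →L[ℝ] E) ∞ W U ∧
        ∀ x ∈ U, Function.Injective (W x) ∧ ∀ v, v ∈ V x ↔ ∃ c, W x c = toModel I x₀ x v := by
  obtain ⟨U₁, hU₁, hx₁, r, X, hX, hXV⟩ := hV x₀
  let U := U₁ ∩ (chartAt H x₀).source
  have hU : IsOpen U := hU₁.inter (chartAt H x₀).open_source
  have hUs : U ⊆ (chartAt H x₀).source := inter_subset_right
  let W : M → (Fin r → ℝ) →L[ℝ] E := fun x => frameCLM fun i => toModel I x₀ x (X i x)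
  have hW : ContMDiffOn I 𝓘(ℝ, (Fin r → ℝ) →L[ℝ] E) ∞ W U := by
    refine (contDiff_frameCLM (S := E)).contMDiff.comp_contMDiffOn ?_
    rw [contMDiffOn_pi_space]
    exact fun i => (smoothVectorFieldOn_iff hU hUs).1 ((hX i).mono inter_subset_left)
  have hW_apply (x : M) (c : Fin r → ℝ) : W x c = toModel I x₀ x (∑ i, c i • X i x) := by
    rw [map_sum]
    simp only [map_smul]
    rfl
  refine ⟨U, hU, ⟨hx₁, mem_chart_source H x₀⟩, hUs, r, W, hW, fun x hx => ?_⟩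
  simp only [hW_apply, (toModel_injective (hUs hx)).eq_iff]
  obtain ⟨h_indep, h_span⟩ := hXV x hx.1
  refine ⟨fun c d hcd => ?_, fun v => ?_⟩
  · rw [hW_apply, hW_apply] at hcd
    exact h_indep.fintypeLinearCombination_injective (toModel_injective (hUs hx) hcd)
  · rw [h_span, Submodule.mem_span_range_iff_exists_fun]

variable [FiniteDimensional ℝ E] {L : DiracStructure I M}

theorem CharFrame.exists_leftInverse_vanishing {N : Type*} [NormedAddCommGroup N]
    [NormedSpace ℝ N] [FiniteDimensional ℝ N] {x₀ : M} (f : CharFrame L N x₀)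
    (hV : L.IsSmoothComplement V) :
    ∃ U ⊆ f.U, IsOpen U ∧ x₀ ∈ U ∧ ∃ Ψ : M → E →L[ℝ] N, ContMDiffOn I 𝓘(ℝ, E →L[ℝ] N) ∞ Ψ U ∧
      ∀ x ∈ U, (∀ c, Ψ x (f.Y x c) = c) ∧ ∀ v ∈ V x, Ψ x (toModel I x₀ x v) = 0 := by
  obtain ⟨U₁, hU₁, hx₁, -, r, W, hW, hWV⟩ := hV.smooth.exists_frame x₀
  let A : M → N × (Fin r → ℝ) →L[ℝ] E := fun x => (f.Y x).coprod (W x)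
  have hA : ContMDiffOn I 𝓘(ℝ, N × (Fin r → ℝ) →L[ℝ] E) ∞ A (f.U ∩ U₁) := by
    simp only [A, ← ContinuousLinearMap.comp_fst_add_comp_snd]
    exact ((f.smooth_Y.mono inter_subset_left).clm_comp contMDiffOn_const).add
      ((hW.mono inter_subset_right).clm_comp contMDiffOn_const)
  have hA_inj : Function.Injective (A x₀) := by
    refine (injective_iff_map_eq_zero (A x₀)).2 fun ⟨c, d⟩ h => ?_
    have h_char := f.ofModel_Y_mem f.mem c
    have h_neg : W x₀ (-d) = toModel I x₀ x₀ (ofModel I x₀ x₀ (f.Y x₀ c)) := by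
      rw [toModel_ofModel (f.subset f.mem), map_neg]
      exact (eq_neg_of_add_eq_zero_left h).symm
    have h_zero := Submodule.disjoint_def.1 (hV.isCompl x₀).disjoint _ h_char
      (((hWV x₀ hx₁).2 _).2 ⟨-d, h_neg⟩)
    have hYc : f.Y x₀ c = 0 := (toModel_ofModel (f.subset f.mem) _).symm.trans
      ((congrArg (toModel I x₀ x₀) h_zero).trans (map_zero _))
    have hc : c = 0 := (f.leftInv x₀ f.mem c).symm.trans (by rw [hYc, map_zero])
    have hWd : W x₀ d = 0 := by
      have h_sum : f.Y x₀ c + W x₀ d = 0 := h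
      rwa [hYc, zero_add] at h_sum
    exact Prod.ext hc ((hWV x₀ hx₁).1 (hWd.trans (map_zero _).symm))
  obtain ⟨U, hUU, hU, hx₀, Θ, hΘ, hΘA⟩ := exists_smooth_leftInverse
    (f.isOpen.inter hU₁) ⟨f.mem, hx₁⟩ hA hA_inj
  refine ⟨U, fun x hx => (hUU hx).1, hU, hx₀,
    fun x => ContinuousLinearMap.fst ℝ N (Fin r → ℝ) ∘L Θ x, contMDiffOn_const.clm_comp hΘ,
    fun x hx => ⟨fun c => ?_, fun v hv => ?_⟩⟩
  · simpa [A] using congrArg Prod.fst (hΘA x hx (c, 0))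
  · obtain ⟨d, hd⟩ := ((hWV x (hUU hx).2).2 v).1 hv
    rw [← hd]
    simpa [A] using congrArg Prod.fst (hΘA x hx (0, d))

variable {k : ℕ}

/-- The covector of `splittingMap` at a point of `(L ∩ TM)*`. -/
def splittingCovector (k : ℕ) (hV : L.IsSmoothComplement V) (p : L.CharDualTotal k) :
    Cotangent I p.1 :=
  (DiracStructure.splittingMap k hV p).2

theorem splittingCovector_add (hV : L.IsSmoothComplement V) {x : M} {v w : TangentSpace I x}
    (hv : v ∈ L.char x) (hw : w ∈ V x) (e : L.CharDual x) :
    splittingCovector k hV ⟨x, e⟩ (v + w) = e ⟨v, hv⟩ := by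
  have h_left : (L.char x).projectionOnto (V x) (hV.isCompl x) v = ⟨v, hv⟩ :=
    Submodule.projectionOnto_apply_left (hV.isCompl x) ⟨v, hv⟩
  have h_right : (L.char x).projectionOnto (V x) (hV.isCompl x) w = 0 :=
    Submodule.projectionOnto_apply_right (hV.isCompl x) ⟨w, hw⟩
  refine congrArg e (?_ : (L.char x).projectionOnto (V x) (hV.isCompl x) (v + w) = ⟨v, hv⟩)
  rw [map_add, h_left, h_right, add_zero]

variable [L.CharDualBundle k] {f : ∀ x₀, CharFrame L (EuclideanSpace ℝ (Fin k)) x₀}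

theorem covectorToModel_splittingCovector (hV : L.IsSmoothComplement V) (hf : IsFrameFamily f)
    {x₀ x : M} (hx : x ∈ (f x₀).U) {Ψ : E →L[ℝ] EuclideanSpace ℝ (Fin k)}
    (hΨY : ∀ c, Ψ ((f x₀).Y x c) = c) (hΨV : ∀ v ∈ V x, Ψ (toModel I x₀ x v) = 0)
    (e : L.CharDual x) :
    covectorToModel I x₀ x (splittingCovector k hV ⟨x, e⟩) =
      (dualModel (EuclideanSpace ℝ (Fin k))).symm
        ((trivializationAt (EuclideanSpace ℝ (Fin k)) L.CharDual x₀ ⟨x, e⟩).2) ∘L Ψ := by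
  rw [(hf x₀).2 x e, CharFrame.dualCoord_apply, ContinuousLinearEquiv.symm_apply_apply]
  refine ContinuousLinearMap.ext fun u => ?_
  obtain ⟨v, w, hv, hw, h_sum⟩ := Submodule.codisjoint_iff_exists_add_eq.1
    (hV.isCompl x).codisjoint (ofModel I x₀ x u)
  obtain ⟨c, hc⟩ := ((f x₀).mem_iff x hx v).1 hv
  have h_toChar : (f x₀).toChar x c = ⟨v, hv⟩ := Subtype.ext <| by
    rw [(f x₀).coe_toChar hx, hc, ofModel_toModel ((f x₀).subset hx)]
  have h_coord : Ψ u = c := by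
    rw [← toModel_ofModel (I := I) ((f x₀).subset hx) u, ← h_sum, map_add, map_add, ← hc, hΨY,
      hΨV w hw, add_zero]
  calc splittingCovector k hV ⟨x, e⟩ (ofModel I x₀ x u) = e ⟨v, hv⟩ := by
        rw [← h_sum, splittingCovector_add hV hv hw]
    _ = e ((f x₀).toChar x (Ψ u)) := by rw [h_coord, h_toChar]

theorem contMDiff_toCotangent_splittingCovector (hV : L.IsSmoothComplement V)
    (hf : IsFrameFamily f) :
    ContMDiff (I.prod 𝓘(ℝ, EuclideanSpace ℝ (Fin k))) (I.prod 𝓘(ℝ, E →L[ℝ] ℝ)) ∞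
      (toCotangent (splittingCovector k hV)) := by
  intro p
  obtain ⟨U, hUf, hU, hp, Ψ, hΨ, hΨL⟩ := (f p.1).exists_leftInverse_vanishing hV
  have h_proj : ContMDiffAt (I.prod 𝓘(ℝ, EuclideanSpace ℝ (Fin k))) I ∞
    (fun q : L.CharDualTotal k => q.1) p := contMDiffAt_proj _
  have h_coord := ((contMDiffAt_totalSpace (IM := I.prod 𝓘(ℝ, EuclideanSpace ℝ (Fin k))) (IB := I)
    (n := ∞) (f := fun q : L.CharDualTotal k => q) (x₀ := p)).1 contMDiffAt_id).2
  refine contMDiffAt_totalSpace.2 ⟨h_proj, ContMDiffAt.congr_of_eventuallyEq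
    (((dualModel (EuclideanSpace ℝ (Fin k))).symm.contDiff (n := ∞) |>.contMDiff.contMDiffAt.comp p
      h_coord).clm_comp ((hΨ.contMDiffAt (hU.mem_nhds hp)).comp p h_proj)) ?_⟩
  filter_upwards [h_proj.continuousAt.eventually (hU.mem_nhds hp)] with q hq
  exact (trivializationAt_cotangent ((f p.1).subset (hUf hq)) _).trans
    (covectorToModel_splittingCovector hV hf (hUf hq) (hΨL q.1 hq).1 (hΨL q.1 hq).2 q.2)

end Splitting

/-! ### The gauged pullback along the zero section -/

section HomogeneousMaps

variable {E : Type*} [NormedAddCommGroup E] [NormedSpace ℝ E]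
  {K : Type*} [NormedAddCommGroup K] [NormedSpace ℝ K]
  {W : Type*} [NormedAddCommGroup W] [NormedSpace ℝ W]

theorem fderiv_zero_of_forall_smul {g : K → W} (hg : DifferentiableAt ℝ g 0)
    (h_smul : ∀ (c : ℝ) e, g (c • e) = c • g e) (e : K) : fderiv ℝ g 0 e = g e := by
  rw [← hg.lineDeriv_eq_fderiv, lineDeriv]
  simp only [zero_add, h_smul]
  rw [deriv_smul_const differentiableAt_fun_id, deriv_id'', one_smul]

theorem fderiv_prod_zero_of_eventually_forall_smul {θ : E × K → W} {u₀ : E}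
    (hθ : DifferentiableAt ℝ θ (u₀, 0))
    (h_smul : ∀ᶠ u in 𝓝 u₀, ∀ (c : ℝ) e, θ (u, c • e) = c • θ (u, e)) (v : E) (e : K) :
    fderiv ℝ θ (u₀, 0) (v, e) = θ (u₀, e) := by
  have h_zero : (fun u => θ (u, 0)) =ᶠ[𝓝 u₀] fun _ => 0 := by
    filter_upwards [h_smul] with u hu
    simpa using hu 0 0
  have h_left : fderiv ℝ θ (u₀, 0) (v, 0) = 0 := by
    have h_comp := HasFDerivAt.comp (g := θ) u₀ hθ.hasFDerivAt
      (hasFDerivAt_prodMk_left (𝕜 := ℝ) u₀ (0 : K))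
    exact congrArg (fun A => A v) (h_comp.unique ((hasFDerivAt_const 0 u₀).congr_of_eventuallyEq
      h_zero))
  have h_right : fderiv ℝ θ (u₀, 0) (0, e) = θ (u₀, e) := by
    have h_comp := HasFDerivAt.comp (g := θ) (0 : K) hθ.hasFDerivAt
      (hasFDerivAt_prodMk_right u₀ (0 : K))
    exact (congrArg (fun A => A e) h_comp.fderiv).symm.trans
      (fderiv_zero_of_forall_smul h_comp.differentiableAt h_smul.self_of_nhds e)
  rw [← Prod.fst_add_snd (v, e), map_add, h_left, h_right, zero_add]

end HomogeneousMaps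

section ZeroSection

variable {E : Type*} [NormedAddCommGroup E] [NormedSpace ℝ E]
  {H : Type*} [TopologicalSpace H] {I : ModelWithCorners ℝ E H}
  {M : Type*} [TopologicalSpace M] [ChartedSpace H M]
  {K : Type*} [NormedAddCommGroup K] [NormedSpace ℝ K] {Z : M → Type*}
  [TopologicalSpace (TotalSpace K Z)] [∀ x, TopologicalSpace (Z x)] [FiberBundle K Z]
  [∀ x, AddCommMonoid (Z x)] [∀ x, Module ℝ (Z x)] [VectorBundle ℝ K Z]

theorem extChartAt_zeroSection {x₀ x : M} (hx : x ∈ (trivializationAt K Z x₀).baseSet) :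
    extChartAt (I.prod 𝓘(ℝ, K)) (zeroSection K Z x₀) (zeroSection K Z x) =
      (extChartAt I x₀ x, 0) :=
  (extChartAt_totalSpace hx).trans
    (Prod.ext rfl (congrArg (fun q : M × K => q.2) ((trivializationAt K Z x₀).zeroSection ℝ hx)))

theorem extChartAt_zeroSection_symm {x₀ : M} {u : E}
    (hu : (extChartAt I x₀).symm u ∈ (trivializationAt K Z x₀).baseSet) (e : K) :
    (extChartAt (I.prod 𝓘(ℝ, K)) (zeroSection K Z x₀)).symm (u, e) =
      ⟨(extChartAt I x₀).symm u,
        (trivializationAt K Z x₀).symmL ℝ ((extChartAt I x₀).symm u) e⟩ := by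
  rw [FiberBundle.extChartAt, Trivialization.symmL_apply _ hu]
  exact ((trivializationAt K Z x₀).mk_symm hu e).symm

variable [IsManifold I ∞ M]

theorem tautologicalFormInChart_smul {σ : Π p : TotalSpace K Z, Cotangent I p.1}
    (h_smul : ∀ x (c : ℝ) (e : Z x), σ ⟨x, c • e⟩ = c • σ ⟨x, e⟩) {x : M} {u : E}
    (hu : (extChartAt I x).symm u ∈ (trivializationAt K Z x).baseSet) (c : ℝ) (e : K) :
    tautologicalFormInChart σ (zeroSection K Z x) (u, c • e) =
      c • tautologicalFormInChart σ (zeroSection K Z x) (u, e) := by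
  simp only [tautologicalFormInChart]
  rw [extChartAt_zeroSection_symm hu, extChartAt_zeroSection_symm hu, map_smul, h_smul]
  rfl

variable [ContMDiffVectorBundle ∞ K Z I]

variable (I K Z) in
/-- The differential of the zero section of the vector bundle `Z`. -/
def dZero (x : M) : TangentSpace I x →L[ℝ] TangentSpace (I.prod 𝓘(ℝ, K)) (zeroSection K Z x) :=
  mfderiv I (I.prod 𝓘(ℝ, K)) (zeroSection K Z) x

variable (I K Z) in
/-- The component in `TₓM` of a tangent vector of the vector bundle `Z` at `0 ∈ Zₓ`. -/
def horizontalPart (x : M) :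
    TangentSpace (I.prod 𝓘(ℝ, K)) (zeroSection K Z x) →L[ℝ] TangentSpace I x :=
  mfderiv (I.prod 𝓘(ℝ, K)) I (TotalSpace.proj : TotalSpace K Z → M) (zeroSection K Z x)

variable (I K Z) in
/-- The component in `Zₓ` of a tangent vector of the vector bundle `Z` at `0 ∈ Zₓ`. -/
def verticalPart (x : M) : TangentSpace (I.prod 𝓘(ℝ, K)) (zeroSection K Z x) →L[ℝ] Z x :=
  (trivializationAt K Z x).symmL ℝ x ∘L ContinuousLinearMap.snd ℝ E K ∘L
    toModel (I.prod 𝓘(ℝ, K)) (zeroSection K Z x) (zeroSection K Z x)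

theorem toModel_dZero (x : M) (v : TangentSpace I x) :
    toModel (I.prod 𝓘(ℝ, K)) (zeroSection K Z x) (zeroSection K Z x) (dZero I K Z x v) =
      (toModel I x x v, 0) := by
  have h_chart : extChartAt (I.prod 𝓘(ℝ, K)) (zeroSection K Z x) ∘ zeroSection K Z =ᶠ[𝓝 x]
      ContinuousLinearMap.inl ℝ E K ∘ extChartAt I x := by
    filter_upwards [(trivializationAt K Z x).open_baseSet.mem_nhds
      (FiberBundle.mem_baseSet_trivializationAt' x)] with y hy
    exact extChartAt_zeroSection hy
  have h_deriv := h_chart.mfderiv_eq (I := I) (I' := 𝓘(ℝ, E × K))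
  rw [mfderiv_comp x (mdifferentiableAt_extChartAt
      (I := I.prod 𝓘(ℝ, K)) (mem_chart_source _ (zeroSection K Z x)))
      ((contMDiff_zeroSection ℝ Z x (n := ∞)).mdifferentiableAt (by simp)),
    mfderiv_comp (I'' := 𝓘(ℝ, E × K)) x
      ((ContinuousLinearMap.inl ℝ E K).differentiableAt.mdifferentiableAt)
      (mdifferentiableAt_extChartAt (I := I) (mem_chart_source H x))] at h_deriv
  rw [toModel_eq_mfderiv (mem_chart_source _ (zeroSection K Z x)),
    toModel_eq_mfderiv (mem_chart_source H x)]
  refine (congrArg (fun A : E →L[ℝ] E × K => A v) h_deriv).trans ?_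
  rw [mfderiv_eq_fderiv, (ContinuousLinearMap.inl ℝ E K).fderiv]
  rfl

theorem toModel_horizontalPart (x : M) (X : TangentSpace (I.prod 𝓘(ℝ, K)) (zeroSection K Z x)) :
    toModel I x x (horizontalPart I K Z x X) =
      (toModel (I.prod 𝓘(ℝ, K)) (zeroSection K Z x) (zeroSection K Z x) X).1 :=
  toModel_mfderiv_proj (mem_chart_source _ (zeroSection K Z x)) X

theorem horizontalPart_dZero (x : M) (v : TangentSpace I x) :
    horizontalPart I K Z x (dZero I K Z x v) = v :=
  toModel_injective (mem_chart_source H x) <|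
    (toModel_horizontalPart x _).trans (congrArg Prod.fst (toModel_dZero x v))

theorem verticalPart_dZero (x : M) (v : TangentSpace I x) :
    verticalPart I K Z x (dZero I K Z x v) = 0 :=
  (congrArg (fun w : E × K => (trivializationAt K Z x).symmL ℝ x w.2) (toModel_dZero x v)).trans
    (map_zero _)

theorem eq_dZero_of_verticalPart_eq_zero {x : M}
    {X : TangentSpace (I.prod 𝓘(ℝ, K)) (zeroSection K Z x)} (hX : verticalPart I K Z x X = 0) :
    X = dZero I K Z x (horizontalPart I K Z x X) := by
  refine toModel_injective (mem_chart_source _ _) <|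
    Eq.trans (Prod.ext (toModel_horizontalPart x X).symm ?_) (toModel_dZero x _).symm
  have h_base := FiberBundle.mem_baseSet_trivializationAt' (F := K) (E := Z) x
  exact ((trivializationAt K Z x).continuousLinearMapAt_symmL (R := ℝ) h_base _).symm.trans
    ((congrArg ((trivializationAt K Z x).continuousLinearMapAt ℝ x) hX).trans (map_zero _))

theorem verticalPart_surjective (x : M) : Function.Surjective (verticalPart I K Z x) := by
  intro e
  let w : E × K := (0, (trivializationAt K Z x).continuousLinearMapAt ℝ x e)
  refine ⟨ofModel (I.prod 𝓘(ℝ, K)) (zeroSection K Z x) (zeroSection K Z x) w, ?_⟩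
  exact (congrArg (fun w : E × K => (trivializationAt K Z x).symmL ℝ x w.2)
    (toModel_ofModel (I := I.prod 𝓘(ℝ, K)) (mem_chart_source _ (zeroSection K Z x)) w)).trans
    ((trivializationAt K Z x).symmL_continuousLinearMapAt
      (FiberBundle.mem_baseSet_trivializationAt' x) e)

section SymplecticForm

variable {σ : Π p : TotalSpace K Z, Cotangent I p.1}

theorem tautologicalFormInChart_toModel (x : M)
    (X Y : TangentSpace (I.prod 𝓘(ℝ, K)) (zeroSection K Z x)) :
    tautologicalFormInChart σ (zeroSection K Z x) (extChartAt I x x,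
        (toModel (I.prod 𝓘(ℝ, K)) (zeroSection K Z x) (zeroSection K Z x) X).2)
        (toModel (I.prod 𝓘(ℝ, K)) (zeroSection K Z x) (zeroSection K Z x) Y) =
      σ ⟨x, verticalPart I K Z x X⟩ (horizontalPart I K Z x Y) := by
  have h_base := FiberBundle.mem_baseSet_trivializationAt' (F := K) (E := Z) x
  simp only [tautologicalFormInChart]
  rw [extChartAt_zeroSection_symm (by rwa [extChartAt_to_inv]), extChartAt_to_inv]
  refine congrArg (σ ⟨x, verticalPart I K Z x X⟩) ?_
  exact (congrArg (ofModel I x x) (toModel_horizontalPart x Y).symm).trans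
    (ofModel_toModel (mem_chart_source H x) _)

variable [I.Boundaryless]

theorem pullbackSymplecticForm_zeroSection
    (hσ : ContMDiff (I.prod 𝓘(ℝ, K)) (I.prod 𝓘(ℝ, E →L[ℝ] ℝ)) ∞ (toCotangent σ))
    (h_smul : ∀ x (c : ℝ) (e : Z x), σ ⟨x, c • e⟩ = c • σ ⟨x, e⟩) (x : M)
    (X Y : TangentSpace (I.prod 𝓘(ℝ, K)) (zeroSection K Z x)) :
    pullbackSymplecticForm σ (zeroSection K Z x) X Y =
      (σ ⟨x, verticalPart I K Z x X⟩ (horizontalPart I K Z x Y) -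
        σ ⟨x, verticalPart I K Z x Y⟩ (horizontalPart I K Z x X) : ℝ) := by
  have hp := mem_chart_source (ModelProd H K) (zeroSection K Z x)
  have h_base := FiberBundle.mem_baseSet_trivializationAt' (F := K) (E := Z) x
  have h_chart : extChartAt (I.prod 𝓘(ℝ, K)) (zeroSection K Z x) (zeroSection K Z x) =
      (extChartAt I x x, 0) := extChartAt_zeroSection h_base
  let T := toModel (I.prod 𝓘(ℝ, K)) (zeroSection K Z x) (zeroSection K Z x)
  have h_fderiv (v w : E × K) :
      fderiv ℝ (tautologicalFormInChart σ (zeroSection K Z x)) (extChartAt I x x, 0) v w =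
        tautologicalFormInChart σ (zeroSection K Z x) (extChartAt I x x, v.2) w := by
    refine congrArg (fun A : E × K →L[ℝ] ℝ => A w)
      (fderiv_prod_zero_of_eventually_forall_smul ?_ ?_ v.1 v.2)
    · exact h_chart ▸ (contDiffAt_tautologicalFormInChart hσ).differentiableAt (by simp)
    · filter_upwards [eventually_extChartAt_symm_mem
        ((trivializationAt K Z x).open_baseSet.mem_nhds h_base)] with u hu
      exact tautologicalFormInChart_smul h_smul hu
  have h_form := pullbackSymplecticForm_ofModel hσ
    (mem_extChartAt_target (I := I.prod 𝓘(ℝ, K)) (zeroSection K Z x)) (T X) (T Y)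
  rw [extChartAt_to_inv, ofModel_toModel hp, ofModel_toModel hp, h_chart, vecD1_apply, h_fderiv,
    h_fderiv] at h_form
  exact h_form.trans (congrArg₂ (· - ·) (tautologicalFormInChart_toModel x X Y)
    (tautologicalFormInChart_toModel x Y X))

end SymplecticForm

end ZeroSection

section CoisotropicZeroSection

theorem pullbackDirac_pullbackDirac {T T' T'' : Type*} [AddCommGroup T] [Module ℝ T]
    [TopologicalSpace T] [AddCommGroup T'] [Module ℝ T'] [TopologicalSpace T'] [AddCommGroup T'']
    [Module ℝ T''] [TopologicalSpace T''] (A : T →L[ℝ] T') (B : T' →L[ℝ] T'')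
    (G : Submodule ℝ (T'' × (T'' →L[ℝ] ℝ))) :
    pullbackDirac A (pullbackDirac B G) = pullbackDirac (B ∘L A) G := by
  ext ⟨v, ζ⟩
  constructor
  · rintro ⟨_, ⟨ξ, hξ, rfl⟩, hζ⟩
    exact ⟨ξ, hξ, hζ⟩
  · rintro ⟨ξ, hξ, hζ⟩
    exact ⟨ξ.comp B, ⟨ξ, hξ, rfl⟩, hζ⟩

variable {E : Type*} [NormedAddCommGroup E] [NormedSpace ℝ E]
  {H : Type*} [TopologicalSpace H] {I : ModelWithCorners ℝ E H}
  {M : Type*} [TopologicalSpace M] [ChartedSpace H M]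
  {K : Type*} {Z : M → Type*} [∀ x, AddCommMonoid (Z x)] [∀ x, Module ℝ (Z x)]

/-- The fibrewise homogeneous bundle map `σ` from `Z` to `T*M` induces at each point `x` a
nondegenerate pairing of `Zₓ` with the characteristic subspace `{v | (v, 0) ∈ D x}`. The form
`pullbackSymplecticForm σ` then turns `π^* D` into a graph along the zero section of `Z`. -/
structure IsCharPairing (D : Π x : M, Submodule ℝ (TangentSpace I x × Cotangent I x))
    (σ : Π p : TotalSpace K Z, Cotangent I p.1) : Prop where
  map_smul : ∀ x (c : ℝ) (e : Z x), σ ⟨x, c • e⟩ = c • σ ⟨x, e⟩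
  eq_zero_of_forall_char : ∀ x (e : Z x),
    (∀ v : TangentSpace I x, (v, 0) ∈ D x → σ ⟨x, e⟩ v = (0 : ℝ)) → e = 0
  eq_zero_of_forall_fibre : ∀ x (v : TangentSpace I x), (v, 0) ∈ D x →
    (∀ e : Z x, σ ⟨x, e⟩ v = (0 : ℝ)) → v = 0

variable {D : Π x : M, Submodule ℝ (TangentSpace I x × Cotangent I x)}
  {σ : Π p : TotalSpace K Z, Cotangent I p.1}

theorem IsCharPairing.map_zero (hσD : IsCharPairing D σ) (x : M) : σ ⟨x, 0⟩ = 0 := by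
  let σₓ (e : Z x) : Cotangent I x := σ ⟨x, e⟩
  exact (congrArg σₓ (zero_smul ℝ 0)).symm.trans ((hσD.map_smul x 0 0).trans (zero_smul ℝ _))

theorem IsCharPairing.eq_zero_of_add_eq_zero (hσD : IsCharPairing D σ)
    (hD : ∀ x, ∀ a ∈ D x, ∀ b ∈ D x, (a.2 b.1 + b.2 a.1 : ℝ) = 0) {x : M} {u : TangentSpace I x}
    {ζ : Cotangent I x} (hζ : (u, ζ) ∈ D x) {e : Z x} (h : ζ + σ ⟨x, e⟩ = 0) :
    e = 0 ∧ ζ = 0 := by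
  have he : e = 0 := hσD.eq_zero_of_forall_char x e fun v hv => by
    have h_iso : (ζ v + 0 : ℝ) = 0 := hD x _ hζ _ hv
    have h_sum : (ζ v + σ ⟨x, e⟩ v : ℝ) = 0 := congrArg (fun η : Cotangent I x => η v) h
    linarith
  rw [he, hσD.map_zero, add_zero] at h
  exact ⟨he, h⟩

variable [NormedAddCommGroup K] [NormedSpace ℝ K] [TopologicalSpace (TotalSpace K Z)]
  [∀ x, TopologicalSpace (Z x)] [FiberBundle K Z]
  [VectorBundle ℝ K Z] [IsManifold I ∞ M] [ContMDiffVectorBundle ∞ K Z I] [I.Boundaryless]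

theorem mem_gaugedPullback_zeroSection_iff
    (hσ : ContMDiff (I.prod 𝓘(ℝ, K)) (I.prod 𝓘(ℝ, E →L[ℝ] ℝ)) ∞ (toCotangent σ))
    (hσD : IsCharPairing D σ) {x : M} {X : TangentSpace (I.prod 𝓘(ℝ, K)) (zeroSection K Z x)}
    {η : Cotangent (I.prod 𝓘(ℝ, K)) (zeroSection K Z x)} :
    (X, η) ∈ gaugedPullback D σ (zeroSection K Z x) ↔
      (horizontalPart I K Z x X, η.comp (dZero I K Z x) - σ ⟨x, verticalPart I K Z x X⟩) ∈ D x ∧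
        ∀ Y, η Y = (η (dZero I K Z x (horizontalPart I K Z x Y)) -
          σ ⟨x, verticalPart I K Z x Y⟩ (horizontalPart I K Z x X) : ℝ) := by
  have h_form := pullbackSymplecticForm_zeroSection hσ hσD.map_smul x X
  refine (mem_gaugedPullback_iff _).trans ⟨?_, fun ⟨hX, hη⟩ => ⟨_, hX, ?_⟩⟩
  · rintro ⟨ζ, hζ, hη⟩
    have hη_apply (Y : TangentSpace (I.prod 𝓘(ℝ, K)) (zeroSection K Z x)) :
        η Y = (ζ (horizontalPart I K Z x Y) +
          (σ ⟨x, verticalPart I K Z x X⟩ (horizontalPart I K Z x Y) -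
            σ ⟨x, verticalPart I K Z x Y⟩ (horizontalPart I K Z x X)) : ℝ) :=
      (congrArg (fun A : E × K →L[ℝ] ℝ => A Y) hη).trans
        (congrArg (fun t : ℝ => (ζ (horizontalPart I K Z x Y) + t : ℝ)) (h_form Y))
    have hη_dZero (v : TangentSpace I x) :
        η (dZero I K Z x v) = (ζ v + σ ⟨x, verticalPart I K Z x X⟩ v : ℝ) := by
      refine (hη_apply _).trans ?_
      rw [horizontalPart_dZero, verticalPart_dZero, hσD.map_zero]
      exact congrArg _ (sub_zero _)
    have hζ_eq : η.comp (dZero I K Z x) - σ ⟨x, verticalPart I K Z x X⟩ = ζ :=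
      sub_eq_of_eq_add (ContinuousLinearMap.ext hη_dZero)
    refine ⟨hζ_eq ▸ hζ, fun Y => (hη_apply Y).trans ?_⟩
    rw [hη_dZero, add_sub_assoc]
  · refine ContinuousLinearMap.ext fun Y => (hη Y).trans ?_
    refine Eq.trans ?_ (congrArg (fun t : ℝ => (η (dZero I K Z x (horizontalPart I K Z x Y)) -
      σ ⟨x, verticalPart I K Z x X⟩ (horizontalPart I K Z x Y) + t : ℝ)) (h_form Y)).symm
    ring

variable (hσ : ContMDiff (I.prod 𝓘(ℝ, K)) (I.prod 𝓘(ℝ, E →L[ℝ] ℝ)) ∞ (toCotangent σ))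
  (hσD : IsCharPairing D σ)
  (hD : ∀ x, ∀ a ∈ D x, ∀ b ∈ D x, (a.2 b.1 + b.2 a.1 : ℝ) = 0)

include hσ hσD in
theorem pullbackDirac_dZero_gaugedPullback (x : M) :
    pullbackDirac (dZero I K Z x) (gaugedPullback D σ (zeroSection K Z x)) = D x := by
  have h_dZero {v : TangentSpace I x} {η : Cotangent (I.prod 𝓘(ℝ, K)) (zeroSection K Z x)}
      (h : (dZero I K Z x v, η) ∈ gaugedPullback D σ (zeroSection K Z x)) :
      (v, η.comp (dZero I K Z x)) ∈ D x := by
    have h_mem := ((mem_gaugedPullback_zeroSection_iff hσ hσD).1 h).1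
    rwa [horizontalPart_dZero, verticalPart_dZero, hσD.map_zero, sub_zero] at h_mem
  ext ⟨v, ζ⟩
  constructor
  · rintro ⟨η, hη, rfl : ζ = _⟩
    exact h_dZero hη
  · intro hζ
    let B : E × K →ₗ[ℝ] (E × K →L[ℝ] ℝ) := pullbackSymplecticForm σ (zeroSection K Z x)
    let ζ_hor : E × K →L[ℝ] ℝ := ζ.comp (horizontalPart I K Z x)
    let η : E × K →L[ℝ] ℝ := ζ_hor + B (dZero I K Z x v)
    have h_hor : (horizontalPart I K Z x (dZero I K Z x v), ζ) ∈ D x := by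
      rwa [horizontalPart_dZero]
    have hη : (dZero I K Z x v, η) ∈ gaugedPullback D σ (zeroSection K Z x) :=
      (mem_gaugedPullback_iff _).2 ⟨ζ, h_hor, rfl⟩
    refine ⟨η, hη, ContinuousLinearMap.ext fun w => ?_⟩
    have h_form : (B (dZero I K Z x v) (dZero I K Z x w) : ℝ) = 0 := by
      refine (pullbackSymplecticForm_zeroSection hσ hσD.map_smul x _ _).trans ?_
      rw [verticalPart_dZero, verticalPart_dZero, hσD.map_zero]
      exact sub_self _
    exact ((congrArg₂ (· + ·) (congrArg ζ (horizontalPart_dZero x w)) h_form).trans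
      (add_zero _)).symm

include hσ hσD hD

theorem verticalPart_eq_zero_of_mem_gaugedPullback {x : M}
    {X : TangentSpace (I.prod 𝓘(ℝ, K)) (zeroSection K Z x)}
    {η : Cotangent (I.prod 𝓘(ℝ, K)) (zeroSection K Z x)}
    (hX : (X, η) ∈ gaugedPullback D σ (zeroSection K Z x)) (hη : η.comp (dZero I K Z x) = 0) :
    verticalPart I K Z x X = 0 ∧ (horizontalPart I K Z x X, 0) ∈ D x := by
  have h_mem := ((mem_gaugedPullback_zeroSection_iff hσ hσD).1 hX).1
  obtain ⟨h_vert, h_cov⟩ := hσD.eq_zero_of_add_eq_zero hD h_mem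
    (e := verticalPart I K Z x X) (by rw [hη]; simp)
  exact ⟨h_vert, h_cov ▸ h_mem⟩

theorem isTransverse_gaugedPullback_zeroSection (x : M) :
    IsTransverse (gaugedPullback D σ (zeroSection K Z x)) := by
  intro X hX
  obtain ⟨h_vert, h_char⟩ :=
    verticalPart_eq_zero_of_mem_gaugedPullback hσ hσD hD hX (ContinuousLinearMap.zero_comp _)
  have h_hor : horizontalPart I K Z x X = 0 := by
    refine hσD.eq_zero_of_forall_fibre x _ h_char fun e => ?_
    obtain ⟨Y, rfl⟩ := verticalPart_surjective (I := I) (K := K) x e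
    have hY := ((mem_gaugedPullback_zeroSection_iff hσ hσD).1 hX).2 Y
    exact neg_eq_zero.1 ((zero_sub _).symm.trans hY.symm)
  rw [eq_dZero_of_verticalPart_eq_zero h_vert, h_hor, _root_.map_zero]

end CoisotropicZeroSection

section PoissonNeighbourhood

variable {E : Type*} [NormedAddCommGroup E] [NormedSpace ℝ E]
  {H : Type*} [TopologicalSpace H] {I : ModelWithCorners ℝ E H}
  {M : Type*} [TopologicalSpace M] [ChartedSpace H M] [IsManifold I ∞ M]
  {K : Type*} [NormedAddCommGroup K] [NormedSpace ℝ K] {Z : M → Type*}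
  [TopologicalSpace (TotalSpace K Z)] [∀ x, TopologicalSpace (Z x)] [FiberBundle K Z]
  [∀ x, AddCommMonoid (Z x)] [∀ x, Module ℝ (Z x)] [VectorBundle ℝ K Z]
  [ContMDiffVectorBundle ∞ K Z I]
  {U : Opens (TotalSpace K Z)} (h0 : ∀ x, zeroSection K Z x ∈ U)

include h0 in
theorem isImmersionOfComplement_zeroSection :
    Manifold.IsImmersionOfComplement K I (I.prod 𝓘(ℝ, K)) ∞
      (fun x => (⟨zeroSection K Z x, h0 x⟩ : U)) := by
  intro x
  have h_cont : Continuous fun x => (⟨zeroSection K Z x, h0 x⟩ : U) :=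
    (Trivialization.continuous_zeroSection ℝ).subtype_mk h0
  have h_base := (trivializationAt K Z x).open_baseSet
  let φ := (chartAt H x).restr (trivializationAt K Z x).baseSet
  have h_opens (p q : U) :
      extChartAt (I.prod 𝓘(ℝ, K)) p q = extChartAt (I.prod 𝓘(ℝ, K)) p.1 q.1 := rfl
  have h_chart {y : M} (hy : y ∈ (trivializationAt K Z x).baseSet) :
      extChartAt (I.prod 𝓘(ℝ, K)) (⟨zeroSection K Z x, h0 x⟩ : U) ⟨zeroSection K Z y, h0 y⟩ =
        (extChartAt I x y, 0) :=
    (h_opens _ _).trans (extChartAt_zeroSection hy)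
  refine .mk_of_continuousAt h_cont.continuousAt (ContinuousLinearEquiv.refl ℝ (E × K)) φ
    (chartAt (ModelProd H K) (⟨zeroSection K Z x, h0 x⟩ : U)) ?_ (mem_chart_source _ _)
    (restr_mem_maximalAtlas (contDiffGroupoid ∞ I) (IsManifold.chart_mem_maximalAtlas x) h_base)
    (IsManifold.chart_mem_maximalAtlas _) fun u hu => ?_
  · rw [OpenPartialHomeomorph.restr_source' _ _ h_base]
    exact ⟨mem_chart_source H x, FiberBundle.mem_baseSet_trivializationAt' x⟩
  · have h_source := (φ.extend I).map_target hu
    rw [OpenPartialHomeomorph.extend_source, OpenPartialHomeomorph.restr_source' _ _ h_base]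
      at h_source
    exact (h_chart h_source.2).trans
      (congrArg (fun v : E => (v, (0 : K))) ((φ.extend I).right_inv hu))

theorem isSmoothEmbedding_zeroSection :
    Manifold.IsSmoothEmbedding I (I.prod 𝓘(ℝ, K)) ∞
      (fun x => (⟨zeroSection K Z x, h0 x⟩ : U)) where
  isImmersion := (isImmersionOfComplement_zeroSection h0).isImmersion
  isEmbedding := .of_leftInverse (f := fun p : U => p.1.1) (fun _ => rfl)
    ((FiberBundle.continuous_proj K Z).comp continuous_subtype_val)
    ((Trivialization.continuous_zeroSection ℝ).subtype_mk h0)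

theorem mfderiv_val_comp_mfderiv_zeroSection (x : M) :
    (mfderiv (I.prod 𝓘(ℝ, K)) (I.prod 𝓘(ℝ, K)) (Subtype.val : U → TotalSpace K Z)
        ⟨zeroSection K Z x, h0 x⟩).comp
      (mfderiv I (I.prod 𝓘(ℝ, K)) (fun x => (⟨zeroSection K Z x, h0 x⟩ : U)) x) =
      dZero I K Z x :=
  (mfderiv_comp x ((contMDiff_subtype_val (n := ∞) _).mdifferentiableAt (by simp))
    (((isSmoothEmbedding_zeroSection h0).contMDiff x).mdifferentiableAt (by simp))).symm

variable [I.Boundaryless] {L : DiracStructure I M} {σ : Π p : TotalSpace K Z, Cotangent I p.1}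

theorem isCoisotropicEmbedding_zeroSection
    (hσ : ContMDiff (I.prod 𝓘(ℝ, K)) (I.prod 𝓘(ℝ, E →L[ℝ] ℝ)) ∞ (toCotangent σ))
    (hσL : IsCharPairing L.fiber σ) {S : PoissonStructure (I.prod 𝓘(ℝ, K)) U}
    (hS : ∀ p : U, S.graph p = pullbackDirac
      (mfderiv (I.prod 𝓘(ℝ, K)) (I.prod 𝓘(ℝ, K)) (Subtype.val : U → TotalSpace K Z) p)
      (gaugedPullback L.fiber σ p.1)) :
    L.IsCoisotropicEmbedding S (fun x => (⟨zeroSection K Z x, h0 x⟩ : U)) where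
  isSmoothEmbedding := isSmoothEmbedding_zeroSection h0
  coisotropic x ξ hξ := by
    have h_graph : (S.sharp _ ξ, ξ) ∈ S.graph ⟨zeroSection K Z x, h0 x⟩ := ⟨ξ, rfl⟩
    rw [hS] at h_graph
    obtain ⟨η, hη, h_ξ⟩ := h_graph
    have h_conormal : η.comp (dZero I K Z x) = 0 :=
      (congrArg η.comp (mfderiv_val_comp_mfderiv_zeroSection h0 x)).symm.trans
        ((congrArg (fun ζ : E × K →L[ℝ] ℝ => ζ.comp (mfderiv I (I.prod 𝓘(ℝ, K))
          (fun x => (⟨zeroSection K Z x, h0 x⟩ : U)) x)) h_ξ).symm.trans hξ)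
    have h_vert :=
      (verticalPart_eq_zero_of_mem_gaugedPullback hσ hσL L.isotropic hη h_conormal).1
    let v : E := horizontalPart I K Z x (mfderiv (I.prod 𝓘(ℝ, K)) (I.prod 𝓘(ℝ, K))
      (Subtype.val : U → TotalSpace K Z) ⟨zeroSection K Z x, h0 x⟩ (S.sharp _ ξ))
    have h_tangent := congrArg (fun A : E →L[ℝ] E × K => A v)
      (mfderiv_val_comp_mfderiv_zeroSection (I := I) h0 x)
    exact ⟨v, (mfderiv_val_bijective _).1
      (h_tangent.trans (eq_dZero_of_verticalPart_eq_zero h_vert).symm)⟩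
  pullback_eq x := by
    rw [hS]
    refine (pullbackDirac_pullbackDirac _ _ _).trans ?_
    rw [mfderiv_val_comp_mfderiv_zeroSection]
    exact pullbackDirac_dZero_gaugedPullback hσ hσL x

theorem exists_isCoisotropicEmbedding_zeroSection [FiniteDimensional ℝ E] [FiniteDimensional ℝ K]
    (hσ : ContMDiff (I.prod 𝓘(ℝ, K)) (I.prod 𝓘(ℝ, E →L[ℝ] ℝ)) ∞ (toCotangent σ))
    (hσL : IsCharPairing L.fiber σ) :
    ∃ (U : Opens (TotalSpace K Z)) (h0 : ∀ x, zeroSection K Z x ∈ U)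
      (S : PoissonStructure (I.prod 𝓘(ℝ, K)) U),
      (∀ p : U, S.graph p = pullbackDirac
        (mfderiv (I.prod 𝓘(ℝ, K)) (I.prod 𝓘(ℝ, K)) (Subtype.val : U → TotalSpace K Z) p)
        (gaugedPullback L.fiber σ p.1)) ∧
      L.IsCoisotropicEmbedding S (fun x => (⟨zeroSection K Z x, h0 x⟩ : U)) := by
  choose G hG using L.exists_isCourantFrameAt
  have h_frame (p₀ : TotalSpace K Z) := (hG p₀.1).gaugedPullback hσ
  have h_rank : Module.finrank ℝ ((Fin (Module.finrank ℝ E) → ℝ) × K) =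
      Module.finrank ℝ (E × K) := by simp
  let U : Opens (TotalSpace K Z) := ⟨_, isOpen_setOf_isTransverse h_frame h_rank⟩
  have h0 (x : M) : zeroSection K Z x ∈ U :=
    isTransverse_gaugedPullback_zeroSection hσ hσL L.isotropic x
  obtain ⟨S, hS⟩ := exists_poissonStructure_opens (U := U) h_frame h_rank
    (isotropic_gaugedPullback L.isotropic) fun _ hp => hp
  exact ⟨U, h0, S, hS, isCoisotropicEmbedding_zeroSection h0 hσ hσL hS⟩

end PoissonNeighbourhood

section Splitting

variable {E : Type*} [NormedAddCommGroup E] [NormedSpace ℝ E] [FiniteDimensional ℝ E]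
  {H : Type*} [TopologicalSpace H] {I : ModelWithCorners ℝ E H}
  {M : Type*} [TopologicalSpace M] [ChartedSpace H M] [IsManifold I ∞ M]
  {L : DiracStructure I M} {k : ℕ} {V : Π x : M, Submodule ℝ (TangentSpace I x)}

theorem isCharPairing_splittingCovector (hV : L.IsSmoothComplement V) :
    IsCharPairing L.fiber (splittingCovector k hV) where
  map_smul _ _ _ := rfl
  eq_zero_of_forall_char x e h := ContinuousLinearMap.ext fun v => by
    have h_apply := splittingCovector_add (k := k) hV v.2 (V x).zero_mem e
    rw [add_zero] at h_apply
    exact h_apply.symm.trans (h v v.2)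
  eq_zero_of_forall_fibre x v hv h := by
    by_contra h_ne
    let C : Submodule ℝ E := L.char x
    obtain ⟨e, he⟩ := SeparatingDual.exists_ne_zero (R := ℝ) (V := C) (x := ⟨v, hv⟩)
      fun h_zero => h_ne (congrArg Subtype.val h_zero)
    have h_apply := splittingCovector_add (k := k) hV hv (V x).zero_mem e
    rw [add_zero] at h_apply
    exact he (h_apply.symm.trans (h e))

theorem exists_isPoissonNeighbourhood [I.Boundaryless] [L.CharDualBundle k]
    {f : ∀ x₀, CharFrame L (EuclideanSpace ℝ (Fin k)) x₀} (hf : IsFrameFamily f)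
    (hV : L.IsSmoothComplement V) :
    ∃ U : Opens (L.CharDualTotal k), DiracStructure.IsPoissonNeighbourhood k hV U :=
  exists_isCoisotropicEmbedding_zeroSection (contMDiff_toCotangent_splittingCovector hV hf)
    (isCharPairing_splittingCovector hV)

end Splitting

/-! ### Embedding into a Poisson manifold -/

section BundleTopology

variable {B : Type*} [TopologicalSpace B] (F : Type*) [TopologicalSpace F] (Z : B → Type*)
  [∀ x, TopologicalSpace (Z x)] [TopologicalSpace (TotalSpace F Z)] [FiberBundle F Z]

theorem t2Space_totalSpace [T2Space B] [T2Space F] : T2Space (TotalSpace F Z) := by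
  refine ⟨fun p q h_ne => ?_⟩
  by_cases h_base : p.1 = q.1
  · let e := trivializationAt F Z p.1
    have hp : p ∈ e.source := FiberBundle.mem_trivializationAt_proj_source
    have hq : q ∈ e.source :=
      e.mem_source.2 (h_base ▸ FiberBundle.mem_baseSet_trivializationAt' p.1)
    obtain ⟨u, v, hu, hv, hpu, hqv, huv⟩ := t2_separation (e.injOn.ne hp hq h_ne)
    exact ⟨e.source ∩ e ⁻¹' u, e.source ∩ e ⁻¹' v,
      e.continuousOn_toFun.isOpen_inter_preimage e.open_source hu,
      e.continuousOn_toFun.isOpen_inter_preimage e.open_source hv, ⟨hp, hpu⟩, ⟨hq, hqv⟩,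
      (huv.preimage e).mono inter_subset_right inter_subset_right⟩
  · exact separated_by_continuous (FiberBundle.continuous_proj F Z) h_base

theorem secondCountableTopology_totalSpace [SecondCountableTopology B]
    [SecondCountableTopology F] : SecondCountableTopology (TotalSpace F Z) := by
  obtain ⟨s, hs, h_cover⟩ := TopologicalSpace.countable_cover_nhds fun x : B =>
    (trivializationAt F Z x).open_baseSet.mem_nhds (FiberBundle.mem_baseSet_trivializationAt' x)
  have := hs.to_subtype
  have (x : s) : SecondCountableTopology (trivializationAt F Z x.1).source :=
    (trivializationAt F Z x.1).toOpenPartialHomeomorph.secondCountableTopology_source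
  refine secondCountableTopology_of_countable_cover
    (fun x : s => (trivializationAt F Z x.1).open_source) (eq_univ_of_forall fun p => ?_)
  obtain ⟨x, hx, hpx⟩ := mem_iUnion₂.1 (h_cover ▸ mem_univ p.1)
  exact mem_iUnion.2 ⟨⟨x, hx⟩, (Trivialization.mem_source _).2 hpx⟩

end BundleTopology

section Embedding

variable {E : Type*} [NormedAddCommGroup E] [NormedSpace ℝ E] [FiniteDimensional ℝ E]
  {H : Type*} [TopologicalSpace H] {I : ModelWithCorners ℝ E H} [I.Boundaryless]
  {M : Type*} [TopologicalSpace M] [ChartedSpace H M] [IsManifold I ∞ M]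
  {L : DiracStructure I M} {k : ℕ}

namespace DiracStructure

theorem EmbedsCoisotropically.exists_forall_charRank_eq [PreconnectedSpace M]
    (h : L.EmbedsCoisotropically) : ∃ k : ℕ, ∀ x, L.charRank x = k := by
  rcases isEmpty_or_nonempty M with _ | ⟨⟨x₀⟩⟩
  · exact ⟨0, fun x => isEmptyElim x⟩
  · exact ⟨L.charRank x₀, fun x =>
      h.isLocallyConstant_charRank.apply_eq_of_preconnectedSpace x x₀⟩

variable [T2Space M] [SecondCountableTopology M]

theorem IsPoissonNeighbourhood.embedsCoisotropically [L.CharDualBundle k]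
    {V : Π x : M, Submodule ℝ (TangentSpace I x)} {hV : L.IsSmoothComplement V}
    {U : Opens (L.CharDualTotal k)} (hU : IsPoissonNeighbourhood k hV U) :
    L.EmbedsCoisotropically := by
  obtain ⟨h0, S, -, hS⟩ := hU
  have := t2Space_totalSpace (EuclideanSpace ℝ (Fin k)) L.CharDual
  have := secondCountableTopology_totalSpace (EuclideanSpace ℝ (Fin k)) L.CharDual
  exact ⟨E × EuclideanSpace ℝ (Fin k), inferInstance, inferInstance, inferInstance,
    ModelProd H (EuclideanSpace ℝ (Fin k)), inferInstance,
    I.prod 𝓘(ℝ, EuclideanSpace ℝ (Fin k)), inferInstance, U, inferInstance, inferInstance,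
    inferInstance, inferInstance, inferInstance, S, _, hS⟩

theorem exists_isSmoothComplement_and_charDualBundle (L : DiracStructure I M)
    (hk : ∀ x, L.charRank x = k) :
    (∃ V : Π x : M, Submodule ℝ (TangentSpace I x), L.IsSmoothComplement V) ∧
    ∃ _ : L.CharDualBundle k,
      ∀ (V : Π x : M, Submodule ℝ (TangentSpace I x)) (hV : L.IsSmoothComplement V),
        ∃ U : Opens (L.CharDualTotal k), IsPoissonNeighbourhood k hV U := by
  have := I.locallyCompactSpace
  have := ChartedSpace.locallyCompactSpace H M
  have hN (x : M) : L.charRank x = Module.finrank ℝ (EuclideanSpace ℝ (Fin k)) :=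
    (hk x).trans finrank_euclideanSpace_fin.symm
  let f (x₀ : M) := (L.nonempty_charFrame hN x₀).some
  exact ⟨exists_isSmoothComplement f hN, charDualBundle f, fun V hV =>
    let _ := charDualBundle f
    exists_isPoissonNeighbourhood (isFrameFamily_charDualBundle f) hV⟩

end DiracStructure

end Embedding

end DiracGeom

end

theorem mainTheorem3_general {E : Type*} [NormedAddCommGroup E] [NormedSpace ℝ E]
    [FiniteDimensional ℝ E] {H : Type*} [TopologicalSpace H] {I : ModelWithCorners ℝ E H}
    [I.Boundaryless] {M : Type*} [TopologicalSpace M] [T2Space M] [SecondCountableTopology M]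
    [ChartedSpace H M] [IsManifold I ∞ M] (L : DiracGeom.DiracStructure I M) :
    (PreconnectedSpace M → (L.EmbedsCoisotropically ↔ ∃ k : ℕ, ∀ x, L.charRank x = k)) ∧
    (L.EmbedsCoisotropically → IsLocallyConstant L.charRank) ∧
    (∀ k : ℕ, (∀ x, L.charRank x = k) →
      L.EmbedsCoisotropically ∧
      (∃ V : Π x : M, Submodule ℝ (TangentSpace I x), L.IsSmoothComplement V) ∧
      ∃ _ : L.CharDualBundle k,
        ∀ (V : Π x : M, Submodule ℝ (TangentSpace I x)) (hV : L.IsSmoothComplement V),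
          ∃ U : TopologicalSpace.Opens (L.CharDualTotal k),
            DiracGeom.DiracStructure.IsPoissonNeighbourhood k hV U) := by
  have h_embeds {k : ℕ} (hk : ∀ x, L.charRank x = k) : L.EmbedsCoisotropically := by
    obtain ⟨⟨V, hV⟩, _, h_nhds⟩ := L.exists_isSmoothComplement_and_charDualBundle hk
    exact (h_nhds V hV).choose_spec.embedsCoisotropically
  exact ⟨fun _ => ⟨fun h => h.exists_forall_charRank_eq, fun ⟨_, hk⟩ => h_embeds hk⟩,
    fun h => h.isLocallyConstant_charRank,
    fun _ hk => ⟨h_embeds hk, L.exists_isSmoothComplement_and_charDualBundle hk⟩⟩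

theorem mainTheorem3 {n : ℕ} {M : Type*} [TopologicalSpace M] [T2Space M]
    [SecondCountableTopology M] [ChartedSpace (EuclideanSpace ℝ (Fin n)) M] [IsManifold (𝓡 n) ∞ M]
    (L : DiracGeom.DiracStructure (𝓡 n) M) :
    (PreconnectedSpace M → (L.EmbedsCoisotropically ↔ ∃ k : ℕ, ∀ x, L.charRank x = k)) ∧
    (L.EmbedsCoisotropically → IsLocallyConstant L.charRank) ∧
    (∀ k : ℕ, (∀ x, L.charRank x = k) →
      L.EmbedsCoisotropically ∧
      (∃ V : Π x : M, Submodule ℝ (TangentSpace (𝓡 n) x), L.IsSmoothComplement V) ∧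
      ∃ _ : L.CharDualBundle k,
        ∀ (V : Π x : M, Submodule ℝ (TangentSpace (𝓡 n) x)) (hV : L.IsSmoothComplement V),
          ∃ U : TopologicalSpace.Opens (L.CharDualTotal k),
            DiracGeom.DiracStructure.IsPoissonNeighbourhood k hV U) :=
  mainTheorem3_general L
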